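/- Let $n\ge 1$ and let $\mathbb H^n=\mathbb C^n\times\mathbb R$ be the Heisenberg group with group law $(z,t)(w,s)=\big(z+w,\,t+s+\tfrac12\operatorname{Im}(z\cdot\bar w)\big)$ and Haar measure $dz\,dt$ (Lebesgue measure). For $\lambda\in\mathbb R\setminus\{0\}$ let $\pi_\lambda$ be the Schrödinger representation on $L^2(\mathbb R^n)$, $$\pi_\lambda(z,t)\varphi(\xi)=e^{i\lambda t}e^{i\lambda(x\cdot\xi+\frac12x\cdot y)}\varphi(\xi+y),\qquad z=x+iy,$$ let $\hat f(\lambda)=\int_{\mathbb H^n}f(z,t)\,\pi_\lambda(z,t)\,dz\,dt$ be the group Fourier transform of $f\in L^1(\mathbb H^n)$, a bounded operator on $L^2(\mathbb R^n)$, and let $H(\lambda)=-\Delta+\lambda^2|\xi|^2$ be the scaled Hermite operator, a positive self-adjoint operator on $L^2(\mathbb R^n)$. Let $\Theta:[0,\infty)\to[0,\infty)$ be a nonincreasing function with $\Theta(\lambda)\to0$ as $\lambda\to\infty$. Then the following are equivalent. (i) There exist a nonzero compactly supported continuous function $f:\mathbb H^n\to\mathbb C$ and a constant $C$ such that, for all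 $\lambda\in\mathbb R\setminus\{0\}$, $$\hat f(\lambda)^*\hat f(\lambda)\le C\,e^{-2|\lambda|\,\Theta(|\lambda|)}\,e^{-2\sqrt{H(\lambda)}\,\Theta(\sqrt{H(\lambda)})}$$ in the sense of the order of bounded self-adjoint operators on $L^2(\mathbb R^n)$, the last factor being defined by the functional calculus of $H(\lambda)$. (ii) $\displaystyle\int_1^\infty\frac{\Theta(t)}{t}\,dt<\infty$. -/

import Mathlib

open MeasureTheory Filter Topology
open scoped NNReal ENNReal SchwartzMap InnerProductSpace

noncomputable section

/-! ### The Heisenberg group and its Schrödinger representations -/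

/-- The underlying space `ℂⁿ × ℝ` of the Heisenberg group `ℍⁿ`, whose group law is
`(z, t) (w, s) = (z + w, t + s + Im (z · w̄) / 2)`. Its topology is the product topology and its
Haar measure is the Lebesgue measure `dz dt`, the standard `volume` on this type. -/
abbrev Heis (n : ℕ) : Type := (Fin n → ℂ) × ℝ

/-- The Hilbert space `L²(ℝⁿ)` of complex valued functions. -/
abbrev L2 (n : ℕ) : Type := Lp ℂ 2 (volume : Measure (EuclideanSpace ℝ (Fin n)))

/-- The vector `y = Im z ∈ ℝⁿ` of a point `(z, t)`, `z = x + i y`. -/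
def Heis.im {n : ℕ} (p : Heis n) : EuclideanSpace ℝ (Fin n) := WithLp.toLp 2 fun j => (p.1 j).im

/-- The vector `x = Re z ∈ ℝⁿ` of a point `(z, t)`, `z = x + i y`. -/
def Heis.re {n : ℕ} (p : Heis n) : EuclideanSpace ℝ (Fin n) := WithLp.toLp 2 fun j => (p.1 j).re

/-- The unimodular factor `exp (iλt) exp (iλ (x · ξ + x · y / 2))`, where `p = (x + i y, t)`. -/
def schrodingerPhase {n : ℕ} (lam : ℝ) (p : Heis n) (ξ : EuclideanSpace ℝ (Fin n)) : ℂ :=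
  Complex.exp (Complex.I * ((lam * p.2 : ℝ) : ℂ)) *
    Complex.exp (Complex.I * ((lam * (⟪p.re, ξ⟫_ℝ + 1 / 2 * ⟪p.re, p.im⟫_ℝ) : ℝ) : ℂ))

theorem norm_schrodingerPhase {n : ℕ} (lam : ℝ) (p : Heis n) (ξ : EuclideanSpace ℝ (Fin n)) :
    ‖schrodingerPhase lam p ξ‖ = 1 := by
  rw [schrodingerPhase, norm_mul, Complex.norm_exp_I_mul_ofReal, Complex.norm_exp_I_mul_ofReal,
    one_mul]

theorem Heis.continuous_re {n : ℕ} : Continuous (Heis.re : Heis n → _) := by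
  unfold Heis.re
  fun_prop

theorem Heis.continuous_im {n : ℕ} : Continuous (Heis.im : Heis n → _) := by
  unfold Heis.im
  fun_prop

theorem continuous_schrodingerPhase {n : ℕ} (lam : ℝ) :
    Continuous fun q : Heis n × EuclideanSpace ℝ (Fin n) => schrodingerPhase lam q.1 q.2 := by
  have h1 := Heis.continuous_re (n := n)
  have h2 := Heis.continuous_im (n := n)
  unfold schrodingerPhase
  fun_prop

theorem memLp_phase_mul {n : ℕ} (lam : ℝ) (p : Heis n) {g : EuclideanSpace ℝ (Fin n) → ℂ}
    (hg : MemLp g 2) : MemLp (fun ξ => schrodingerPhase lam p ξ * g ξ) 2 := by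
  have hc : Continuous (schrodingerPhase lam p) :=
    (continuous_schrodingerPhase lam).comp (by fun_prop : Continuous fun ξ => (p, ξ))
  refine hg.of_le (hc.aestronglyMeasurable.mul hg.1) (Eventually.of_forall fun ξ => ?_)
  rw [norm_mul, norm_schrodingerPhase, one_mul]

theorem memLp_translate {n : ℕ} (y : EuclideanSpace ℝ (Fin n)) (φ : L2 n) :
    MemLp (fun ξ => φ (ξ + y)) 2 :=
  (Lp.memLp φ).comp_measurePreserving (measurePreserving_add_right volume y)

/-- The Schrödinger representation
`(π_λ(z, t) φ)(ξ) = exp (iλt) exp (iλ (x · ξ + x · y / 2)) φ(ξ + y)`, `z = x + i y`, where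
`π_λ(z, t)` is an isometry of `L²(ℝⁿ)`. -/
def schrodinger {n : ℕ} (lam : ℝ) (p : Heis n) : L2 n →ₗᵢ[ℂ] L2 n where
  toFun φ := (memLp_phase_mul lam p (memLp_translate p.im φ)).toLp
    (fun ξ => schrodingerPhase lam p ξ * φ (ξ + p.im))
  map_add' φ ψ := by
    rw [← MemLp.toLp_add, MemLp.toLp_eq_toLp_iff]
    filter_upwards [(measurePreserving_add_right volume p.im).quasiMeasurePreserving.ae
      (Lp.coeFn_add φ ψ)] with ξ h
    simp only [Pi.add_apply] at h ⊢
    rw [h, mul_add]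
  map_smul' c φ := by
    rw [RingHom.id_apply, ← MemLp.toLp_const_smul, MemLp.toLp_eq_toLp_iff]
    filter_upwards [(measurePreserving_add_right volume p.im).quasiMeasurePreserving.ae
      (Lp.coeFn_smul c φ)] with ξ h
    simp only [Pi.smul_apply, smul_eq_mul] at h ⊢
    rw [h]
    ring
  norm_map' φ := by
    change ‖(memLp_phase_mul lam p (memLp_translate p.im φ)).toLp _‖ = ‖φ‖
    rw [Lp.norm_toLp, Lp.norm_def]
    congr 1
    rw [eLpNorm_congr_norm_ae (g := fun ξ => φ (ξ + p.im))
      (Eventually.of_forall fun ξ => by rw [norm_mul, norm_schrodingerPhase, one_mul])]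
    exact eLpNorm_comp_measurePreserving (Lp.aestronglyMeasurable φ)
      (measurePreserving_add_right volume p.im)

theorem coeFn_schrodinger {n : ℕ} (lam : ℝ) (p : Heis n) (φ : L2 n) :
    schrodinger lam p φ =ᵐ[volume] fun ξ => schrodingerPhase lam p ξ * φ (ξ + p.im) :=
  MemLp.coeFn_toLp (memLp_phase_mul lam p (memLp_translate p.im φ))

/-- Multiplication by the phase is strongly continuous. -/
theorem continuous_phase_mul {n : ℕ} (lam : ℝ) (φ : L2 n) :
    Continuous fun p : Heis n => (memLp_phase_mul lam p (Lp.memLp φ)).toLp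
      (fun ξ => schrodingerPhase lam p ξ * φ ξ) := by
  rw [continuous_iff_continuousAt]
  intro p
  rw [ContinuousAt, tendsto_iff_norm_sub_tendsto_zero]
  have hcont : ∀ q : Heis n, Continuous (schrodingerPhase lam q) := fun q =>
    (continuous_schrodingerPhase lam).comp (by fun_prop : Continuous fun ξ => (q, ξ))
  have hint : Integrable (fun ξ => ‖φ ξ‖ ^ 2) volume := (Lp.memLp φ).integrable_norm_pow (by simp)
  have key : Tendsto (fun q : Heis n =>
      ∫ ξ, ‖schrodingerPhase lam q ξ - schrodingerPhase lam p ξ‖ ^ 2 * ‖φ ξ‖ ^ 2) (𝓝 p)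
      (𝓝 (∫ _ : EuclideanSpace ℝ (Fin n), (0 : ℝ))) := by
    refine tendsto_integral_filter_of_dominated_convergence (fun ξ => 4 * ‖φ ξ‖ ^ 2)
      (Eventually.of_forall fun q => ?_) (Eventually.of_forall fun q =>
        Eventually.of_forall fun ξ => ?_) (hint.const_mul 4) (Eventually.of_forall fun ξ => ?_)
    · exact (((hcont q).sub (hcont p)).norm.pow 2).aestronglyMeasurable.mul
        hint.aestronglyMeasurable
    · rw [Real.norm_of_nonneg (by positivity)]
      gcongr
      have h := norm_sub_le (schrodingerPhase lam q ξ) (schrodingerPhase lam p ξ)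
      rw [norm_schrodingerPhase, norm_schrodingerPhase] at h
      nlinarith [norm_nonneg (schrodingerPhase lam q ξ - schrodingerPhase lam p ξ)]
    · have h1 : Continuous fun q : Heis n => schrodingerPhase lam q ξ :=
        (continuous_schrodingerPhase lam).comp (by fun_prop : Continuous fun q => (q, ξ))
      have h2 : Continuous fun q : Heis n =>
          ‖schrodingerPhase lam q ξ - schrodingerPhase lam p ξ‖ ^ 2 * ‖φ ξ‖ ^ 2 := by fun_prop
      have h3 := h2.tendsto p
      simpa using h3
  have key2 := key.sqrt
  simp only [integral_zero, Real.sqrt_zero] at key2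
  refine key2.congr fun q => ?_
  rw [← MemLp.toLp_sub, Lp.norm_toLp]
  have hm := (memLp_phase_mul lam q (Lp.memLp φ)).sub (memLp_phase_mul lam p (Lp.memLp φ))
  rw [hm.eLpNorm_eq_integral_rpow_norm (by simp) (by simp), ENNReal.toReal_ofReal (by positivity)]
  simp only [ENNReal.toReal_ofNat, Real.rpow_ofNat, Pi.sub_apply, ← sub_mul, norm_mul, mul_pow]
  rw [Real.sqrt_eq_rpow, one_div]

/-- The Schrödinger representation is strongly continuous. -/
theorem continuous_schrodinger {n : ℕ} (lam : ℝ) (φ : L2 n) :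
    Continuous fun p : Heis n => schrodinger lam p φ := by
  let τ : Heis n → L2 n := fun p =>
    Lp.compMeasurePreserving (· + p.im) (measurePreserving_add_right volume p.im) φ
  have hτ : Continuous τ := by
    have hg : Continuous fun q : Heis n × EuclideanSpace ℝ (Fin n) => q.2 + q.1.im :=
      continuous_snd.add (Heis.continuous_im.comp continuous_fst)
    exact continuous_const.compMeasurePreservingLp (f := fun _ : Heis n => φ)
      (g := (ContinuousMap.mk _ hg).curry) (ContinuousMap.continuous _)
      (fun p => measurePreserving_add_right volume p.im) (by simp)
  have hdiff : ∀ p q : Heis n, ‖schrodinger lam p φ -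
      (memLp_phase_mul lam p (Lp.memLp (τ q))).toLp (fun ξ => schrodingerPhase lam p ξ * τ q ξ)‖
      = ‖τ p - τ q‖ := by
    intro p q
    rw [Lp.norm_def, Lp.norm_def]
    congr 1
    refine eLpNorm_congr_norm_ae ?_
    filter_upwards [Lp.coeFn_sub (schrodinger lam p φ)
      ((memLp_phase_mul lam p (Lp.memLp (τ q))).toLp _), Lp.coeFn_sub (τ p) (τ q),
      coeFn_schrodinger lam p φ, (memLp_phase_mul lam p (Lp.memLp (τ q))).coeFn_toLp,
      Lp.coeFn_compMeasurePreserving φ (measurePreserving_add_right volume p.im)]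
      with ξ h1 h2 h3 h4 h5
    rw [h1, h2, Pi.sub_apply, Pi.sub_apply, h3, h4, ← one_mul ‖τ p ξ - τ q ξ‖,
      ← norm_schrodingerPhase lam p ξ, ← norm_mul, mul_sub]
    congr 3
    exact h5.symm
  rw [continuous_iff_continuousAt]
  intro p
  rw [ContinuousAt, tendsto_iff_norm_sub_tendsto_zero]
  have ha := tendsto_iff_norm_sub_tendsto_zero.1 (hτ.tendsto p)
  have hb := tendsto_iff_norm_sub_tendsto_zero.1 ((continuous_phase_mul lam (τ p)).tendsto p)
  have hab := ha.add hb
  rw [add_zero] at hab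
  refine squeeze_zero (fun _ => norm_nonneg _) (fun q => ?_) hab
  have h0 : schrodinger lam p φ = (memLp_phase_mul lam p (Lp.memLp (τ p))).toLp
      (fun ξ => schrodingerPhase lam p ξ * τ p ξ) := by
    rw [← sub_eq_zero, ← norm_eq_zero, hdiff p p, sub_self, norm_zero]
  rw [h0, ← hdiff q p]
  exact norm_sub_le_norm_sub_add_norm_sub _ _ _

/-- The group Fourier transform `f̂(λ) = ∫ f(z, t) π_λ(z, t) dz dt` of `f ∈ L¹(ℍⁿ)`, a bounded
operator on `L²(ℝⁿ)`; the operator valued integral is taken in the strong sense, that is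
`f̂(λ) φ = ∫ f(z, t) π_λ(z, t) φ dz dt` is a Bochner integral in `L²(ℝⁿ)`. -/
def heisFourier {n : ℕ} (f : Heis n → ℂ) (hf : Integrable f) (lam : ℝ) : L2 n →L[ℂ] L2 n :=
  have hint : ∀ φ : L2 n, Integrable fun p => f p • schrodinger lam p φ := fun φ =>
    (hf.norm.mul_const ‖φ‖).mono'
      (hf.aestronglyMeasurable.smul (continuous_schrodinger lam φ).aestronglyMeasurable)
      (Eventually.of_forall fun p => by rw [norm_smul, LinearIsometry.norm_map])
  LinearMap.mkContinuous
    { toFun := fun φ => ∫ p, f p • schrodinger lam p φ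
      map_add' := fun φ ψ => by
        simp only [map_add, smul_add]
        exact integral_add (hint φ) (hint ψ)
      map_smul' := fun c φ => by
        simp only [map_smul, smul_comm _ c, RingHom.id_apply]
        exact integral_smul c _ }
    (∫ p, ‖f p‖) fun φ => by
      refine (norm_integral_le_integral_norm _).trans (le_of_eq ?_)
      simp only [norm_smul, LinearIsometry.norm_map]
      exact integral_mul_const _ _

theorem heisFourier_apply {n : ℕ} (f : Heis n → ℂ) (hf : Integrable f) (lam : ℝ) (φ : L2 n) :
    heisFourier f hf lam φ = ∫ p, f p • schrodinger lam p φ := rfl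

/-! ### The Hermite operator and its functional calculus -/

/-- The scaled Hermite operator `H(λ) = -Δ + λ² |ξ|²` on the Schwartz space of `ℝⁿ`, where it is
essentially self-adjoint in `L²(ℝⁿ)`. -/
def hermiteOp (n : ℕ) (lam : ℝ) :
    𝓢(EuclideanSpace ℝ (Fin n), ℂ) →L[ℂ] 𝓢(EuclideanSpace ℝ (Fin n), ℂ) :=
  -LineDeriv.laplacianCLM ℂ (EuclideanSpace ℝ (Fin n)) 𝓢(EuclideanSpace ℝ (Fin n), ℂ) +
    SchwartzMap.smulLeftCLM ℂ
      fun ξ : EuclideanSpace ℝ (Fin n) => ((lam ^ 2 * ‖ξ‖ ^ 2 : ℝ) : ℂ)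

open Laplacian in
theorem hermiteOp_apply (n : ℕ) (lam : ℝ) (g : 𝓢(EuclideanSpace ℝ (Fin n), ℂ))
    (ξ : EuclideanSpace ℝ (Fin n)) :
    hermiteOp n lam g ξ =
      -Δ (g : EuclideanSpace ℝ (Fin n) → ℂ) ξ + ((lam ^ 2 * ‖ξ‖ ^ 2 : ℝ) : ℂ) * g ξ := by
  have hg : Function.HasTemperateGrowth
      fun ξ : EuclideanSpace ℝ (Fin n) => ((lam ^ 2 * ‖ξ‖ ^ 2 : ℝ) : ℂ) := by
    fun_prop
  rw [← SchwartzMap.laplacian_apply]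
  have h := SchwartzMap.smulLeftCLM_apply_apply hg g ξ
  rw [hermiteOp, _root_.add_apply, _root_.add_apply, h, smul_eq_mul,
    _root_.neg_apply, SchwartzMap.laplacianCLM_eq, _root_.neg_apply]

theorem hermiteOp_symmetric (n : ℕ) (lam : ℝ) (g h : 𝓢(EuclideanSpace ℝ (Fin n), ℂ)) :
    ⟪(hermiteOp n lam g).toLp 2, h.toLp 2⟫_ℂ = ⟪g.toLp 2, (hermiteOp n lam h).toLp 2⟫_ℂ := by
  let L : ℂ →L[ℝ] ℂ →L[ℝ] ℂ :=
    (ContinuousLinearMap.mul ℝ ℂ).comp (Complex.conjCLE : ℂ →L[ℝ] ℂ)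
  have hL : ∀ a b : 𝓢(EuclideanSpace ℝ (Fin n), ℂ),
      ⟪a.toLp 2, b.toLp 2⟫_ℂ = ∫ ξ, L (a ξ) (b ξ) := by
    intro a b
    rw [L2.inner_def]
    refine integral_congr_ae ?_
    filter_upwards [a.coeFn_toLp 2 volume, b.coeFn_toLp 2 volume] with ξ h1 h2
    rw [h1, h2]
    simp [L, RCLike.inner_apply, mul_comm]
  have hint : ∀ a b : 𝓢(EuclideanSpace ℝ (Fin n), ℂ), Integrable fun ξ => L (a ξ) (b ξ) :=
    fun a b => (SchwartzMap.pairing L a b).integrable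
  have hw : Function.HasTemperateGrowth
      fun ξ : EuclideanSpace ℝ (Fin n) => ((lam ^ 2 * ‖ξ‖ ^ 2 : ℝ) : ℂ) := by
    fun_prop
  rw [hL, hL]
  simp only [hermiteOp, _root_.add_apply, _root_.neg_apply,
    SchwartzMap.laplacianCLM_eq, map_add, map_neg]
  rw [integral_add (hint _ h).fun_neg (hint _ h), integral_add (hint g _).fun_neg (hint g _),
    integral_neg, integral_neg, SchwartzMap.integral_bilinear_laplacian_right_eq_left]
  congr 1
  refine integral_congr_ae (Eventually.of_forall fun ξ => ?_)
  simp only [SchwartzMap.smulLeftCLM_apply_apply hw, smul_eq_mul, L,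
    ContinuousLinearMap.comp_apply, ContinuousLinearMap.mul_apply',
    ContinuousLinearEquiv.coe_coe, Complex.conjCLE_apply, map_mul, Complex.conj_ofReal]
  ring

/-- The (closed) eigenspace `{g ∈ L²(ℝⁿ) : H(λ) g = μ g}`. -/
def hermiteEigenspace (n : ℕ) (lam μ : ℝ) : Submodule ℂ (L2 n) :=
  ((LinearMap.ker ((hermiteOp n lam - (μ : ℂ) • ContinuousLinearMap.id ℂ _ :
    𝓢(EuclideanSpace ℝ (Fin n), ℂ) →L[ℂ] 𝓢(EuclideanSpace ℝ (Fin n), ℂ)) :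
      𝓢(EuclideanSpace ℝ (Fin n), ℂ) →ₗ[ℂ] 𝓢(EuclideanSpace ℝ (Fin n), ℂ))).map
    (SchwartzMap.toLpCLM ℂ ℂ 2 (volume : Measure (EuclideanSpace ℝ (Fin n))) :
      𝓢(EuclideanSpace ℝ (Fin n), ℂ) →ₗ[ℂ] L2 n)).topologicalClosure

instance (n : ℕ) (lam μ : ℝ) : CompleteSpace (hermiteEigenspace n lam μ) :=
  (Submodule.isClosed_topologicalClosure _).completeSpace_coe

theorem hermiteEigenspace_orthogonal (n : ℕ) (lam : ℝ) :
    OrthogonalFamily ℂ (fun μ : ℝ => hermiteEigenspace n lam μ)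
      fun μ => (hermiteEigenspace n lam μ).subtypeₗᵢ := by
  refine OrthogonalFamily.of_pairwise fun μ ν hne => ?_
  change hermiteEigenspace n lam μ ⟂ hermiteEigenspace n lam ν
  rw [hermiteEigenspace, hermiteEigenspace, Submodule.isOrtho_iff_le,
    Submodule.orthogonal_closure]
  refine Submodule.topologicalClosure_minimal _ ?_ (Submodule.isClosed_orthogonal _)
  rw [← Submodule.isOrtho_iff_le, Submodule.isOrtho_iff_inner_eq]
  rintro _ ⟨g, hg, rfl⟩ _ ⟨h, hh, rfl⟩
  have hg' : hermiteOp n lam g = (μ : ℂ) • g := by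
    simpa [sub_eq_zero] using hg
  have hh' : hermiteOp n lam h = (ν : ℂ) • h := by
    simpa [sub_eq_zero] using hh
  have key := hermiteOp_symmetric n lam g h
  rw [hg', hh', ← SchwartzMap.toLpCLM_apply (𝕜 := ℂ), ← SchwartzMap.toLpCLM_apply (𝕜 := ℂ),
    ← SchwartzMap.toLpCLM_apply (𝕜 := ℂ), ← SchwartzMap.toLpCLM_apply (𝕜 := ℂ),
    map_smul, map_smul, inner_smul_left, inner_smul_right, Complex.conj_ofReal, ← sub_eq_zero,
    ← sub_mul] at key
  refine (mul_eq_zero.1 key).resolve_left ?_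
  exact_mod_cast sub_ne_zero.2 hne

theorem summable_spectral (n : ℕ) (lam : ℝ) (m : ℝ → ℝ) (M : ℝ) (hm : ∀ μ, |m μ| ≤ M)
    (φ : L2 n) :
    Summable (fun μ : ℝ => (m μ : ℂ) • (hermiteEigenspace n lam μ).starProjection φ) ∧
      ‖∑' μ : ℝ, (m μ : ℂ) • (hermiteEigenspace n lam μ).starProjection φ‖ ≤ M * ‖φ‖ := by
  have hV := hermiteEigenspace_orthogonal n lam
  have hM : 0 ≤ M := (abs_nonneg _).trans (hm 0)
  let v : ∀ μ : ℝ, hermiteEigenspace n lam μ := fun μ =>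
    ⟨(hermiteEigenspace n lam μ).starProjection φ, Submodule.starProjection_apply_mem _ _⟩
  have hbessel : ∀ s : Finset ℝ, ∑ μ ∈ s, ‖v μ‖ ^ 2 ≤ ‖φ‖ ^ 2 := by
    intro s
    have h1 : ‖∑ μ ∈ s, (v μ : L2 n)‖ ^ 2 = ∑ μ ∈ s, ‖v μ‖ ^ 2 := hV.norm_sum v s
    have h2 : ⟪φ, ∑ μ ∈ s, (v μ : L2 n)⟫_ℂ = ((∑ μ ∈ s, ‖v μ‖ ^ 2 : ℝ) : ℂ) := by
      rw [inner_sum, Complex.ofReal_sum]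
      refine Finset.sum_congr rfl fun μ _ => ?_
      have h := Submodule.starProjection_inner_eq_zero (K := hermiteEigenspace n lam μ) φ
        (v μ : L2 n) (v μ).2
      rw [inner_sub_left, sub_eq_zero] at h
      rw [h]
      exact (inner_self_eq_norm_sq_to_K (𝕜 := ℂ) (v μ : L2 n)).trans (by norm_cast)
    have h3 := norm_inner_le_norm (𝕜 := ℂ) φ (∑ μ ∈ s, (v μ : L2 n))
    rw [h2, ← h1, Complex.norm_real, Real.norm_of_nonneg (by positivity)] at h3
    rw [← h1]
    have h4 : ‖∑ μ ∈ s, (v μ : L2 n)‖ ≤ ‖φ‖ := by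
      rcases (norm_nonneg (∑ μ ∈ s, (v μ : L2 n))).eq_or_lt with h0 | h0
      · rw [← h0]
        exact norm_nonneg _
      · nlinarith
    gcongr
  have hfin : ∀ s : Finset ℝ,
      ∑ μ ∈ s, ‖(m μ : ℂ) • v μ‖ ^ 2 ≤ (M * ‖φ‖) ^ 2 := by
    intro s
    calc ∑ μ ∈ s, ‖(m μ : ℂ) • v μ‖ ^ 2 ≤ ∑ μ ∈ s, M ^ 2 * ‖v μ‖ ^ 2 := by
          refine Finset.sum_le_sum fun μ _ => ?_
          rw [norm_smul, Complex.norm_real, Real.norm_eq_abs, mul_pow]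
          gcongr
          exact hm μ
      _ = M ^ 2 * ∑ μ ∈ s, ‖v μ‖ ^ 2 := by rw [Finset.mul_sum]
      _ ≤ M ^ 2 * ‖φ‖ ^ 2 := by
          gcongr
          exact hbessel s
      _ = (M * ‖φ‖) ^ 2 := by ring
  have hsum : Summable fun μ : ℝ =>
      (m μ : ℂ) • (hermiteEigenspace n lam μ).starProjection φ :=
    (hV.summable_iff_norm_sq_summable fun μ => (m μ : ℂ) • v μ).2
      (summable_of_sum_le (fun _ => by positivity) hfin)
  refine ⟨hsum, le_of_tendsto hsum.hasSum.norm (Eventually.of_forall fun s => ?_)⟩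
  refine le_of_sq_le_sq ?_ (by positivity)
  exact (hV.norm_sum (fun μ => (m μ : ℂ) • v μ) s).trans_le (hfin s)

/-- The bounded operator `m(H(λ)) = ∑_μ m(μ) P_μ` on `L²(ℝⁿ)` for a bounded function `m`, where
`P_μ` is the orthogonal projection onto the eigenspace of `H(λ)` with eigenvalue `μ` and the sum
converges strongly. As `L²(ℝⁿ)` is the Hilbert sum of these eigenspaces, this is the functional
calculus of the self-adjoint operator `H(λ)`. -/
def hermiteCalculus (n : ℕ) (lam : ℝ) (m : ℝ → ℝ) (hm : ∃ M, ∀ μ, |m μ| ≤ M) : L2 n →L[ℂ] L2 n :=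
  LinearMap.mkContinuousOfExistsBound
    { toFun := fun φ => ∑' μ : ℝ, (m μ : ℂ) • (hermiteEigenspace n lam μ).starProjection φ
      map_add' := fun φ ψ => by
        obtain ⟨M, hM⟩ := hm
        simp only [map_add, smul_add]
        exact (summable_spectral n lam m M hM φ).1.tsum_add (summable_spectral n lam m M hM ψ).1
      map_smul' := fun c φ => by
        obtain ⟨M, hM⟩ := hm
        simp only [map_smul, smul_comm _ c, RingHom.id_apply]
        exact (summable_spectral n lam m M hM φ).1.tsum_const_smul c }
    (hm.imp fun M hM φ => (summable_spectral n lam m M hM φ).2)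

/-- The symbol `μ ↦ exp (-2 √μ Θ(√μ))`. -/
def inghamSymbol (Θ : ℝ≥0 → ℝ≥0) (μ : ℝ) : ℝ :=
  Real.exp (-2 * √μ * Θ (√μ).toNNReal)

theorem inghamSymbol_bounded (Θ : ℝ≥0 → ℝ≥0) : ∃ M, ∀ μ, |inghamSymbol Θ μ| ≤ M := by
  refine ⟨1, fun μ => ?_⟩
  rw [inghamSymbol, abs_of_pos (Real.exp_pos _), Real.exp_le_one_iff]
  have : 0 ≤ √μ * (Θ (√μ).toNNReal : ℝ) := by positivity
  linarith

/-- The decay condition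
`f̂(λ)* f̂(λ) ≤ C exp (-2 |λ| Θ(|λ|)) exp (-2 √H(λ) Θ(√H(λ)))` for all `λ ≠ 0`, with one constant
`C`; the inequality is that of bounded self-adjoint operators on `L²(ℝⁿ)`. -/
def InghamDecay {n : ℕ} (Θ : ℝ≥0 → ℝ≥0) (f : Heis n → ℂ) (hf : Integrable f) : Prop :=
  ∃ C : ℝ, ∀ lam : ℝ, lam ≠ 0 →
    (heisFourier f hf lam).adjoint ∘L heisFourier f hf lam ≤
      ((C * Real.exp (-2 * |lam| * Θ |lam|.toNNReal) : ℝ) : ℂ) •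
        hermiteCalculus n lam (inghamSymbol Θ) (inghamSymbol_bounded Θ)

end

/-!
Both conditions are equivalent to the convergence of `∑ Θ(2 ^ k)`. For the integral this is
condensation (`integrableOn_div_iff_summable_dyadic`).

Decay forces convergence. Fix `λ ≠ 0`. The coherent state `coherent` of frequency `r e`, with
`e` a unit vector, has a Poisson distribution with mean `r² / (2 |λ|)` on the eigenvalues
`(2 j + n) |λ|` of the Hermite operator (`spectralMass_coherent`), so its energy is concentrated at
`μ ≈ r²` and the hypothesis bounds `f̂(λ)` on it by `exp (-|r| Θ(3 |r|) / 2)`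
(`exists_inner_inghamSymbol_coherent_le`). On the other hand, the matrix coefficients of
`f̂(λ)` between a test function and this state are the Fourier transform in `r` of a compactly
supported function (`inner_heisFourier_coherent_eq`), hence extend to an entire function of
exponential type. If `∑ Θ(2 ^ k)` diverges, such a function vanishes
(`eq_zero_of_decay_of_not_summable`): after a Cayley transform, Jensen's inequality and Fatou's
lemma bound its logarithmic integral as soon as it is nonzero at a point of the upper half-plane.
Coherent states are total, so `f̂(λ) = 0` for all `λ ≠ 0`, and `f = 0` by injectivity of the group
Fourier transform (`eq_zero_of_heisFourier_eq_zero`).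

Convergence gives an example. Infinitely many averages over intervals of summable lengths produce a
bump `g` with `|g^(k)| ≤ Λ_l ^ k` for `k ≤ 2 m_l`, where `Λ_l = 2 ^ l / (4 n)` and `m_l` is about `2
^ (l + 1) Θ(2 ^ l) + l` (`exists_bump`, `exists_dyadic_bump`). Let `f` be the product function
`productBump` of the coordinates `(y, x, τ)` of `Heis.ofPolar`. Then `f̂(λ) φ(ξ) = c(λ, ξ) ⟪u_ξ,
φ⟫`, with a multiplier `c` that is a product of one-dimensional Fourier transforms of `g` at `λ` and
`λ ξ_j`, and `u_ξ` the translate to `ξ` of a product of copies of `g`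
(`heisFourier_productBump_eq_inner`). On functions of energy at least `4 ^ l` this is of size `exp
(-|λ| Θ(|λ|)) exp (-m_l)` (`norm_heisFourier_productBump_high_le`): if `|λ|` or some `|λ ξ_j|` is
large compared with `Λ_l`, then `c` is small; otherwise `m_l` powers of `H(λ)` are moved onto `u_ξ`,
where `H(λ)` costs a factor `5 n Λ_l²`, less than `4 ^ l / e` (`SobolevBound.hermiteOp_iterate`).
The remaining factor `exp (-l)` allows summation over the blocks `4 ^ l ≤ μ < 4 ^ (l + 1)`, and the
eigenspaces exhaust `L²(ℝⁿ)` (`hasSum_starProjection_hermiteEigenspace`).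
-/

open scoped LineDeriv

/-! ### The logarithmic integral of a bounded analytic function -/

/-- Jensen's inequality: the zeros of `f` only increase the circle average of `log |f|`. -/
theorem log_norm_le_circleAverage {f : ℂ → ℂ} {R : ℝ} (hR : 0 < R)
    (hf : AnalyticOnNhd ℂ f (Metric.closedBall 0 R)) (h0 : f 0 ≠ 0) :
    Real.log ‖f 0‖ ≤ Real.circleAverage (fun z => Real.log ‖f z‖) 0 R := by
  rw [← abs_of_pos hR] at hf
  rw [AnalyticOnNhd.circleAverage_log_norm hR.ne' hf h0]
  refine le_add_of_nonneg_left (finsum_nonneg fun u => ?_)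
  by_cases hu : u ∈ Metric.closedBall (0 : ℂ) |R|
  · refine mul_nonneg ?_ ?_
    · have := MeromorphicOn.AnalyticOnNhd.divisor_nonneg hf
      exact_mod_cast this u
    · rcases eq_or_ne u 0 with rfl | hu0
      · simp
      · have h1 : ‖u‖ ≤ R := by simpa [abs_of_pos hR] using hu
        have h2 : 0 < ‖u‖ := norm_pos_iff.2 hu0
        rw [zero_sub, norm_neg]
        refine Real.log_nonneg ?_
        rw [← div_eq_mul_inv, le_div_iff₀ h2]
        linarith
  · rw [Function.locallyFinsuppWithin.apply_eq_zero_of_notMem _ hu]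
    simp

theorem ae_ne_zero_circleMap {f : ℂ → ℂ} {R : ℝ} (hR : 0 < R)
    (hf : AnalyticOnNhd ℂ f (Metric.closedBall 0 R)) (h0 : f 0 ≠ 0) :
    ∀ᵐ θ : ℝ, f (circleMap 0 R θ) ≠ 0 := by
  have h1 : ∀ᶠ z in codiscreteWithin (Metric.closedBall (0 : ℂ) R), f z ≠ 0 := by
    have := hf.preimage_zero_mem_codiscreteWithin (x := 0) h0 (by simp [hR.le])
      ⟨⟨0, by simp [hR.le]⟩, (convex_closedBall (0 : ℂ) R).isPreconnected⟩
    filter_upwards [this] with z hz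
    simpa using hz
  have h2 : ∀ᶠ z in codiscreteWithin (Metric.sphere (0 : ℂ) |R|), f z ≠ 0 := by
    rw [abs_of_pos hR]
    exact codiscreteWithin_mono Metric.sphere_subset_closedBall h1
  have h3 := circleMap_preimage_codiscrete hR.ne' h2
  have h4 := ae_restrict_le_codiscreteWithin (μ := volume) MeasurableSet.univ h3
  rw [Measure.restrict_univ] at h4
  exact h4

/-- Fatou's lemma turns Jensen's inequality on the circles `|w| = ρ < 1` into a bound for the
logarithmic integral over the unit circle; `f` is allowed to be singular at `1`. -/
theorem lintegral_decay_circle_lt_top {f : ℂ → ℂ} (hf : DifferentiableOn ℂ f {1}ᶜ)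
    (hb : ∀ w, ‖w‖ < 1 → ‖f w‖ ≤ 1) (h0 : f 0 ≠ 0) (B : ℝ → ℝ)
    (hB : ∀ θ ∈ Set.Ioo 0 (2 * Real.pi), ‖f (circleMap 0 1 θ)‖ ≤ Real.exp (-B θ)) :
    ∫⁻ θ in Set.Ioc 0 (2 * Real.pi), ENNReal.ofReal (B θ) < ∞ := by
  have han : AnalyticOnNhd ℂ f {1}ᶜ := hf.analyticOnNhd isOpen_compl_singleton
  let ρ : ℕ → ℝ := fun k => 1 - 1 / ((k : ℝ) + 2)
  have hρ0 : ∀ k, 0 < ρ k := fun k => by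
    have h1 : 1 / ((k : ℝ) + 2) < 1 := by
      rw [div_lt_one (by positivity)]
      have : (0 : ℝ) ≤ k := k.cast_nonneg
      linarith
    simp only [ρ]
    linarith
  have hρ1 : ∀ k, ρ k < 1 := fun k => by
    have : 0 < 1 / ((k : ℝ) + 2) := by positivity
    simp only [ρ]
    linarith
  have hρ : Tendsto ρ atTop (𝓝 1) := by
    have h1 : Tendsto (fun k : ℕ => 1 / ((k : ℝ) + 2)) atTop (𝓝 0) := by
      refine Tendsto.div_atTop tendsto_const_nhds ?_
      exact tendsto_atTop_add_const_right _ _ tendsto_natCast_atTop_atTop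
    simpa [ρ] using h1.const_sub 1
  have hank : ∀ k, AnalyticOnNhd ℂ f (Metric.closedBall 0 (ρ k)) := fun k =>
    han.mono fun z hz => by
      rintro rfl
      have : (1 : ℝ) ≤ ρ k := by simpa using hz
      linarith [hρ1 k]
  have hnorm : ∀ k θ, ‖circleMap 0 (ρ k) θ‖ < 1 := fun k θ => by
    rw [norm_circleMap_zero, abs_of_pos (hρ0 k)]
    exact hρ1 k
  let g : ℕ → ℝ → ℝ≥0∞ := fun k θ => ENNReal.ofReal (-Real.log ‖f (circleMap 0 (ρ k) θ)‖)
  have hcont : ∀ k, Continuous fun θ => f (circleMap 0 (ρ k) θ) := fun k => by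
    refine (han.continuousOn).comp_continuous (continuous_circleMap 0 (ρ k)) fun θ => ?_
    intro h
    have h2 := hnorm k θ
    rw [Set.mem_singleton_iff.1 h, norm_one] at h2
    exact lt_irrefl _ h2
  have hgm : ∀ k, Measurable (g k) := fun k =>
    ((Real.measurable_log.comp (hcont k).norm.measurable).neg).ennreal_ofReal
  have hgint : ∀ k, ∫⁻ θ in Set.Ioc 0 (2 * Real.pi), g k θ ≤
      ENNReal.ofReal (2 * Real.pi * -Real.log ‖f 0‖) := by
    intro k
    have hci : CircleIntegrable (fun z => Real.log ‖f z‖) 0 (ρ k) := by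
      refine MeromorphicOn.circleIntegrable_log_norm_of_nonneg ?_ (hρ0 k).le
      exact ((hank k).mono Metric.sphere_subset_closedBall).meromorphicOn
    have hint : Integrable (fun θ => -Real.log ‖f (circleMap 0 (ρ k) θ)‖)
        (volume.restrict (Set.Ioc 0 (2 * Real.pi))) := hci.1.neg
    rw [← ofReal_integral_eq_lintegral_ofReal hint]
    · refine ENNReal.ofReal_le_ofReal ?_
      have hj := log_norm_le_circleAverage (hρ0 k) (hank k) h0
      rw [Real.circleAverage_def, smul_eq_mul, intervalIntegral.integral_of_le
        Real.two_pi_pos.le] at hj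
      rw [integral_neg, mul_neg]
      have h2 := Real.two_pi_pos
      refine neg_le_neg ?_
      calc 2 * Real.pi * Real.log ‖f 0‖ ≤ 2 * Real.pi * ((2 * Real.pi)⁻¹ *
            ∫ θ in Set.Ioc 0 (2 * Real.pi), Real.log ‖f (circleMap 0 (ρ k) θ)‖) := by gcongr
        _ = _ := by rw [mul_inv_cancel_left₀ h2.ne']
    · refine Eventually.of_forall fun θ => ?_
      have := Real.log_nonpos (norm_nonneg _) (hb _ (hnorm k θ))
      simpa using this
  have hfatou : ∫⁻ θ in Set.Ioc 0 (2 * Real.pi), liminf (fun k => g k θ) atTop ≤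
      ENNReal.ofReal (2 * Real.pi * -Real.log ‖f 0‖) := by
    refine (lintegral_liminf_le hgm).trans ?_
    exact liminf_le_of_frequently_le' (Frequently.of_forall hgint)
  refine lt_of_le_of_lt ?_ (hfatou.trans_lt ENNReal.ofReal_lt_top)
  refine lintegral_mono_ae ?_
  have hz : ∀ᵐ θ : ℝ, ∀ k, f (circleMap 0 (ρ k) θ) ≠ 0 :=
    ae_all_iff.2 fun k => ae_ne_zero_circleMap (hρ0 k) (hank k) h0
  have h2pi : ∀ᵐ θ : ℝ, θ ≠ 2 * Real.pi := by simp [ae_iff]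
  rw [ae_restrict_iff' measurableSet_Ioc]
  filter_upwards [hz, h2pi] with θ hθ hne hmem
  have hmem' : θ ∈ Set.Ioo 0 (2 * Real.pi) := ⟨hmem.1, lt_of_le_of_ne hmem.2 hne⟩
  have hne1 : circleMap 0 1 θ ≠ 1 := by
    intro h
    rw [circleMap_zero, Complex.ofReal_one, one_mul, Complex.exp_eq_one_iff] at h
    obtain ⟨m, hm⟩ := h
    have hm' : θ = m * (2 * Real.pi) := by
      have := congrArg Complex.im hm
      simpa using this
    rw [hm'] at hmem'
    have hpi := Real.two_pi_pos
    have h1 : (0 : ℝ) < m := by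
      by_contra hcon
      nlinarith [hmem'.1]
    have h2 : (m : ℝ) < 1 := by
      by_contra hcon
      nlinarith [hmem'.2]
    have h3 : (0 : ℤ) < m := by exact_mod_cast h1
    have h4 : m < (1 : ℤ) := by exact_mod_cast h2
    omega
  have hlim : Tendsto (fun k => ‖f (circleMap 0 (ρ k) θ)‖) atTop (𝓝 ‖f (circleMap 0 1 θ)‖) := by
    refine (((han _ hne1).continuousAt).tendsto.comp ?_).norm
    have : Continuous fun r : ℝ => circleMap 0 r θ := by
      unfold circleMap
      fun_prop
    exact (this.tendsto 1).comp hρ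
  refine le_of_forall_lt_imp_le_of_dense fun c hc => ?_
  have hcB : c.toReal < B θ := by
    rw [← ENNReal.ofReal_toReal hc.ne_top] at hc
    exact (ENNReal.ofReal_lt_ofReal_iff_of_nonneg ENNReal.toReal_nonneg).1 hc
  refine le_liminf_of_le (by isBoundedDefault) ?_
  have hlt : ‖f (circleMap 0 1 θ)‖ < Real.exp (-c.toReal) :=
    (hB θ hmem').trans_lt (Real.exp_lt_exp.2 (neg_lt_neg hcB))
  filter_upwards [hlim.eventually (gt_mem_nhds hlt)] with k hk
  rw [← ENNReal.ofReal_toReal hc.ne_top]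
  refine ENNReal.ofReal_le_ofReal ?_
  have := Real.log_lt_log (norm_pos_iff.2 (hθ k)) hk
  rw [Real.log_exp] at this
  linarith

/-- The Cayley transform `w ↦ i (1 + w) / (1 - w)` of the unit disc onto the upper half-plane. -/
noncomputable def cayleyTransform (w : ℂ) : ℂ := Complex.I * ((1 + w) / (1 - w))

theorem cayleyTransform_im_pos {w : ℂ} (hw : ‖w‖ < 1) : 0 < (cayleyTransform w).im := by
  have h1 : (cayleyTransform w).im = (1 - Complex.normSq w) / Complex.normSq (1 - w) := by
    rw [cayleyTransform, Complex.I_mul_im, Complex.div_re]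
    simp only [Complex.add_re, Complex.sub_re, Complex.one_re, Complex.add_im, Complex.sub_im,
      Complex.one_im, Complex.normSq_apply w]
    ring
  have h2 : w ≠ 1 := by
    rintro rfl
    simp at hw
  rw [h1]
  refine div_pos ?_ (Complex.normSq_pos.2 (sub_ne_zero.2 h2.symm))
  rw [Complex.normSq_eq_norm_sq]
  nlinarith [norm_nonneg w]

theorem cayleyTransform_circleMap {θ : ℝ} (h0 : 0 < θ) (h1 : θ < 2 * Real.pi) :
    cayleyTransform (circleMap 0 1 θ) = ((-Real.cot (θ / 2) : ℝ) : ℂ) := by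
  have hs : Real.sin (θ / 2) ≠ 0 :=
    (Real.sin_pos_of_pos_of_lt_pi (by linarith) (by linarith)).ne'
  have hs' : Complex.sin ((θ : ℂ) / 2) ≠ 0 := by
    have : ((Real.sin (θ / 2) : ℝ) : ℂ) ≠ 0 := by exact_mod_cast hs
    simpa using this
  have he : circleMap 0 1 θ = Complex.exp ((θ : ℂ) / 2 * Complex.I) ^ 2 := by
    rw [circleMap_zero, Complex.ofReal_one, one_mul, ← Complex.exp_nat_mul]
    congr 1
    push_cast
    ring
  have hexp : Complex.exp ((θ : ℂ) / 2 * Complex.I) =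
      Complex.cos ((θ : ℂ) / 2) + Complex.sin ((θ : ℂ) / 2) * Complex.I := Complex.exp_mul_I _
  have hsq := Complex.sin_sq_add_cos_sq ((θ : ℂ) / 2)
  have hden : 1 - circleMap 0 1 θ ≠ 0 := by
    intro h
    rw [he, hexp] at h
    have h3 : Complex.sin ((θ : ℂ) / 2) *
        (Complex.sin ((θ : ℂ) / 2) - Complex.cos ((θ : ℂ) / 2) * Complex.I) = 0 := by
      linear_combination (h + (Complex.sin ((θ : ℂ) / 2)) ^ 2 * Complex.I_sq + hsq) / 2
    have h4 := (mul_eq_zero.1 h3).resolve_left hs'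
    have h5 : Complex.sin ((θ : ℂ) / 2) ^ 2 + Complex.cos ((θ : ℂ) / 2) ^ 2 = 0 := by
      linear_combination (Complex.sin ((θ : ℂ) / 2) + Complex.cos ((θ : ℂ) / 2) * Complex.I) * h4
        + Complex.cos ((θ : ℂ) / 2) ^ 2 * Complex.I_sq
    rw [hsq] at h5
    exact one_ne_zero h5
  rw [cayleyTransform, ← mul_div_assoc, div_eq_iff hden, Real.cot_eq_cos_div_sin, he, hexp]
  have hcot : ((-(Real.cos (θ / 2) / Real.sin (θ / 2)) : ℝ) : ℂ) * Complex.sin ((θ : ℂ) / 2) =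
      -Complex.cos ((θ : ℂ) / 2) := by
    push_cast
    field_simp
  refine mul_right_cancel₀ hs' ?_
  rw [mul_right_comm (((-(Real.cos (θ / 2) / Real.sin (θ / 2)) : ℝ) : ℂ)), hcot]
  linear_combination (Complex.cos ((θ : ℂ) / 2) * Complex.sin ((θ : ℂ) / 2) ^ 2 +
    Complex.I * Complex.sin ((θ : ℂ) / 2) ^ 3) * Complex.I_sq -
    (Complex.I * Complex.sin ((θ : ℂ) / 2) + Complex.cos ((θ : ℂ) / 2)) * hsq

/-- A function of exponential type that is bounded on the real line, does not vanish at `i` and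
decays like `exp (-c |r| q(a |r|))` has a convergent logarithmic integral. -/
theorem lintegral_lt_top_of_decay {F : ℂ → ℂ} (hF : Differentiable ℂ F) {A C a c : ℝ}
    (hC : 0 < C) (ha : 0 < a) (hc : 0 < c) (hexp : ∀ z, ‖F z‖ ≤ C * Real.exp (A * |z.im|))
    {q : ℝ → ℝ} (hq : Antitone q) (hq0 : ∀ x, 0 ≤ q x)
    (hdec : ∀ r : ℝ, ‖F r‖ ≤ C * Real.exp (-(c * |r| * q (a * |r|)))) (h0 : F Complex.I ≠ 0) :
    ∫⁻ θ in Set.Ioc 0 1, ENNReal.ofReal (q (2 * a / θ) / θ) < ∞ := by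
  -- `exp (i A z)` compensates the growth of `F` in the upper half-plane, so that `|h| ≤ 1` there
  let h : ℂ → ℂ := fun w => F (cayleyTransform w) *
    Complex.exp (Complex.I * A * cayleyTransform w) / C
  have hh : DifferentiableOn ℂ h {1}ᶜ := by
    have h1 : DifferentiableOn ℂ cayleyTransform {1}ᶜ := by
      unfold cayleyTransform
      refine DifferentiableOn.const_mul (DifferentiableOn.div (by fun_prop) (by fun_prop)
        fun w hw => ?_) _
      exact sub_ne_zero.2 (Ne.symm hw)
    have h2 : DifferentiableOn ℂ (fun w => F (cayleyTransform w)) {1}ᶜ :=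
      hF.comp_differentiableOn h1
    have h3 : DifferentiableOn ℂ (fun w => Complex.exp (Complex.I * A * cayleyTransform w)) {1}ᶜ :=
      (h1.const_mul (Complex.I * A)).cexp
    exact (h2.mul h3).div_const _
  have hn : ∀ w, ‖h w‖ = ‖F (cayleyTransform w)‖ * Real.exp (-(A * (cayleyTransform w).im)) / C := by
    intro w
    simp only [h, norm_mul, norm_div, Complex.norm_exp, Complex.norm_real, Real.norm_eq_abs,
      abs_of_pos hC]
    congr 3
    simp
  have key := lintegral_decay_circle_lt_top hh ?_ ?_
    (fun θ => c * |Real.cot (θ / 2)| * q (a * |Real.cot (θ / 2)|)) ?_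
  · have hsub : Set.Ioc (0 : ℝ) 1 ⊆ Set.Ioc 0 (2 * Real.pi) :=
      Set.Ioc_subset_Ioc_right (by linarith [Real.pi_gt_three])
    have k1 := (lintegral_mono_set (μ := volume) (f := fun θ => ENNReal.ofReal
      (c * |Real.cot (θ / 2)| * q (a * |Real.cot (θ / 2)|))) hsub).trans_lt key
    have k2 := ENNReal.mul_lt_top (ENNReal.ofReal_lt_top (r := c⁻¹)) k1
    rw [← lintegral_const_mul' _ _ ENNReal.ofReal_ne_top] at k2
    refine lt_of_le_of_lt ?_ k2
    refine setLIntegral_mono' measurableSet_Ioc fun θ hθ => ?_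
    rw [← ENNReal.ofReal_mul (by positivity)]
    refine ENNReal.ofReal_le_ofReal ?_
    have hθ0 : 0 < θ := hθ.1
    have hcos : 0 < Real.cos (θ / 2) := Real.cos_pos_of_mem_Ioo
      ⟨by linarith [Real.pi_gt_three], by linarith [Real.pi_gt_three, hθ.2]⟩
    have hsin : 0 < Real.sin (θ / 2) := Real.sin_pos_of_pos_of_lt_pi (by linarith)
      (by linarith [Real.pi_gt_three, hθ.2])
    have hcot : Real.cot (θ / 2) = Real.cos (θ / 2) / Real.sin (θ / 2) :=
      Real.cot_eq_cos_div_sin _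
    have hpos : 0 < Real.cot (θ / 2) := by rw [hcot]; positivity
    -- near the singular point `θ = 0` the boundary value `cot (θ / 2)` is comparable to `1 / θ`
    have hle : Real.cot (θ / 2) ≤ 2 / θ := by
      have := Real.lt_tan (x := θ / 2) (by linarith) (by linarith [Real.pi_gt_three, hθ.2])
      rw [Real.tan_eq_sin_div_cos, lt_div_iff₀ hcos] at this
      rw [hcot, div_le_div_iff₀ hsin hθ0]
      linarith
    have hge : 1 / θ ≤ Real.cot (θ / 2) := by
      have h1 := Real.sin_le (x := θ / 2) (by linarith)
      have h2 : 1 / 2 ≤ Real.cos (θ / 2) := by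
        have := Real.one_sub_sq_div_two_le_cos (x := θ / 2)
        nlinarith [hθ.2]
      rw [hcot, div_le_div_iff₀ hθ0 hsin]
      nlinarith
    rw [abs_of_pos hpos]
    have hqq : q (2 * a / θ) ≤ q (a * Real.cot (θ / 2)) := by
      refine hq ?_
      calc a * Real.cot (θ / 2) ≤ a * (2 / θ) := by gcongr
        _ = 2 * a / θ := by ring
    calc q (2 * a / θ) / θ = 1 / θ * q (2 * a / θ) := by ring
      _ ≤ Real.cot (θ / 2) * q (a * Real.cot (θ / 2)) := by gcongr; exact hq0 _
      _ = c⁻¹ * (c * Real.cot (θ / 2) * q (a * Real.cot (θ / 2))) := by field_simp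
  · intro w hw
    have him := cayleyTransform_im_pos hw
    rw [hn, div_le_one hC]
    have h1 := hexp (cayleyTransform w)
    rw [abs_of_pos him] at h1
    calc _ ≤ C * Real.exp (A * (cayleyTransform w).im) *
          Real.exp (-(A * (cayleyTransform w).im)) := by gcongr
      _ = C := by rw [mul_assoc, ← Real.exp_add, add_neg_cancel, Real.exp_zero, mul_one]
  · have : cayleyTransform 0 = Complex.I := by simp [cayleyTransform]
    simp only [h, this]
    have hC' : (C : ℂ) ≠ 0 := by exact_mod_cast hC.ne'
    exact div_ne_zero (mul_ne_zero h0 (Complex.exp_ne_zero _)) hC'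
  · intro θ hθ
    rw [hn, cayleyTransform_circleMap hθ.1 hθ.2, Complex.ofReal_im, mul_zero, neg_zero,
      Real.exp_zero, mul_one, div_le_iff₀ hC]
    have h1 := hdec (-Real.cot (θ / 2))
    rw [abs_neg] at h1
    linarith

/-! ### Dyadic form of the integral condition -/

theorem pairwise_disjoint_dyadic_Ico :
    Pairwise (Function.onFun Disjoint fun k : ℕ => Set.Ico ((2 : ℝ) ^ k) (2 ^ (k + 1))) :=
  Monotone.pairwise_disjoint_on_Ico_succ (f := fun k : ℕ => (2 : ℝ) ^ k)
    (pow_right_mono₀ one_le_two)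

theorem iUnion_dyadic_Ico : ⋃ k : ℕ, Set.Ico ((2 : ℝ) ^ k) (2 ^ (k + 1)) = Set.Ici 1 := by
  ext x
  simp only [Set.mem_iUnion, Set.mem_Ico, Set.mem_Ici]
  constructor
  · rintro ⟨k, hk, _⟩
    exact (one_le_pow₀ one_le_two).trans hk
  · intro hx
    exact exists_nat_pow_near hx one_lt_two

theorem summable_of_tsum_ofReal_lt_top {ι : Type*} {u : ι → ℝ} (hu : ∀ i, 0 ≤ u i)
    (h : ∑' i, ENNReal.ofReal (u i) < ∞) : Summable u := by
  have := ENNReal.summable_toReal h.ne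
  simpa [ENNReal.toReal_ofReal (hu _)] using this

theorem lintegral_dyadic_lt_top_iff {q : ℝ → ℝ} (hq : Antitone q) (hq0 : ∀ x, 0 ≤ q x) :
    ∫⁻ t in Set.Ici (1 : ℝ), ENNReal.ofReal (q t / t) < ∞ ↔
      Summable fun k : ℕ => q (2 ^ k) := by
  have hvol : ∀ k : ℕ, volume (Set.Ico ((2 : ℝ) ^ k) (2 ^ (k + 1))) = ENNReal.ofReal (2 ^ k) := by
    intro k
    rw [Real.volume_Ico]
    congr 1
    ring
  have hsplit : ∫⁻ t in Set.Ici (1 : ℝ), ENNReal.ofReal (q t / t) =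
      ∑' k : ℕ, ∫⁻ t in Set.Ico ((2 : ℝ) ^ k) (2 ^ (k + 1)), ENNReal.ofReal (q t / t) := by
    rw [← iUnion_dyadic_Ico, lintegral_iUnion (fun _ => measurableSet_Ico)
      pairwise_disjoint_dyadic_Ico]
  rw [hsplit]
  constructor
  · intro h
    have hle : ∀ k : ℕ, ENNReal.ofReal (q (2 ^ (k + 1)) / 2) ≤
        ∫⁻ t in Set.Ico ((2 : ℝ) ^ k) (2 ^ (k + 1)), ENNReal.ofReal (q t / t) := by
      intro k
      calc ENNReal.ofReal (q (2 ^ (k + 1)) / 2)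
          = ∫⁻ _ in Set.Ico ((2 : ℝ) ^ k) (2 ^ (k + 1)),
              ENNReal.ofReal (q (2 ^ (k + 1)) / 2 ^ (k + 1)) := by
            rw [setLIntegral_const, hvol, ← ENNReal.ofReal_mul
              (div_nonneg (hq0 _) (by positivity))]
            congr 1
            rw [pow_succ]
            field_simp
        _ ≤ _ := by
            refine setLIntegral_mono' measurableSet_Ico fun t ht => ?_
            have ht0 : 0 < t := lt_of_lt_of_le (by positivity) ht.1
            refine ENNReal.ofReal_le_ofReal (div_le_div₀ (hq0 _) (hq ht.2.le) ht0 ht.2.le)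
    have h1 : Summable fun k : ℕ => q (2 ^ (k + 1)) / 2 :=
      summable_of_tsum_ofReal_lt_top (fun k => div_nonneg (hq0 _) zero_le_two)
        ((ENNReal.tsum_le_tsum hle).trans_lt h)
    have h2 := h1.mul_left 2
    simp only [mul_div_cancel₀ _ (two_ne_zero' ℝ)] at h2
    exact (summable_nat_add_iff 1).1 h2
  · intro h
    have hle : ∀ k : ℕ, ∫⁻ t in Set.Ico ((2 : ℝ) ^ k) (2 ^ (k + 1)), ENNReal.ofReal (q t / t) ≤
        ENNReal.ofReal (q (2 ^ k)) := by
      intro k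
      calc _ ≤ ∫⁻ _ in Set.Ico ((2 : ℝ) ^ k) (2 ^ (k + 1)),
              ENNReal.ofReal (q (2 ^ k) / 2 ^ k) := by
            refine setLIntegral_mono' measurableSet_Ico fun t ht => ?_
            exact ENNReal.ofReal_le_ofReal (div_le_div₀ (hq0 _) (hq ht.1) (by positivity) ht.1)
        _ = ENNReal.ofReal (q (2 ^ k)) := by
            rw [setLIntegral_const, hvol, ← ENNReal.ofReal_mul
              (div_nonneg (hq0 _) (by positivity))]
            congr 1
            field_simp
    refine (ENNReal.tsum_le_tsum hle).trans_lt ?_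
    rw [← ENNReal.ofReal_tsum_of_nonneg (fun k => hq0 _) h]
    exact ENNReal.ofReal_lt_top

theorem integrableOn_div_iff_summable_dyadic {q : ℝ → ℝ} (hq : Antitone q) (hq0 : ∀ x, 0 ≤ q x) :
    IntegrableOn (fun t => q t / t) (Set.Ici 1) ↔ Summable fun k : ℕ => q (2 ^ k) := by
  rw [← lintegral_dyadic_lt_top_iff hq hq0]
  have hm : Measurable fun t => q t / t := hq.measurable.div measurable_id
  have hnn : 0 ≤ᵐ[volume.restrict (Set.Ici (1 : ℝ))] fun t => q t / t := by
    rw [EventuallyLE, ae_restrict_iff' measurableSet_Ici]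
    exact Eventually.of_forall fun t ht => div_nonneg (hq0 _) (zero_le_one.trans ht)
  rw [IntegrableOn, Integrable, and_iff_right hm.aestronglyMeasurable,
    hasFiniteIntegral_iff_ofReal hnn]

/-- A bounded change of scale only shifts the dyadic sum. -/
theorem summable_dyadic_of_scaled {q : ℝ → ℝ} (hq : Antitone q) (hq0 : ∀ x, 0 ≤ q x) {K : ℝ}
    (h : Summable fun k : ℕ => q (K * 2 ^ k)) : Summable fun k : ℕ => q (2 ^ k) := by
  obtain ⟨J, hJ⟩ := pow_unbounded_of_one_lt K (one_lt_two (α := ℝ))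
  refine (summable_nat_add_iff J).1 (Summable.of_nonneg_of_le (fun k => hq0 _) (fun k => hq ?_) h)
  rw [pow_add, mul_comm]
  gcongr

theorem summable_dyadic_of_lintegral {q : ℝ → ℝ} (hq : Antitone q) (hq0 : ∀ x, 0 ≤ q x) {K : ℝ}
    (hK : 0 < K) (h : ∫⁻ θ in Set.Ioc 0 1, ENNReal.ofReal (q (K / θ) / θ) < ∞) :
    Summable fun k : ℕ => q (2 ^ k) := by
  have hdisj : Pairwise (Function.onFun Disjoint fun k : ℕ =>
      Set.Ioc ((2⁻¹ : ℝ) ^ (k + 1)) (2⁻¹ ^ k)) := by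
    have := Antitone.pairwise_disjoint_on_Ioc_succ (f := fun k : ℕ => (2⁻¹ : ℝ) ^ k)
      (pow_right_anti₀ (by norm_num) (by norm_num))
    exact this
  have hsub : (⋃ k : ℕ, Set.Ioc ((2⁻¹ : ℝ) ^ (k + 1)) (2⁻¹ ^ k)) ⊆ Set.Ioc 0 1 := by
    refine Set.iUnion_subset fun k x hx => ⟨lt_trans (by positivity) hx.1, hx.2.trans ?_⟩
    exact pow_le_one₀ (by norm_num) (by norm_num)
  have h1 := (lintegral_mono_set (μ := volume)
    (f := fun θ => ENNReal.ofReal (q (K / θ) / θ)) hsub).trans_lt h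
  rw [lintegral_iUnion (fun _ => measurableSet_Ioc) hdisj] at h1
  have hle : ∀ k : ℕ, ENNReal.ofReal (q (2 * K * 2 ^ k) / 2) ≤
      ∫⁻ θ in Set.Ioc ((2⁻¹ : ℝ) ^ (k + 1)) (2⁻¹ ^ k), ENNReal.ofReal (q (K / θ) / θ) := by
    intro k
    calc ENNReal.ofReal (q (2 * K * 2 ^ k) / 2)
        = ∫⁻ _ in Set.Ioc ((2⁻¹ : ℝ) ^ (k + 1)) (2⁻¹ ^ k),
            ENNReal.ofReal (q (2 * K * 2 ^ k) / 2⁻¹ ^ k) := by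
          rw [setLIntegral_const, Real.volume_Ioc, ← ENNReal.ofReal_mul
            (div_nonneg (hq0 _) (by positivity))]
          congr 1
          rw [pow_succ]
          field_simp
          ring
      _ ≤ _ := by
          refine setLIntegral_mono' measurableSet_Ioc fun θ hθ => ?_
          have hθ0 : 0 < θ := lt_trans (by positivity) hθ.1
          refine ENNReal.ofReal_le_ofReal (div_le_div₀ (hq0 _) (hq ?_) hθ0 hθ.2)
          rw [div_le_iff₀ hθ0]
          calc K = 2 * K * 2 ^ k * 2⁻¹ ^ (k + 1) := by
                rw [pow_succ, inv_pow]
                field_simp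
            _ ≤ 2 * K * 2 ^ k * θ := by
                have := hθ.1.le
                gcongr
  have h2 : Summable fun k : ℕ => q (2 * K * 2 ^ k) / 2 :=
    summable_of_tsum_ofReal_lt_top (fun k => div_nonneg (hq0 _) zero_le_two)
      ((ENNReal.tsum_le_tsum hle).trans_lt h1)
  have h3 := h2.mul_left 2
  simp only [mul_div_cancel₀ _ (two_ne_zero' ℝ)] at h3
  exact summable_dyadic_of_scaled hq hq0 h3

/-- The one-dimensional uniqueness theorem of Ingham and Levinson, for entire functions. -/
theorem eq_zero_of_decay_of_not_summable {F : ℂ → ℂ} (hF : Differentiable ℂ F) {A C a c : ℝ}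
    (hC : 0 < C) (ha : 0 < a) (hc : 0 < c) (hexp : ∀ z, ‖F z‖ ≤ C * Real.exp (A * |z.im|))
    {q : ℝ → ℝ} (hq : Antitone q) (hq0 : ∀ x, 0 ≤ q x)
    (hdec : ∀ r : ℝ, ‖F r‖ ≤ C * Real.exp (-(c * |r| * q (a * |r|))))
    (hns : ¬ Summable fun k : ℕ => q (2 ^ k)) : F = 0 := by
  -- a nonzero value at `i y` contradicts the finiteness of the logarithmic integral of `F (y ·)`
  have hi : ∀ y : ℝ, 0 < y → F (y * Complex.I) = 0 := by
    intro y hy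
    by_contra hne
    refine hns (summable_dyadic_of_lintegral hq hq0 (K := 2 * (a * y)) (by positivity) ?_)
    refine lintegral_lt_top_of_decay (F := fun z => F (y * z)) (A := A * y) (c := c * y)
      (by fun_prop) hC (by positivity) (by positivity) (fun z => ?_) hq hq0 (fun r => ?_) hne
    · refine (hexp _).trans (le_of_eq ?_)
      simp only [Complex.mul_im, Complex.ofReal_re, Complex.ofReal_im, zero_mul, add_zero, abs_mul,
        abs_of_pos hy]
      ring_nf
    · have := hdec (y * r)
      rw [abs_mul, abs_of_pos hy] at this
      push_cast at this
      refine this.trans (le_of_eq ?_)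
      ring_nf
  have hfreq : ∃ᶠ z in 𝓝[≠] (0 : ℂ), F z = (0 : ℂ → ℂ) z := by
    rw [frequently_iff_seq_forall]
    refine ⟨fun k => (((1 : ℝ) / ((k : ℝ) + 1) : ℝ) : ℂ) * Complex.I, ?_, fun k => ?_⟩
    · refine tendsto_nhdsWithin_iff.2 ⟨?_, Eventually.of_forall fun k => ?_⟩
      · have h1 := (Complex.continuous_ofReal.tendsto 0).comp tendsto_one_div_add_atTop_nhds_zero_nat
        simpa using h1.mul_const Complex.I
      · have : (0 : ℝ) < 1 / ((k : ℝ) + 1) := by positivity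
        exact mul_ne_zero (by exact_mod_cast this.ne') Complex.I_ne_zero
    · exact hi _ (by positivity)
  have han : AnalyticOnNhd ℂ F Set.univ := hF.differentiableOn.analyticOnNhd isOpen_univ
  exact AnalyticOnNhd.eq_of_frequently_eq han analyticOnNhd_const hfreq

/-! ### Compactly supported functions with prescribed bounds on the derivatives -/

/-- The average of `u` over `[x - r, x + r]`. -/
noncomputable def boxAverage (r : ℝ) (u : ℝ → ℝ) (x : ℝ) : ℝ := (2 * r)⁻¹ * ∫ t in (-r)..r, u (x + t)

theorem boxAverage_const {r : ℝ} (hr : 0 < r) (c x : ℝ) : boxAverage r (fun _ => c) x = c := by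
  simp only [boxAverage, intervalIntegral.integral_const, smul_eq_mul]
  field_simp
  ring

theorem boxAverage_mono {r : ℝ} (hr : 0 < r) {u v : ℝ → ℝ} (hu : Continuous u) (hv : Continuous v)
    {x : ℝ} (h : ∀ t ∈ Set.Icc (-r) r, u (x + t) ≤ v (x + t)) :
    boxAverage r u x ≤ boxAverage r v x := by
  unfold boxAverage
  refine mul_le_mul_of_nonneg_left ?_ (by positivity)
  exact intervalIntegral.integral_mono_on (by linarith)
    ((by fun_prop : Continuous fun t => u (x + t)).intervalIntegrable _ _)
    ((by fun_prop : Continuous fun t => v (x + t)).intervalIntegrable _ _) h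

theorem boxAverage_congr {r : ℝ} (hr : 0 < r) {u v : ℝ → ℝ} {x : ℝ}
    (h : ∀ t ∈ Set.Icc (-r) r, u (x + t) = v (x + t)) : boxAverage r u x = boxAverage r v x := by
  unfold boxAverage
  congr 1
  refine intervalIntegral.integral_congr fun t ht => h t ?_
  rwa [Set.uIcc_of_le (by linarith)] at ht

theorem abs_boxAverage_sub_le {r : ℝ} (hr : 0 < r) {u v : ℝ → ℝ} (hu : Continuous u)
    (hv : Continuous v) {x y d : ℝ} (h : ∀ t ∈ Set.Icc (-r) r, |u (x + t) - v (y + t)| ≤ d) :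
    |boxAverage r u x - boxAverage r v y| ≤ d := by
  have h1 : boxAverage r u x - boxAverage r v y =
      (2 * r)⁻¹ * ∫ t in (-r)..r, (u (x + t) - v (y + t)) := by
    rw [boxAverage, boxAverage, intervalIntegral.integral_sub
      ((by fun_prop : Continuous fun t => u (x + t)).intervalIntegrable _ _)
      ((by fun_prop : Continuous fun t => v (y + t)).intervalIntegrable _ _)]
    ring
  have h2 := intervalIntegral.norm_integral_le_of_norm_le_const (a := -r) (b := r)
    (f := fun t => u (x + t) - v (y + t)) (C := d) fun t ht => by
      rw [Set.uIoc_of_le (by linarith)] at ht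
      exact h t ⟨ht.1.le, ht.2⟩
  rw [h1, abs_mul, abs_of_pos (by positivity : 0 < (2 * r)⁻¹), inv_mul_le_iff₀ (by positivity)]
  rw [Real.norm_eq_abs, sub_neg_eq_add, abs_of_pos (by linarith : 0 < r + r)] at h2
  linarith

theorem hasDerivAt_boxAverage {r : ℝ} {u : ℝ → ℝ} (hu : Continuous u) (x : ℝ) :
    HasDerivAt (boxAverage r u) ((2 * r)⁻¹ * (u (x + r) - u (x + -r))) x := by
  have h1 : boxAverage r u = fun x => (2 * r)⁻¹ *
      ((∫ t in (0 : ℝ)..(x + r), u t) - ∫ t in (0 : ℝ)..(x + -r), u t) := by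
    ext y
    rw [boxAverage, intervalIntegral.integral_comp_add_left (fun t => u t) y,
      intervalIntegral.integral_interval_sub_left (hu.intervalIntegrable _ _)
        (hu.intervalIntegrable _ _)]
  rw [h1]
  have h2 : ∀ s, HasDerivAt (fun y => ∫ t in (0 : ℝ)..(y + s), u t) (u (x + s)) x := fun s =>
    (intervalIntegral.integral_hasDerivAt_right (hu.intervalIntegrable _ _)
      (hu.stronglyMeasurableAtFilter _ _) hu.continuousAt).comp_add_const x s
  exact ((h2 r).sub (h2 (-r))).const_mul _

/-- The trapezoid equal to `1` on `[-1, 1]` and to `0` off `[-2, 2]`. -/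
noncomputable def trapezoid (x : ℝ) : ℝ := max 0 (min 1 (2 - |x|))

theorem lipschitzWith_trapezoid : LipschitzWith 1 trapezoid := by
  have h1 : LipschitzWith 1 fun x : ℝ => 2 - |x| := by
    refine LipschitzWith.of_dist_le_mul fun x y => ?_
    rw [Real.dist_eq, Real.dist_eq, NNReal.coe_one, one_mul]
    calc |2 - |x| - (2 - |y|)| = |(|y| - |x|)| := by congr 1; ring
      _ ≤ |y - x| := abs_abs_sub_abs_le _ _
      _ = |x - y| := abs_sub_comm _ _
  exact (h1.const_min 1).const_max 0

/-- The `N`-fold average of the trapezoid over boxes of half-widths `r j, …, r (j + N - 1)`. -/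
noncomputable def iterBoxAverage (r : ℕ → ℝ) : ℕ → ℕ → ℝ → ℝ
  | 0, _ => trapezoid
  | N + 1, j => boxAverage (r j) (iterBoxAverage r N (j + 1))

theorem abs_iterBoxAverage_sub {r : ℕ → ℝ} (hr : ∀ i, 0 < r i) (N j : ℕ) (x y : ℝ) :
    |iterBoxAverage r N j x - iterBoxAverage r N j y| ≤ |x - y| := by
  induction N generalizing j x y with
  | zero =>
    have := lipschitzWith_trapezoid.dist_le_mul x y
    simpa [Real.dist_eq, iterBoxAverage] using this
  | succ N ih =>
    have hc : Continuous (iterBoxAverage r N (j + 1)) :=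
      (LipschitzWith.of_dist_le_mul (K := 1) fun x y => by
        simpa [Real.dist_eq] using ih (j + 1) x y).continuous
    refine abs_boxAverage_sub_le (hr j) hc hc fun t _ => ?_
    simpa using ih (j + 1) (x + t) (y + t)

theorem continuous_of_abs_sub_le {u : ℝ → ℝ} (h : ∀ x y, |u x - u y| ≤ |x - y|) : Continuous u :=
  (LipschitzWith.of_dist_le_mul (K := 1) fun x y => by
    simpa [Real.dist_eq] using h x y).continuous

theorem continuous_iterBoxAverage {r : ℕ → ℝ} (hr : ∀ i, 0 < r i) (N j : ℕ) :
    Continuous (iterBoxAverage r N j) :=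
  continuous_of_abs_sub_le (abs_iterBoxAverage_sub hr N j)

theorem iterBoxAverage_mem_Icc {r : ℕ → ℝ} (hr : ∀ i, 0 < r i) (N j : ℕ) (x : ℝ) :
    iterBoxAverage r N j x ∈ Set.Icc 0 1 := by
  induction N generalizing j x with
  | zero => exact ⟨le_max_left _ _, max_le zero_le_one (min_le_left _ _)⟩
  | succ N ih =>
    have hc := continuous_iterBoxAverage hr N (j + 1)
    constructor
    · have := boxAverage_mono (hr j) (x := x) continuous_const hc fun t _ => (ih (j + 1) (x + t)).1
      rwa [boxAverage_const (hr j)] at this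
    · have := boxAverage_mono (hr j) (x := x) hc continuous_const fun t _ => (ih (j + 1) (x + t)).2
      rwa [boxAverage_const (hr j)] at this

theorem iterBoxAverage_eq_zero {r : ℕ → ℝ} (hr : ∀ i, 0 < r i) (N j : ℕ) (x : ℝ)
    (hx : 2 + ∑ i ∈ Finset.range N, r (j + i) ≤ |x|) : iterBoxAverage r N j x = 0 := by
  induction N generalizing j x with
  | zero =>
    refine max_eq_left ((min_le_right _ _).trans ?_)
    simp at hx
    linarith
  | succ N ih =>
    rw [iterBoxAverage, boxAverage_congr (hr j) (v := fun _ => 0), boxAverage_const (hr j)]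
    intro t ht
    refine ih (j + 1) _ ?_
    rw [Finset.sum_range_succ'] at hx
    have h1 : |x| ≤ |x + t| + |t| := by
      simpa using abs_sub (x + t) t
    have h2 : |t| ≤ r j := abs_le.2 ht
    have h3 : ∑ i ∈ Finset.range N, r (j + 1 + i) = ∑ i ∈ Finset.range N, r (j + (i + 1)) :=
      Finset.sum_congr rfl fun i _ => by congr 1; ring
    rw [h3]
    simp only [add_zero] at hx
    linarith

theorem iterBoxAverage_eq_one {r : ℕ → ℝ} (hr : ∀ i, 0 < r i) (N j : ℕ) (x : ℝ)
    (hx : |x| ≤ 1 - ∑ i ∈ Finset.range N, r (j + i)) : iterBoxAverage r N j x = 1 := by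
  induction N generalizing j x with
  | zero =>
    simp only [Finset.range_zero, Finset.sum_empty, sub_zero] at hx
    rw [iterBoxAverage, trapezoid, min_eq_left (by linarith), max_eq_right zero_le_one]
  | succ N ih =>
    rw [iterBoxAverage, boxAverage_congr (hr j) (v := fun _ => 1), boxAverage_const (hr j)]
    intro t ht
    refine ih (j + 1) _ ?_
    rw [Finset.sum_range_succ'] at hx
    have h1 : |x + t| ≤ |x| + |t| := abs_add_le _ _
    have h2 : |t| ≤ r j := abs_le.2 ht
    have h3 : ∑ i ∈ Finset.range N, r (j + 1 + i) = ∑ i ∈ Finset.range N, r (j + (i + 1)) :=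
      Finset.sum_congr rfl fun i _ => by congr 1; ring
    rw [h3]
    simp only [add_zero] at hx
    linarith

theorem abs_iterBoxAverage_succ_sub {r : ℕ → ℝ} (hr : ∀ i, 0 < r i) (N j : ℕ) (x : ℝ) :
    |iterBoxAverage r N j x - iterBoxAverage r (N + 1) j x| ≤ r (j + N) := by
  induction N generalizing j x with
  | zero =>
    have hc : Continuous trapezoid := lipschitzWith_trapezoid.continuous
    have := abs_boxAverage_sub_le (hr j) (u := fun _ => trapezoid x) (x := x) (y := x)
      continuous_const hc (d := r j) fun t ht => by
        have h := lipschitzWith_trapezoid.dist_le_mul x (x + t)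
        rw [NNReal.coe_one, one_mul, Real.dist_eq, Real.dist_eq, sub_add_cancel_left, abs_neg] at h
        exact h.trans (abs_le.2 ht)
    rwa [boxAverage_const (hr j)] at this
  | succ N ih =>
    have := abs_boxAverage_sub_le (hr j) (x := x) (y := x)
      (continuous_iterBoxAverage hr N (j + 1)) (continuous_iterBoxAverage hr (N + 1) (j + 1))
      (d := r (j + (N + 1))) fun t _ => by
        have h := ih (j + 1) (x + t)
        rwa [show j + 1 + N = j + (N + 1) by ring] at h
    exact this

/-- The limits `v j` of the iterated averages satisfy `v j = boxAverage (r j) (v (j + 1))`. -/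
theorem exists_boxAverage_fixed {r : ℕ → ℝ} (hr : ∀ i, 0 < r i) (hs : Summable r) :
    ∃ v : ℕ → ℝ → ℝ, (∀ j x, Tendsto (fun N => iterBoxAverage r N j x) atTop (𝓝 (v j x))) ∧
      (∀ j, Continuous (v j)) ∧ ∀ j, v j = boxAverage (r j) (v (j + 1)) := by
  have hcauchy : ∀ j x, ∃ y, Tendsto (fun N => iterBoxAverage r N j x) atTop (𝓝 y) := fun j x =>
    cauchySeq_tendsto_of_complete (cauchySeq_of_dist_le_of_summable (fun N => r (j + N))
      (fun N => abs_iterBoxAverage_succ_sub hr N j x)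
      (by simpa only [add_comm] using (summable_nat_add_iff j).2 hs))
  choose v hv using hcauchy
  have hlip : ∀ j x y, |v j x - v j y| ≤ |x - y| := fun j x y =>
    le_of_tendsto ((hv j x).sub (hv j y)).abs
      (Eventually.of_forall fun N => abs_iterBoxAverage_sub hr N j x y)
  refine ⟨v, hv, fun j => continuous_of_abs_sub_le (hlip j), fun j => funext fun x => ?_⟩
  refine tendsto_nhds_unique ((tendsto_add_atTop_iff_nat 1).2 (hv j x)) ?_
  refine Tendsto.const_mul _ ?_
  refine intervalIntegral.tendsto_integral_filter_of_dominated_convergence (fun _ => 1)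
    (Eventually.of_forall fun N => ?_) (Eventually.of_forall fun N => Eventually.of_forall
      fun t _ => ?_) (intervalIntegrable_const) (Eventually.of_forall fun t _ => hv _ _)
  · have := continuous_iterBoxAverage hr N (j + 1)
    exact (by fun_prop : Continuous fun t => iterBoxAverage r N (j + 1) (x + t)).aestronglyMeasurable
  · have := iterBoxAverage_mem_Icc hr N (j + 1) (x + t)
    rw [Real.norm_of_nonneg this.1]
    exact this.2

/-- The derivative of a box average is a difference quotient, so each of the first `k` boxes absorbs
one derivative at the cost of a factor `1 / r`. -/
theorem contDiff_and_abs_iteratedDeriv_le {r : ℕ → ℝ} (hr : ∀ i, 0 < r i) {v : ℕ → ℝ → ℝ}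
    (hc : ∀ j, Continuous (v j)) (hv : ∀ j, v j = boxAverage (r j) (v (j + 1)))
    (hb : ∀ j x, |v j x| ≤ 1) (k j : ℕ) :
    ContDiff ℝ k (v j) ∧
      ∀ x, |iteratedDeriv k (v j) x| ≤ ∏ i ∈ Finset.range k, (r (j + i))⁻¹ := by
  induction k generalizing j with
  | zero => exact ⟨contDiff_zero.2 (hc j), fun x => by simpa using hb j x⟩
  | succ k ih =>
    obtain ⟨h1, h2⟩ := ih (j + 1)
    have hd : ∀ x, HasDerivAt (v j)
        ((2 * r j)⁻¹ * (v (j + 1) (x + r j) - v (j + 1) (x + -r j))) x := fun x => by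
      have := hasDerivAt_boxAverage (r := r j) (hc (j + 1)) x
      rwa [← hv j] at this
    have hderiv : deriv (v j) = fun x =>
        (2 * r j)⁻¹ * (v (j + 1) (x + r j) - v (j + 1) (x + -r j)) :=
      funext fun x => (hd x).deriv
    have hcomp : ∀ s : ℝ, ContDiff ℝ k fun x => v (j + 1) (x + s) := fun s =>
      h1.comp (contDiff_id.add contDiff_const)
    constructor
    · rw [Nat.cast_add, Nat.cast_one, contDiff_succ_iff_deriv]
      refine ⟨fun x => (hd x).differentiableAt, by simp, ?_⟩
      rw [hderiv]
      exact contDiff_const.mul ((hcomp _).sub (hcomp _))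
    · intro x
      rw [iteratedDeriv_succ', hderiv, iteratedDeriv_const_mul_field, iteratedDeriv_fun_sub
        (hcomp _).contDiffAt (hcomp _).contDiffAt, iteratedDeriv_comp_add_const,
        iteratedDeriv_comp_add_const, abs_mul, abs_of_pos (inv_pos.2 (by linarith [hr j])),
        Finset.prod_range_succ']
      have h3 := h2 (x + r j)
      have h4 := h2 (x + -r j)
      have h5 := abs_sub (iteratedDeriv k (v (j + 1)) (x + r j))
        (iteratedDeriv k (v (j + 1)) (x + -r j))
      have h6 : ∏ i ∈ Finset.range k, (r (j + 1 + i))⁻¹ =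
          ∏ i ∈ Finset.range k, (r (j + (i + 1)))⁻¹ :=
        Finset.prod_congr rfl fun i _ => by congr 2; ring
      rw [h6] at h3 h4
      have hrj := hr j
      rw [mul_inv, add_zero]
      calc 2⁻¹ * (r j)⁻¹ * _ ≤ 2⁻¹ * (r j)⁻¹ * (∏ i ∈ Finset.range k, (r (j + (i + 1)))⁻¹ +
            ∏ i ∈ Finset.range k, (r (j + (i + 1)))⁻¹) := by
              gcongr
              linarith
        _ = _ := by ring

/-- A smooth bump whose `k`-th derivative is bounded by `Λ l ^ k` as long as `k ≤ N l`. -/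
theorem exists_bump {N : ℕ → ℕ} {Λ : ℕ → ℝ} (hΛ : ∀ l, 0 < Λ l) (hN : ∀ k, ∃ l, k < N l)
    (hs : Summable fun l => N l / Λ l) (hs1 : ∑' l, N l / Λ l ≤ 1) :
    ∃ g : ℝ → ℝ, ContDiff ℝ (⊤ : ℕ∞) g ∧ g 0 = 1 ∧ (∀ x, 3 ≤ |x| → g x = 0) ∧
      ∀ l k, k ≤ N l → ∀ x, |iteratedDeriv k g x| ≤ Λ l ^ k := by
  -- `c i l` is the contribution of the scale `l` to the half-width `r i` of the `i`-th box: each of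
  -- the first `N l` boxes is at least `1 / Λ l` wide, and the total width is `∑ N l / Λ l`
  let c : ℕ → ℕ → ℝ := fun i l => if i < N l then (Λ l)⁻¹ else 0
  have hc0 : ∀ i l, 0 ≤ c i l := fun i l => by
    have := (hΛ l).le
    simp only [c]
    split_ifs <;> positivity
  have hcs : ∀ i, Summable (c i) := fun i => by
    refine Summable.of_nonneg_of_le (hc0 i) (fun l => ?_) hs
    have := hΛ l
    simp only [c]
    split_ifs with h
    · rw [inv_eq_one_div]
      have : (1 : ℝ) ≤ N l := by exact_mod_cast (Nat.zero_le i).trans_lt h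
      gcongr
    · positivity
  let r : ℕ → ℝ := fun i => ∑' l, c i l
  have hrl : ∀ i l, i < N l → (Λ l)⁻¹ ≤ r i := fun i l h => by
    have := (hcs i).le_tsum l fun l' _ => hc0 i l'
    simpa [c, h] using this
  have hr : ∀ i, 0 < r i := fun i => by
    obtain ⟨l, hl⟩ := hN i
    exact (inv_pos.2 (hΛ l)).trans_le (hrl i l hl)
  have hsum : ∀ M, ∑ i ∈ Finset.range M, r i ≤ 1 := fun M => by
    rw [← Summable.tsum_finsetSum fun i _ => hcs i]
    refine le_trans (Summable.tsum_le_tsum (fun l => ?_) (summable_sum fun i _ => hcs i) hs) hs1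
    have h1 : ∑ i ∈ Finset.range M, c i l ≤ ∑ i ∈ Finset.range (N l), (Λ l)⁻¹ := by
      simp only [c, ← Finset.sum_filter]
      refine Finset.sum_le_sum_of_subset_of_nonneg (fun i hi => ?_) fun _ _ _ =>
        inv_nonneg.2 (hΛ l).le
      simpa using (Finset.mem_filter.1 hi).2
    refine h1.trans (le_of_eq ?_)
    simp [div_eq_mul_inv]
  obtain ⟨v, hv, hvc, hvb⟩ := exists_boxAverage_fixed hr
    (summable_of_sum_range_le (fun i => (hr i).le) hsum)
  have hvI : ∀ j x, v j x ∈ Set.Icc (0 : ℝ) 1 := fun j x =>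
    isClosed_Icc.mem_of_tendsto (hv j x) (Eventually.of_forall fun M =>
      iterBoxAverage_mem_Icc hr M j x)
  have key := fun k => contDiff_and_abs_iteratedDeriv_le hr hvc hvb
    (fun j x => by rw [abs_of_nonneg (hvI j x).1]; exact (hvI j x).2) k 0
  refine ⟨v 0, contDiff_infty.2 fun k => (key k).1, ?_, fun x hx => ?_, fun l k hk x => ?_⟩
  · refine tendsto_nhds_unique (hv 0 0) (tendsto_const_nhds.congr fun M => ?_)
    rw [iterBoxAverage_eq_one hr]
    simpa using hsum M
  · refine tendsto_nhds_unique (hv 0 x) (tendsto_const_nhds.congr fun M => ?_)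
    rw [iterBoxAverage_eq_zero hr]
    have := hsum M
    simp only [zero_add]
    linarith
  · refine ((key k).2 x).trans ?_
    calc ∏ i ∈ Finset.range k, (r (0 + i))⁻¹ ≤ ∏ i ∈ Finset.range k, Λ l := by
          refine Finset.prod_le_prod (fun i _ => (inv_pos.2 (hr _)).le) fun i hi => ?_
          rw [zero_add]
          exact inv_le_of_inv_le₀ (hΛ l) (hrl i l ((Finset.mem_range.1 hi).trans_le hk))
      _ = Λ l ^ k := by simp

/-- The Fourier transform of `g` with the normalization `ζ ↦ ∫ g(u) exp (i ζ u) du`. -/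
noncomputable def lineFourier (g : ℝ → ℝ) (ζ : ℝ) : ℂ :=
  ∫ u, (g u : ℂ) * Complex.exp (Complex.I * ((ζ * u : ℝ) : ℂ))

/-- Integration by parts; the constant `6` is the length of the support. -/
theorem abs_pow_mul_norm_lineFourier_le {g : ℝ → ℝ} (hg : ContDiff ℝ (⊤ : ℕ∞) g)
    (hsupp : ∀ x, 3 ≤ |x| → g x = 0) {k : ℕ} {B : ℝ} (hB : ∀ x, |iteratedDeriv k g x| ≤ B) (ζ : ℝ) :
    |ζ| ^ k * ‖lineFourier g ζ‖ ≤ 6 * B := by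
  let G : ℝ → ℂ := fun u => (g u : ℂ)
  have hG : ContDiff ℝ (⊤ : ℕ∞) G := Complex.ofRealCLM.contDiff.comp hg
  have hsuppG : Function.support G ⊆ Set.Icc (-3) 3 := fun x hx => by
    by_contra hcon
    refine hx ?_
    simp only [G, Complex.ofReal_eq_zero]
    refine hsupp x ?_
    by_contra h
    exact hcon (abs_le.1 (not_le.1 h).le)
  have hcs : HasCompactSupport G :=
    HasCompactSupport.of_support_subset_isCompact isCompact_Icc hsuppG
  have hnorm : ∀ m x, ‖iteratedDeriv m G x‖ = |iteratedDeriv m g x| := fun m x => by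
    have := Complex.ofRealLI.norm_iteratedFDeriv_comp_left (f := g) (x := x)
      (hg.contDiffAt.of_le (by exact_mod_cast le_top)) (i := m) le_rfl
    rw [← norm_iteratedFDeriv_eq_norm_iteratedDeriv, ← Real.norm_eq_abs,
      ← norm_iteratedFDeriv_eq_norm_iteratedDeriv]
    exact this
  have hcsd : ∀ m, HasCompactSupport (iteratedDeriv m G) := fun m => by
    refine HasCompactSupport.of_support_subset_isCompact hcs.isCompact fun x hx => ?_
    by_contra hcon
    refine hx ?_
    have h1 := image_eq_zero_of_notMem_tsupport (f := iteratedFDeriv ℝ m G) fun h =>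
      hcon (tsupport_iteratedFDeriv_subset m h)
    rw [iteratedDeriv_eq_iteratedFDeriv, h1]
    rfl
  have hint : ∀ m : ℕ, Integrable (iteratedDeriv m G) := fun m =>
    (hG.continuous_iteratedDeriv m (by exact_mod_cast le_top)).integrable_of_hasCompactSupport
      (hcsd m)
  have hF : lineFourier g ζ = FourierTransform.fourier G (-ζ / (2 * Real.pi)) := by
    rw [Real.fourier_eq', lineFourier]
    refine integral_congr_ae (Eventually.of_forall fun u => ?_)
    simp only [G, smul_eq_mul, RCLike.inner_apply, conj_trivial]
    rw [mul_comm]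
    congr 2
    have : (Real.pi : ℂ) ≠ 0 := by exact_mod_cast Real.pi_ne_zero
    push_cast
    field_simp
  have hD := congrFun (Real.fourier_iteratedDeriv (N := ⊤) (n := k) (f := G) hG (fun m _ => hint m)
    le_top) (-ζ / (2 * Real.pi))
  have h3 := congrArg norm hD
  rw [norm_smul, norm_pow, ← hF] at h3
  have h4 : ‖(2 * Real.pi * Complex.I * ((-ζ / (2 * Real.pi) : ℝ) : ℂ))‖ = |ζ| := by
    simp only [norm_mul, Complex.norm_real, Complex.norm_I, Complex.norm_ofNat, Real.norm_eq_abs,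
      abs_div, abs_neg, abs_mul, abs_two]
    have : |Real.pi| ≠ 0 := abs_ne_zero.2 Real.pi_ne_zero
    field_simp
  rw [h4] at h3
  rw [← h3, Real.fourier_eq']
  refine (norm_integral_le_integral_norm _).trans ?_
  have hzero : ∀ x, x ∉ Set.Icc (-3 : ℝ) 3 → iteratedDeriv k G x = 0 := fun x hx => by
    refine image_eq_zero_of_notMem_tsupport fun h => hx ?_
    have h5 : tsupport G ⊆ Set.Icc (-3) 3 := closure_minimal hsuppG isClosed_Icc
    have h6 : tsupport (iteratedDeriv k G) ⊆ tsupport G := by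
      refine closure_minimal (fun y hy => ?_) (isClosed_tsupport _)
      by_contra hcon
      refine hy ?_
      have h1 := image_eq_zero_of_notMem_tsupport (f := iteratedFDeriv ℝ k G) fun h =>
        hcon (tsupport_iteratedFDeriv_subset k h)
      rw [iteratedDeriv_eq_iteratedFDeriv, h1]
      rfl
    exact h5 (h6 h)
  rw [← setIntegral_eq_integral_of_forall_compl_eq_zero (s := Set.Icc (-3 : ℝ) 3)
    fun x hx => by rw [hzero x hx, smul_zero, norm_zero]]
  have h7 := norm_setIntegral_le_of_norm_le_const (μ := volume) (s := Set.Icc (-3 : ℝ) 3)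
    (f := fun v => ‖Complex.exp (((-2 * Real.pi * inner ℝ v (-ζ / (2 * Real.pi)) : ℝ) : ℂ) *
      Complex.I) • iteratedDeriv k G v‖) (C := B) (by simp) fun x _ => by
      rw [norm_norm, norm_smul, Complex.norm_exp_ofReal_mul_I, one_mul, hnorm]
      exact hB x
  refine (le_abs_self _).trans (h7.trans (le_of_eq ?_))
  rw [Measure.real, Real.volume_Icc, ENNReal.toReal_ofReal (by norm_num)]
  ring

/-! ### Position and derivative operators on the Schwartz space -/

/-- The space `ℝⁿ`. -/
abbrev Euc (n : ℕ) : Type := EuclideanSpace ℝ (Fin n)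

/-- Multiplication of Schwartz functions by the linear form `⟪v, ·⟫`. -/
noncomputable def mulInner {n : ℕ} (v : Euc n) : 𝓢(Euc n, ℂ) →L[ℂ] 𝓢(Euc n, ℂ) :=
  SchwartzMap.smulLeftCLM ℂ fun ξ : Euc n => ((⟪v, ξ⟫_ℝ : ℝ) : ℂ)

theorem mulInner_apply {n : ℕ} (v : Euc n) (g : 𝓢(Euc n, ℂ)) (ξ : Euc n) :
    mulInner v g ξ = ((⟪v, ξ⟫_ℝ : ℝ) : ℂ) * g ξ := by
  have h : Function.HasTemperateGrowth fun ξ : Euc n => ((⟪v, ξ⟫_ℝ : ℝ) : ℂ) := by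
    fun_prop
  rw [mulInner, SchwartzMap.smulLeftCLM_apply_apply h, smul_eq_mul]

theorem mulInner_comm {n : ℕ} (v w : Euc n) (g : 𝓢(Euc n, ℂ)) :
    mulInner v (mulInner w g) = mulInner w (mulInner v g) := by
  ext ξ
  simp only [mulInner_apply]
  ring

theorem lineDerivOp_comm {n : ℕ} (v w : Euc n) (g : 𝓢(Euc n, ℂ)) :
    ∂_{v} (∂_{w} g) = ∂_{w} (∂_{v} g) := by
  ext ξ
  have h1 := SchwartzMap.iteratedLineDerivOp_eq_iteratedFDeriv (m := ![v, w]) (f := g) (x := ξ)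
  have h2 := SchwartzMap.iteratedLineDerivOp_eq_iteratedFDeriv (m := ![w, v]) (f := g) (x := ξ)
  have h3 := (g.contDiffAt ⊤ (x := ξ)).isSymmSndFDerivAt (by
    rw [minSmoothness_of_isRCLikeNormedField]
    exact WithTop.coe_le_coe.2 (le_top : (2 : ℕ∞) ≤ ⊤))
  rw [iteratedFDeriv_two_apply] at h1 h2
  have h4 := h3.eq v w
  simp only [LineDeriv.iteratedLineDerivOp_succ_left] at h1 h2
  simp only [Matrix.cons_val_zero, Matrix.cons_val_one] at h1 h2
  have h5 : ∂_{v} (∂_{w} g) ξ = fderiv ℝ (fderiv ℝ g) ξ v w := h1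
  have h6 : ∂_{w} (∂_{v} g) ξ = fderiv ℝ (fderiv ℝ g) ξ w v := h2
  rw [h5, h6, h4]

theorem lineDerivOp_sub {n : ℕ} (v : Euc n) (g h : 𝓢(Euc n, ℂ)) :
    ∂_{v} (g - h) = ∂_{v} g - ∂_{v} h := by
  rw [sub_eq_add_neg, LineDeriv.lineDerivOp_add, LineDeriv.lineDerivOp_neg, sub_eq_add_neg]

theorem lineDerivOp_mulInner {n : ℕ} (v w : Euc n) (g : 𝓢(Euc n, ℂ)) :
    ∂_{v} (mulInner w g) = mulInner w (∂_{v} g) + ((⟪w, v⟫_ℝ : ℝ) : ℂ) • g := by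
  ext ξ
  rw [_root_.add_apply, _root_.smul_apply, mulInner_apply,
    SchwartzMap.lineDerivOp_apply_eq_fderiv, SchwartzMap.lineDerivOp_apply_eq_fderiv, smul_eq_mul]
  have h0 : (mulInner w g : Euc n → ℂ) = fun ξ => ((⟪w, ξ⟫_ℝ : ℝ) : ℂ) * g ξ :=
    funext fun ξ => mulInner_apply w g ξ
  have h1 : HasFDerivAt (fun ξ : Euc n => ((⟪w, ξ⟫_ℝ : ℝ) : ℂ))
      (Complex.ofRealCLM.comp (innerSL ℝ w)) ξ :=
    (Complex.ofRealCLM.comp (innerSL ℝ w)).hasFDerivAt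
  rw [h0, (h1.fun_mul (g.hasFDerivAt ξ)).fderiv]
  simp
  ring

theorem hermiteOp_eq_sum (n : ℕ) (lam : ℝ) (g : 𝓢(Euc n, ℂ)) :
    hermiteOp n lam g = ∑ i, (-(∂_{EuclideanSpace.basisFun (Fin n) ℝ i}
      (∂_{EuclideanSpace.basisFun (Fin n) ℝ i} g)) +
      ((lam ^ 2 : ℝ) : ℂ) • mulInner (EuclideanSpace.basisFun (Fin n) ℝ i)
        (mulInner (EuclideanSpace.basisFun (Fin n) ℝ i) g)) := by
  rw [hermiteOp, _root_.add_apply, _root_.neg_apply,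
    SchwartzMap.laplacianCLM_eq, SchwartzMap.laplacian_eq_sum (EuclideanSpace.basisFun (Fin n) ℝ),
    Finset.sum_add_distrib,
    Finset.sum_neg_distrib]
  congr 1
  ext ξ
  have hg : Function.HasTemperateGrowth
      fun ξ : Euc n => ((lam ^ 2 * ‖ξ‖ ^ 2 : ℝ) : ℂ) := by
    fun_prop
  rw [SchwartzMap.smulLeftCLM_apply_apply hg, _root_.sum_apply]
  simp only [_root_.smul_apply, mulInner_apply, smul_eq_mul]
  rw [← Finset.mul_sum]
  simp only [← mul_assoc]
  rw [← Finset.sum_mul, EuclideanSpace.real_norm_sq_eq]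
  simp only [EuclideanSpace.basisFun_apply, EuclideanSpace.inner_single_left, map_one, one_mul]
  push_cast
  simp only [pow_two]
  ring

/-- The creation operator `κ ⟪e, ·⟫ - ∂_e`. -/
noncomputable def creation {n : ℕ} (κ : ℝ) (e : Euc n) (g : 𝓢(Euc n, ℂ)) : 𝓢(Euc n, ℂ) :=
  (κ : ℂ) • mulInner e g - ∂_{e} g

/-- The annihilation operator `κ ⟪e, ·⟫ + ∂_e`. -/
noncomputable def annihilation {n : ℕ} (κ : ℝ) (e : Euc n) (g : 𝓢(Euc n, ℂ)) : 𝓢(Euc n, ℂ) :=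
  (κ : ℂ) • mulInner e g + ∂_{e} g

theorem annihilation_creation {n : ℕ} (κ : ℝ) {e : Euc n} (he : ‖e‖ = 1) (g : 𝓢(Euc n, ℂ)) :
    annihilation κ e (creation κ e g) = creation κ e (annihilation κ e g) + ((2 * κ : ℝ) : ℂ) • g := by
  have h1 : ⟪e, e⟫_ℝ = 1 := by rw [real_inner_self_eq_norm_sq, he, one_pow]
  unfold annihilation creation
  simp only [map_add, map_sub, map_smul, LineDeriv.lineDerivOp_add, lineDerivOp_sub,
    LineDeriv.lineDerivOp_smul, lineDerivOp_mulInner, h1]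
  push_cast
  module

theorem hermiteOp_creation {n : ℕ} {lam κ : ℝ} (hκ : κ ^ 2 = lam ^ 2) (e : Euc n)
    (g : 𝓢(Euc n, ℂ)) :
    hermiteOp n lam (creation κ e g) =
      creation κ e (hermiteOp n lam g) + ((2 * κ : ℝ) : ℂ) • creation κ e g := by
  set b := EuclideanSpace.basisFun (Fin n) ℝ with hb
  have hX : mulInner e g = ∑ i, ((⟪e, b i⟫_ℝ : ℝ) : ℂ) • mulInner (b i) g := by
    ext ξ
    rw [_root_.sum_apply]
    simp only [_root_.smul_apply, mulInner_apply, smul_eq_mul, ← mul_assoc, ← Finset.sum_mul]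
    rw [← b.sum_inner_mul_inner e ξ]
    push_cast
    rfl
  have hD : ∂_{e} g = ∑ i, ((⟪e, b i⟫_ℝ : ℝ) : ℂ) • ∂_{b i} g := by
    ext ξ
    rw [_root_.sum_apply]
    simp only [_root_.smul_apply, SchwartzMap.lineDerivOp_apply_eq_fderiv, smul_eq_mul]
    conv_lhs => rw [← b.sum_repr' e]
    rw [map_sum]
    refine Finset.sum_congr rfl fun i _ => ?_
    rw [map_smul, real_inner_comm, Complex.real_smul]
  have key : ∀ i, (-(∂_{b i} (∂_{b i} (creation κ e g))) +
      ((lam ^ 2 : ℝ) : ℂ) • mulInner (b i) (mulInner (b i) (creation κ e g))) =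
      creation κ e (-(∂_{b i} (∂_{b i} g)) + ((lam ^ 2 : ℝ) : ℂ) • mulInner (b i) (mulInner (b i) g))
      + ((2 * κ : ℝ) : ℂ) • ((κ : ℂ) • (((⟪e, b i⟫_ℝ : ℝ) : ℂ) • mulInner (b i) g) -
        ((⟪e, b i⟫_ℝ : ℝ) : ℂ) • ∂_{b i} g) := by
    intro i
    unfold creation
    simp only [map_add, map_sub, map_smul, map_neg, LineDeriv.lineDerivOp_add,
      lineDerivOp_sub, LineDeriv.lineDerivOp_smul, lineDerivOp_mulInner,
      LineDeriv.lineDerivOp_neg]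
    rw [lineDerivOp_comm (b i) e, lineDerivOp_comm (b i) e, mulInner_comm (b i) e,
      mulInner_comm (b i) e, real_inner_comm, ← hκ]
    push_cast
    module
  rw [hermiteOp_eq_sum, Finset.sum_congr rfl fun i _ => key i, Finset.sum_add_distrib,
    ← Finset.smul_sum, Finset.sum_sub_distrib, ← Finset.smul_sum, ← hX, ← hD]
  congr 1
  rw [hermiteOp_eq_sum]
  unfold creation
  rw [map_sum, LineDeriv.lineDerivOp_sum, Finset.smul_sum, ← Finset.sum_sub_distrib]

/-! ### Uniqueness for the Fourier transform -/

/-- An integrable function whose Fourier transform vanishes almost everywhere is zero. -/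
theorem ae_eq_zero_of_fourier_ae_eq_zero {V : Type*} [NormedAddCommGroup V] [InnerProductSpace ℝ V]
    [FiniteDimensional ℝ V] [MeasurableSpace V] [BorelSpace V] {k : V → ℂ} (hk : Integrable k)
    (h : ∀ᵐ w : V, ∫ v, k v * Complex.exp (Complex.I * ((⟪w, v⟫_ℝ : ℝ) : ℂ)) = 0) :
    k =ᵐ[volume] 0 := by
  have hF : ∀ᵐ w : V, FourierTransform.fourier k w = 0 := by
    have hq : Measure.QuasiMeasurePreserving (fun w : V => (-(2 * Real.pi)) • w) volume volume := by
      refine ⟨by fun_prop, ?_⟩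
      have h2 : (-(2 * Real.pi)) ≠ 0 := neg_ne_zero.2 Real.two_pi_pos.ne'
      rw [Measure.map_addHaar_smul volume h2]
      exact Measure.smul_absolutelyContinuous
    filter_upwards [hq.ae h] with w hw
    rw [Real.fourier_eq']
    rw [← hw]
    refine integral_congr_ae (Eventually.of_forall fun v => ?_)
    simp only [smul_eq_mul]
    rw [mul_comm]
    congr 2
    rw [real_inner_smul_left, real_inner_comm]
    push_cast
    ring
  refine ae_eq_zero_of_integral_contDiff_smul_eq_zero hk.locallyIntegrable fun g hg hgs => ?_
  let gs : 𝓢(V, ℂ) := HasCompactSupport.toSchwartzMap (f := fun x => (g x : ℂ))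
    (hgs.comp_left Complex.ofReal_zero) (Complex.ofRealCLM.contDiff.comp hg)
  have h1 : FourierTransform.fourier (FourierTransform.fourierInv gs) = gs :=
    FourierTransform.fourier_fourierInv_eq gs
  have h2 := VectorFourier.integral_bilin_fourierIntegral_eq_flip
    (ContinuousLinearMap.lsmul ℂ ℂ) (L := innerₗ V) Real.continuous_fourierChar continuous_inner
    hk (SchwartzMap.integrable (FourierTransform.fourierInv gs : 𝓢(V, ℂ)) (μ := volume))
  have h3 : ∀ x, VectorFourier.fourierIntegral Real.fourierChar volume (innerₗ V).flip
      (FourierTransform.fourierInv gs : 𝓢(V, ℂ)) x = gs x := by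
    intro x
    have h4 : (FourierTransform.fourier (FourierTransform.fourierInv gs) : 𝓢(V, ℂ)) x = gs x := by
      rw [h1]
    rw [← h4, flip_innerₗ]
    rfl
  have h5 : ∫ ξ, (ContinuousLinearMap.lsmul ℂ ℂ) (VectorFourier.fourierIntegral Real.fourierChar
      volume (innerₗ V) k ξ) ((FourierTransform.fourierInv gs : 𝓢(V, ℂ)) ξ) = 0 := by
    refine integral_eq_zero_of_ae ?_
    filter_upwards [hF] with w hw
    have : VectorFourier.fourierIntegral Real.fourierChar volume (innerₗ V) k w = 0 := hw
    rw [this]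
    simp
  rw [h5] at h2
  rw [← h2.symm]
  refine integral_congr_ae (Eventually.of_forall fun x => ?_)
  simp only [h3]
  change g x • k x = k x • ((g x : ℂ))
  rw [Complex.real_smul, smul_eq_mul, mul_comm]

theorem eq_zero_of_fourier_ae_eq_zero {V : Type*} [NormedAddCommGroup V] [InnerProductSpace ℝ V]
    [FiniteDimensional ℝ V] [MeasurableSpace V] [BorelSpace V] {k : V → ℂ} (hk : Integrable k)
    (hc : Continuous k)
    (h : ∀ᵐ w : V, ∫ v, k v * Complex.exp (Complex.I * ((⟪w, v⟫_ℝ : ℝ) : ℂ)) = 0) : k = 0 :=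
  (hc.ae_eq_iff_eq volume continuous_const).1 (ae_eq_zero_of_fourier_ae_eq_zero hk h)

/-! ### Gaussians and coherent states -/

theorem exists_pow_mul_exp_le {κ : ℝ} (hκ : 0 < κ) (M : ℕ) :
    ∃ C : ℝ, ∀ x : ℝ, 0 ≤ x → (1 + x) ^ M * Real.exp (-(κ / 2) * x ^ 2) ≤ C := by
  refine ⟨M.factorial * Real.exp (1 + 1 / (2 * κ)), fun x hx => ?_⟩
  have h1 := Real.pow_div_factorial_le_exp (1 + x) (by linarith) M
  rw [div_le_iff₀ (by positivity)] at h1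
  have h2 : 1 + x + -(κ / 2) * x ^ 2 ≤ 1 + 1 / (2 * κ) := by
    have h3 : 1 + 1 / (2 * κ) - (1 + x + -(κ / 2) * x ^ 2) = (κ * x - 1) ^ 2 / (2 * κ) := by
      field_simp
      ring
    have h4 : 0 ≤ (κ * x - 1) ^ 2 / (2 * κ) := by positivity
    linarith
  calc (1 + x) ^ M * Real.exp (-(κ / 2) * x ^ 2)
      ≤ Real.exp (1 + x) * M.factorial * Real.exp (-(κ / 2) * x ^ 2) := by gcongr
    _ = M.factorial * Real.exp (1 + x + -(κ / 2) * x ^ 2) := by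
          rw [Real.exp_add (1 + x)]
          ring
    _ ≤ _ := by gcongr

theorem norm_iteratedFDeriv_gaussian_le {n : ℕ} {κ : ℝ} (k m : ℕ) :
    ∃ (M : ℕ) (C : ℝ), 0 ≤ C ∧ ∀ x : Euc n, ‖x‖ ^ k * ‖iteratedFDeriv ℝ m
      (fun ξ : Euc n => Real.exp (-(κ / 2) * ‖ξ‖ ^ 2)) x‖ ≤
        C * ((1 + ‖x‖) ^ M * Real.exp (-(κ / 2) * ‖x‖ ^ 2)) := by
  have hq : Function.HasTemperateGrowth fun ξ : Euc n => -(κ / 2) * ‖ξ‖ ^ 2 := by fun_prop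
  obtain ⟨a, C, hC, hb⟩ := hq.norm_iteratedFDeriv_le_uniform m
  refine ⟨k + a * m, m.factorial * (max C 1) ^ m, by positivity, fun x => ?_⟩
  have h1 : (1 : ℝ) ≤ 1 + ‖x‖ := by linarith [norm_nonneg x]
  have h2 : (1 : ℝ) ≤ max C 1 * (1 + ‖x‖) ^ a :=
    one_le_mul_of_one_le_of_one_le (le_max_right _ _) (one_le_pow₀ h1)
  have h3 := norm_iteratedFDeriv_comp_le (𝕜 := ℝ) (g := Real.exp) (n := m) (N := m)
    Real.contDiff_exp (hq.1.of_le (by exact_mod_cast le_top)) le_rfl x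
    (C := Real.exp (-(κ / 2) * ‖x‖ ^ 2)) (D := max C 1 * (1 + ‖x‖) ^ a)
    (fun i _ => by
      rw [norm_iteratedFDeriv_eq_norm_iteratedDeriv, iteratedDeriv_eq_iterate, Real.iter_deriv_exp,
        Real.norm_of_nonneg (Real.exp_pos _).le])
    (fun i hi hi' => by
      refine (hb i hi' x).trans (le_trans ?_ (le_self_pow₀ h2 (by omega)))
      gcongr
      exact le_max_left _ _)
  calc _ ≤ (1 + ‖x‖) ^ k * (m.factorial * Real.exp (-(κ / 2) * ‖x‖ ^ 2) *
        (max C 1 * (1 + ‖x‖) ^ a) ^ m) := by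
        gcongr
        · linarith
        · exact h3
    _ = _ := by
        rw [mul_pow, ← pow_mul, pow_add]
        ring

/-- The Gaussian `exp (-κ |ξ|² / 2)` as a Schwartz function. -/
noncomputable def gaussianSchwartz (n : ℕ) {κ : ℝ} (hκ : 0 < κ) : 𝓢(Euc n, ℂ) where
  toFun ξ := (Real.exp (-(κ / 2) * ‖ξ‖ ^ 2) : ℂ)
  smooth' := by
    have : ContDiff ℝ (⊤ : ℕ∞) fun ξ : Euc n => Real.exp (-(κ / 2) * ‖ξ‖ ^ 2) :=
      Real.contDiff_exp.comp (contDiff_const.mul (contDiff_norm_sq ℝ))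
    exact Complex.ofRealCLM.contDiff.comp this
  decay' k m := by
    obtain ⟨M, C, hC, h⟩ := norm_iteratedFDeriv_gaussian_le (n := n) (κ := κ) k m
    obtain ⟨C', h'⟩ := exists_pow_mul_exp_le hκ M
    have hcd : ContDiff ℝ m fun ξ : Euc n => Real.exp (-(κ / 2) * ‖ξ‖ ^ 2) :=
      Real.contDiff_exp.comp (contDiff_const.mul (contDiff_norm_sq ℝ))
    refine ⟨C * C', fun x => ?_⟩
    have h1 := Complex.ofRealLI.norm_iteratedFDeriv_comp_left (x := x) hcd.contDiffAt le_rfl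
    refine le_trans (le_of_eq ?_) ((h x).trans
      (mul_le_mul_of_nonneg_left (h' _ (norm_nonneg x)) hC))
    rw [← h1]
    rfl

theorem gaussianSchwartz_apply {n : ℕ} {κ : ℝ} (hκ : 0 < κ) (ξ : Euc n) :
    gaussianSchwartz n hκ ξ = Complex.exp (-(κ / 2) * ‖ξ‖ ^ 2) := by
  change ((Real.exp (-(κ / 2) * ‖ξ‖ ^ 2) : ℝ) : ℂ) = _
  push_cast
  rfl

theorem hasTemperateGrowth_cexp_I : Function.HasTemperateGrowth
    fun s : ℝ => Complex.exp (Complex.I * (s : ℂ)) := by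
  have h : ∀ m : ℕ, iteratedDeriv m (fun s : ℝ => Complex.exp (Complex.I * (s : ℂ))) =
      fun s : ℝ => Complex.I ^ m * Complex.exp (Complex.I * (s : ℂ)) := by
    intro m
    induction m with
    | zero => simp
    | succ m ih =>
      rw [iteratedDeriv_succ, ih]
      funext s
      have h1 : HasDerivAt (fun s : ℝ => Complex.exp (Complex.I * (s : ℂ)))
          (Complex.exp (Complex.I * (s : ℂ)) * (Complex.I * 1)) s :=
        ((Complex.ofRealCLM.hasDerivAt (x := s)).const_mul Complex.I).cexp
      rw [(h1.const_mul _).deriv]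
      ring
  refine ⟨?_, fun m => ⟨0, 1, fun x => ?_⟩⟩
  · exact (contDiff_const.mul Complex.ofRealCLM.contDiff).cexp
  · rw [norm_iteratedFDeriv_eq_norm_iteratedDeriv, h, norm_mul, norm_pow, Complex.norm_I,
      Complex.norm_exp_I_mul_ofReal]
    simp

/-- The coherent state `exp (i ⟪w, ξ⟫) exp (-κ |ξ|² / 2)`. -/
noncomputable def coherent {n : ℕ} {κ : ℝ} (hκ : 0 < κ) (w : Euc n) : 𝓢(Euc n, ℂ) :=
  SchwartzMap.smulLeftCLM ℂ (fun ξ : Euc n => Complex.exp (Complex.I * ((⟪w, ξ⟫_ℝ : ℝ) : ℂ)))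
    (gaussianSchwartz n hκ)

theorem coherent_apply {n : ℕ} {κ : ℝ} (hκ : 0 < κ) (w ξ : Euc n) :
    coherent hκ w ξ = Complex.exp (Complex.I * ((⟪w, ξ⟫_ℝ : ℝ) : ℂ)) *
      Complex.exp (-(κ / 2) * ‖ξ‖ ^ 2) := by
  have h : Function.HasTemperateGrowth
      fun ξ : Euc n => Complex.exp (Complex.I * ((⟪w, ξ⟫_ℝ : ℝ) : ℂ)) :=
    hasTemperateGrowth_cexp_I.comp (by fun_prop : Function.HasTemperateGrowth fun ξ => ⟪w, ξ⟫_ℝ)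
  rw [coherent, SchwartzMap.smulLeftCLM_apply_apply h, gaussianSchwartz_apply, smul_eq_mul]

theorem lineDerivOp_coherent {n : ℕ} {κ : ℝ} (hκ : 0 < κ) (w v : Euc n) :
    ∂_{v} (coherent hκ w) = (Complex.I * ((⟪w, v⟫_ℝ : ℝ) : ℂ)) • coherent hκ w -
      (κ : ℂ) • mulInner v (coherent hκ w) := by
  ext ξ
  have h0 : (coherent hκ w : Euc n → ℂ) = fun ξ => Complex.exp (Complex.I *
      ((⟪w, ξ⟫_ℝ : ℝ) : ℂ) + ((-(κ / 2) * ‖ξ‖ ^ 2 : ℝ) : ℂ)) := funext fun ξ => by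
    rw [coherent_apply, Complex.exp_add]
    push_cast
    rfl
  have h1 : HasFDerivAt (fun ξ : Euc n => ((⟪w, ξ⟫_ℝ : ℝ) : ℂ))
      (Complex.ofRealCLM.comp (innerSL ℝ w)) ξ :=
    (Complex.ofRealCLM.comp (innerSL ℝ w)).hasFDerivAt
  have h2 : HasFDerivAt (fun ξ : Euc n => ((-(κ / 2) * ‖ξ‖ ^ 2 : ℝ) : ℂ))
      (Complex.ofRealCLM.comp ((-(κ / 2)) • (2 • innerSL ℝ ξ))) ξ :=
    Complex.ofRealCLM.hasFDerivAt.comp ξ ((hasStrictFDerivAt_norm_sq ξ).hasFDerivAt.const_mul _)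
  have h3 := ((h1.const_mul Complex.I).add h2).cexp
  rw [_root_.sub_apply, _root_.smul_apply, _root_.smul_apply, mulInner_apply,
    SchwartzMap.lineDerivOp_apply_eq_fderiv]
  rw [h0]
  have h4 := h3.fderiv
  change (fderiv ℝ (fun ξ : Euc n => Complex.exp (Complex.I *
      ((⟪w, ξ⟫_ℝ : ℝ) : ℂ) + ((-(κ / 2) * ‖ξ‖ ^ 2 : ℝ) : ℂ))) ξ) v = _
  erw [h4]
  simp [real_inner_comm]
  ring

theorem annihilation_coherent {n : ℕ} {κ : ℝ} (hκ : 0 < κ) (e w : Euc n) :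
    annihilation κ e (coherent hκ w) = (Complex.I * ((⟪w, e⟫_ℝ : ℝ) : ℂ)) • coherent hκ w := by
  rw [annihilation, lineDerivOp_coherent]
  module

theorem hermiteOp_coherent_zero {n : ℕ} {lam κ : ℝ} (hκ : 0 < κ) (hl : κ ^ 2 = lam ^ 2) :
    hermiteOp n lam (coherent hκ 0) = ((n * κ : ℝ) : ℂ) • coherent hκ 0 := by
  rw [hermiteOp_eq_sum]
  have key : ∀ i : Fin n, (-(∂_{EuclideanSpace.basisFun (Fin n) ℝ i}
      (∂_{EuclideanSpace.basisFun (Fin n) ℝ i} (coherent hκ (0 : Euc n)))) +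
      ((lam ^ 2 : ℝ) : ℂ) • mulInner (EuclideanSpace.basisFun (Fin n) ℝ i)
        (mulInner (EuclideanSpace.basisFun (Fin n) ℝ i) (coherent hκ (0 : Euc n)))) =
      (κ : ℂ) • coherent hκ 0 := by
    intro i
    have h1 : ⟪EuclideanSpace.basisFun (Fin n) ℝ i, EuclideanSpace.basisFun (Fin n) ℝ i⟫_ℝ = 1 := by
      rw [real_inner_self_eq_norm_sq, OrthonormalBasis.norm_eq_one, one_pow]
    simp only [lineDerivOp_coherent, LineDeriv.lineDerivOp_smul, inner_zero_left,
      Complex.ofReal_zero, mul_zero, zero_smul, zero_sub, LineDeriv.lineDerivOp_neg,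
      lineDerivOp_mulInner, h1, map_neg, map_smul, ← hl]
    push_cast
    module
  rw [Finset.sum_congr rfl fun i _ => key i, Finset.sum_const, Finset.card_univ, Fintype.card_fin,
    ← Nat.cast_smul_eq_nsmul ℂ, smul_smul]
  push_cast
  rfl

/-! ### Spectral resolution of the Hermite operator -/

theorem hasSum_hermiteCalculus (n : ℕ) (lam : ℝ) (m : ℝ → ℝ) (hm : ∃ M, ∀ μ, |m μ| ≤ M)
    (φ : L2 n) : HasSum (fun μ : ℝ => (m μ : ℂ) • (hermiteEigenspace n lam μ).starProjection φ)
      (hermiteCalculus n lam m hm φ) := by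
  obtain ⟨M, hM⟩ := hm
  exact (summable_spectral n lam m M hM φ).1.hasSum

theorem inner_starProjection_self {H : Type*} [NormedAddCommGroup H] [InnerProductSpace ℂ H]
    (K : Submodule ℂ H) [K.HasOrthogonalProjection] (φ : H) :
    ⟪φ, K.starProjection φ⟫_ℂ = ((‖K.starProjection φ‖ ^ 2 : ℝ) : ℂ) := by
  have h := Submodule.starProjection_inner_eq_zero (K := K) φ (K.starProjection φ)
    (Submodule.starProjection_apply_mem _ _)
  rw [inner_sub_left, sub_eq_zero] at h
  rw [h, inner_self_eq_norm_sq_to_K]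
  norm_cast

theorem hasSum_inner_hermiteCalculus (n : ℕ) (lam : ℝ) (m : ℝ → ℝ) (hm : ∃ M, ∀ μ, |m μ| ≤ M)
    (φ : L2 n) :
    HasSum (fun μ : ℝ => ((m μ * ‖(hermiteEigenspace n lam μ).starProjection φ‖ ^ 2 : ℝ) : ℂ))
      ⟪φ, hermiteCalculus n lam m hm φ⟫_ℂ := by
  have h := (hasSum_hermiteCalculus n lam m hm φ).mapL (innerSL ℂ φ)
  have h1 : (fun μ : ℝ => ((m μ * ‖(hermiteEigenspace n lam μ).starProjection φ‖ ^ 2 : ℝ) : ℂ)) =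
      fun μ => innerSL ℂ φ ((m μ : ℂ) • (hermiteEigenspace n lam μ).starProjection φ) := by
    funext μ
    rw [innerSL_apply_apply, inner_smul_right, inner_starProjection_self]
    push_cast
    rfl
  rw [h1]
  exact h

/-- The mass at `μ` of the spectral measure of `H(λ)` at `φ`; it is zero unless `μ` is an
eigenvalue. -/
noncomputable def spectralMass {n : ℕ} (lam : ℝ) (φ : L2 n) (μ : ℝ) : ℝ :=
  ‖(hermiteEigenspace n lam μ).starProjection φ‖ ^ 2

theorem spectralMass_nonneg {n : ℕ} (lam : ℝ) (φ : L2 n) (μ : ℝ) : 0 ≤ spectralMass lam φ μ :=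
  sq_nonneg _

theorem hasSum_re_inner_hermiteCalculus (n : ℕ) (lam : ℝ) (m : ℝ → ℝ) (hm : ∃ M, ∀ μ, |m μ| ≤ M)
    (φ : L2 n) :
    HasSum (fun μ : ℝ => m μ * spectralMass lam φ μ)
      (RCLike.re ⟪φ, hermiteCalculus n lam m hm φ⟫_ℂ) := by
  exact (hasSum_inner_hermiteCalculus n lam m hm φ).mapL Complex.reCLM

theorem summable_spectralMass {n : ℕ} (lam : ℝ) (φ : L2 n) :
    Summable (spectralMass lam φ) ∧ ∑' μ, spectralMass lam φ μ ≤ ‖φ‖ ^ 2 := by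
  have hm : ∃ M, ∀ μ : ℝ, |(fun _ => (1 : ℝ)) μ| ≤ M := ⟨1, fun _ => by simp⟩
  have h := hasSum_re_inner_hermiteCalculus n lam (fun _ => 1) hm φ
  simp only [one_mul] at h
  refine ⟨h.summable, ?_⟩
  rw [h.tsum_eq]
  have h1 : ‖hermiteCalculus n lam (fun _ => 1) hm φ‖ ≤ 1 * ‖φ‖ := by
    have := (summable_spectral n lam (fun _ => 1) 1 (fun _ => by simp) φ).2
    exact this
  calc RCLike.re ⟪φ, hermiteCalculus n lam (fun _ => 1) hm φ⟫_ℂ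
      ≤ ‖φ‖ * ‖hermiteCalculus n lam (fun _ => 1) hm φ‖ := re_inner_le_norm _ _
    _ ≤ ‖φ‖ * (1 * ‖φ‖) := by gcongr
    _ = ‖φ‖ ^ 2 := by ring

theorem toLp_mem_hermiteEigenspace {n : ℕ} {lam μ : ℝ} {g : 𝓢(Euc n, ℂ)}
    (hg : hermiteOp n lam g = (μ : ℂ) • g) : g.toLp 2 volume ∈ hermiteEigenspace n lam μ := by
  refine Submodule.le_topologicalClosure _ ⟨g, ?_, rfl⟩
  simp [hg]

theorem sq_norm_inner_le_spectralMass {n : ℕ} {lam μ : ℝ} {h : L2 n}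
    (hh : h ∈ hermiteEigenspace n lam μ) (φ : L2 n) :
    ‖⟪h, φ⟫_ℂ‖ ^ 2 ≤ ‖h‖ ^ 2 * spectralMass lam φ μ := by
  have h1 := Submodule.starProjection_inner_eq_zero (K := hermiteEigenspace n lam μ) φ h hh
  rw [inner_sub_left, sub_eq_zero] at h1
  have h2 := norm_inner_le_norm (𝕜 := ℂ) ((hermiteEigenspace n lam μ).starProjection φ) h
  rw [← h1, ← inner_conj_symm, RCLike.norm_conj] at h2
  calc _ ≤ (‖(hermiteEigenspace n lam μ).starProjection φ‖ * ‖h‖) ^ 2 := by gcongr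
    _ = _ := by rw [spectralMass]; ring

theorem inner_creation_left {n : ℕ} (κ : ℝ) (e : Euc n) (g h : 𝓢(Euc n, ℂ)) :
    ⟪(creation κ e g).toLp 2 volume, h.toLp 2 volume⟫_ℂ =
      ⟪g.toLp 2 volume, (annihilation κ e h).toLp 2 volume⟫_ℂ := by
  let L : ℂ →L[ℝ] ℂ →L[ℝ] ℂ :=
    (ContinuousLinearMap.mul ℝ ℂ).comp (Complex.conjCLE : ℂ →L[ℝ] ℂ)
  have hL : ∀ a b : 𝓢(Euc n, ℂ), ⟪a.toLp 2 volume, b.toLp 2 volume⟫_ℂ =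
      ∫ ξ, L (a ξ) (b ξ) := by
    intro a b
    rw [SchwartzMap.inner_toL2_toL2_eq _ _ volume]
    refine integral_congr_ae (Eventually.of_forall fun ξ => ?_)
    simp [L, RCLike.inner_apply, mul_comm]
  have hint : ∀ a b : 𝓢(Euc n, ℂ), Integrable fun ξ => L (a ξ) (b ξ) :=
    fun a b => (SchwartzMap.pairing L a b).integrable
  have hparts := SchwartzMap.integral_bilinear_lineDerivOp_right_eq_neg_left (μ := volume) g h L e
  rw [hL, hL]
  simp only [creation, annihilation, _root_.sub_apply, _root_.add_apply, map_add, map_sub]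
  have hneg : -∫ ξ, L ((∂_{e} g) ξ) (h ξ) = ∫ ξ, L (g ξ) ((∂_{e} h) ξ) := hparts.symm
  rw [integral_add (hint _ _) (hint _ _), ← hneg, ← sub_eq_add_neg]
  rw [← integral_sub (hint _ _) (hint _ _)]
  refine integral_congr_ae (Eventually.of_forall fun ξ => ?_)
  simp only [_root_.smul_apply, mulInner_apply, smul_eq_mul, L,
    ContinuousLinearMap.comp_apply, ContinuousLinearMap.mul_apply',
    ContinuousLinearEquiv.coe_coe, Complex.conjCLE_apply, map_mul, Complex.conj_ofReal]
  ring

/-- The Hermite functions `(κ ⟪e, ·⟫ - ∂_e)^j exp (-κ |·|² / 2)` in the direction `e`. -/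
noncomputable def hermiteFn {n : ℕ} {κ : ℝ} (hκ : 0 < κ) (e : Euc n) : ℕ → 𝓢(Euc n, ℂ)
  | 0 => coherent hκ 0
  | j + 1 => creation κ e (hermiteFn hκ e j)

theorem hermiteOp_hermiteFn {n : ℕ} {lam κ : ℝ} (hκ : 0 < κ) (hl : κ ^ 2 = lam ^ 2) (e : Euc n)
    (j : ℕ) : hermiteOp n lam (hermiteFn hκ e j) =
      (((2 * j + n) * κ : ℝ) : ℂ) • hermiteFn hκ e j := by
  induction j with
  | zero =>
    rw [hermiteFn, hermiteOp_coherent_zero hκ hl]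
    simp
  | succ j ih =>
    rw [hermiteFn, hermiteOp_creation hl, ih]
    simp only [creation, map_smul, LineDeriv.lineDerivOp_smul]
    push_cast
    module

theorem annihilation_hermiteFn {n : ℕ} {κ : ℝ} (hκ : 0 < κ) {e : Euc n} (he : ‖e‖ = 1) (j : ℕ) :
    annihilation κ e (hermiteFn hκ e (j + 1)) =
      ((2 * κ * (j + 1) : ℝ) : ℂ) • hermiteFn hκ e j := by
  induction j with
  | zero =>
    change annihilation κ e (creation κ e (coherent hκ 0)) = _ • coherent hκ 0
    rw [annihilation_creation κ he, annihilation_coherent]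
    simp [creation]
  | succ j ih =>
    rw [hermiteFn, annihilation_creation κ he, ih]
    rw [hermiteFn]
    simp only [creation, map_smul, LineDeriv.lineDerivOp_smul]
    push_cast
    module

theorem toLp_smul {n : ℕ} (c : ℂ) (g : 𝓢(Euc n, ℂ)) :
    (c • g).toLp 2 volume = c • g.toLp 2 volume :=
  (SchwartzMap.toLpCLM ℂ ℂ 2 (volume : Measure (Euc n))).map_smul c g

theorem norm_sq_hermiteFn {n : ℕ} {κ : ℝ} (hκ : 0 < κ) {e : Euc n} (he : ‖e‖ = 1) (j : ℕ) :
    ‖(hermiteFn hκ e j).toLp 2 volume‖ ^ 2 =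
      (2 * κ) ^ j * j.factorial * ‖(coherent hκ (0 : Euc n)).toLp 2 volume‖ ^ 2 := by
  induction j with
  | zero => simp [hermiteFn]
  | succ j ih =>
    have h1 := inner_creation_left κ e (hermiteFn hκ e j) (hermiteFn hκ e (j + 1))
    rw [annihilation_hermiteFn hκ he, toLp_smul, inner_smul_right] at h1
    change ⟪(hermiteFn hκ e (j + 1)).toLp 2 volume, (hermiteFn hκ e (j + 1)).toLp 2 volume⟫_ℂ = _
      at h1
    rw [inner_self_eq_norm_sq_to_K, inner_self_eq_norm_sq_to_K] at h1
    have h2 : ‖(hermiteFn hκ e (j + 1)).toLp 2 volume‖ ^ 2 =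
        (2 * κ * (j + 1)) * ‖(hermiteFn hκ e j).toLp 2 volume‖ ^ 2 := by
      rw [RCLike.ofReal_eq_complex_ofReal] at h1
      exact_mod_cast h1
    rw [h2, ih, Nat.factorial_succ]
    push_cast
    ring

theorem inner_hermiteFn_coherent {n : ℕ} {κ : ℝ} (hκ : 0 < κ) (e w : Euc n) (j : ℕ) :
    ⟪(hermiteFn hκ e j).toLp 2 volume, (coherent hκ w).toLp 2 volume⟫_ℂ =
      (Complex.I * ((⟪w, e⟫_ℝ : ℝ) : ℂ)) ^ j *
        ⟪(coherent hκ (0 : Euc n)).toLp 2 volume, (coherent hκ w).toLp 2 volume⟫_ℂ := by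
  induction j with
  | zero => simp [hermiteFn]
  | succ j ih =>
    rw [hermiteFn, inner_creation_left, annihilation_coherent, toLp_smul, inner_smul_right, ih]
    ring

theorem conj_coherent {n : ℕ} {κ : ℝ} (hκ : 0 < κ) (w ξ : Euc n) :
    (starRingEnd ℂ) (coherent hκ w ξ) = coherent hκ (-w) ξ := by
  have h : Complex.exp (-((κ : ℂ) / 2) * ‖ξ‖ ^ 2) = ((Real.exp (-(κ / 2) * ‖ξ‖ ^ 2) : ℝ) : ℂ) := by
    push_cast
    rfl
  rw [coherent_apply, coherent_apply, h, map_mul, Complex.conj_ofReal, ← Complex.exp_conj, map_mul,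
    Complex.conj_I, Complex.conj_ofReal, inner_neg_left]
  push_cast
  congr 2
  ring

theorem inner_coherent_zero {n : ℕ} {κ : ℝ} (hκ : 0 < κ) (w : Euc n) :
    ⟪(coherent hκ (0 : Euc n)).toLp 2 volume, (coherent hκ w).toLp 2 volume⟫_ℂ =
      ((‖(coherent hκ (0 : Euc n)).toLp 2 volume‖ ^ 2 *
        Real.exp (-(‖w‖ ^ 2 / (4 * κ))) : ℝ) : ℂ) := by
  have h : ∀ w : Euc n, ⟪(coherent hκ (0 : Euc n)).toLp 2 volume, (coherent hκ w).toLp 2 volume⟫_ℂ =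
      ∫ v : Euc n, Complex.exp (-(κ : ℂ) * ‖v‖ ^ 2 + Complex.I * ((⟪w, v⟫_ℝ : ℝ) : ℂ)) := by
    intro w
    rw [SchwartzMap.inner_toL2_toL2_eq _ _ volume]
    refine integral_congr_ae (Eventually.of_forall fun v => ?_)
    simp only [RCLike.inner_apply, conj_coherent]
    simp only [coherent_apply, inner_zero_left, neg_zero, ← Complex.exp_add]
    congr 1
    push_cast
    ring
  have h2 : ((‖(coherent hκ (0 : Euc n)).toLp 2 volume‖ ^ 2 : ℝ) : ℂ) =
      ⟪(coherent hκ (0 : Euc n)).toLp 2 volume, (coherent hκ (0 : Euc n)).toLp 2 volume⟫_ℂ := by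
    rw [inner_self_eq_norm_sq_to_K]
    norm_cast
  rw [Complex.ofReal_mul, h2, h, h, GaussianFourier.integral_cexp_neg_mul_sq_norm_add (by simpa),
    GaussianFourier.integral_cexp_neg_mul_sq_norm_add (by simpa)]
  simp [neg_div]

theorem norm_coherent {n : ℕ} {κ : ℝ} (hκ : 0 < κ) (w : Euc n) :
    ‖(coherent hκ w).toLp 2 volume‖ = ‖(coherent hκ (0 : Euc n)).toLp 2 volume‖ := by
  rw [Lp.norm_def, Lp.norm_def]
  congr 1
  refine eLpNorm_congr_norm_ae ?_
  filter_upwards [(coherent hκ w).coeFn_toLp 2 volume,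
    (coherent hκ (0 : Euc n)).coeFn_toLp 2 volume] with ξ h1 h2
  rw [h1, h2, coherent_apply, coherent_apply, norm_mul, norm_mul, Complex.norm_exp_I_mul_ofReal,
    Complex.norm_exp_I_mul_ofReal]

theorem norm_coherent_zero_pos {n : ℕ} {κ : ℝ} (hκ : 0 < κ) :
    0 < ‖(coherent hκ (0 : Euc n)).toLp 2 volume‖ := by
  refine norm_pos_iff.2 fun h => ?_
  have h1 : coherent hκ (0 : Euc n) = 0 :=
    SchwartzMap.injective_toLp 2 volume (h.trans
      (map_zero (SchwartzMap.toLpCLM ℂ ℂ 2 (volume : Measure (Euc n)))).symm)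
  have h2 : coherent hκ (0 : Euc n) 0 = 0 := by rw [h1]; rfl
  simp [coherent_apply] at h2

/-- The eigenvalues `(2 j + n) κ` of the Hermite operator. -/
def hermiteEigenvalue (n : ℕ) (κ : ℝ) (j : ℕ) : ℝ := (2 * j + n) * κ

theorem hermiteEigenvalue_injective (n : ℕ) {κ : ℝ} (hκ : 0 < κ) :
    Function.Injective (hermiteEigenvalue n κ) := by
  intro i j h
  have h1 := mul_right_cancel₀ hκ.ne' h
  have h2 : (i : ℝ) = j := by linarith
  exact_mod_cast h2

/-- The spectral masses of a coherent state are those of a Poisson distribution: the Hermite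
functions in the direction of `w` account for the whole norm of the state, so that Bessel's
inequality leaves no room for anything else. -/
theorem spectralMass_coherent {n : ℕ} {lam κ : ℝ} (hκ : 0 < κ) (hl : κ ^ 2 = lam ^ 2) {e : Euc n}
    (he : ‖e‖ = 1) (r : ℝ) :
    spectralMass lam ((coherent hκ (r • e)).toLp 2 volume) =
      Function.extend (hermiteEigenvalue n κ) (fun j =>
        ‖(coherent hκ (0 : Euc n)).toLp 2 volume‖ ^ 2 * (Real.exp (-(r ^ 2 / (2 * κ))) *
          ((r ^ 2 / (2 * κ)) ^ j / j.factorial))) 0 := by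
  set N := ‖(coherent hκ (0 : Euc n)).toLp 2 volume‖ ^ 2 with hN
  have hNpos : 0 < N := by have := norm_coherent_zero_pos (n := n) hκ; positivity
  set φ := (coherent hκ (r • e)).toLp 2 volume with hφ
  set p : ℕ → ℝ := fun j => N * (Real.exp (-(r ^ 2 / (2 * κ))) *
          ((r ^ 2 / (2 * κ)) ^ j / j.factorial)) with hp
  have hinj := hermiteEigenvalue_injective n hκ
  have hps : HasSum p (‖φ‖ ^ 2) := by
    have h1 := (NormedSpace.expSeries_div_hasSum_exp (r ^ 2 / (2 * κ))).mul_left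
      (Real.exp (-(r ^ 2 / (2 * κ)))) |>.mul_left N
    rw [← Real.exp_eq_exp_ℝ, ← Real.exp_add, neg_add_cancel, Real.exp_zero, mul_one] at h1
    rwa [hφ, norm_coherent]
  have hle : ∀ j, p j ≤ spectralMass lam φ (hermiteEigenvalue n κ j) := by
    intro j
    have h1 := sq_norm_inner_le_spectralMass (toLp_mem_hermiteEigenspace
      (hermiteOp_hermiteFn hκ hl e j)) φ
    rw [inner_hermiteFn_coherent, inner_coherent_zero, norm_sq_hermiteFn hκ he, ← hN] at h1
    rw [norm_mul, norm_pow, norm_mul, Complex.norm_I, one_mul, Complex.norm_real,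
      Complex.norm_real, real_inner_smul_left, real_inner_self_eq_norm_sq, he, norm_smul, he] at h1
    have h2 : 0 < (2 * κ) ^ j * j.factorial * N := by positivity
    rw [← div_le_iff₀' h2] at h1
    refine le_trans (le_of_eq ?_) h1
    have h3 : Real.exp (-(r ^ 2 / (2 * κ))) = Real.exp (-(r ^ 2 / (4 * κ))) ^ 2 := by
      rw [← Real.exp_nat_mul]
      congr 1
      push_cast
      field_simp
      ring
    simp only [hp, h3, one_pow, mul_one, Real.norm_eq_abs, mul_pow, sq_abs, abs_mul,
      abs_of_pos hNpos, abs_of_pos (Real.exp_pos _), div_pow]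
    have h4 : (|r| ^ j) ^ 2 = (r ^ 2) ^ j := by rw [← pow_mul, mul_comm j 2, pow_mul, sq_abs]
    rw [h4]
    field_simp
  have hsm := summable_spectralMass lam φ
  have hext : HasSum (Function.extend (hermiteEigenvalue n κ) p 0) (‖φ‖ ^ 2) :=
    (hasSum_extend_zero hinj).2 hps
  have hnn : ∀ μ, 0 ≤ spectralMass lam φ μ - Function.extend (hermiteEigenvalue n κ) p 0 μ := by
    intro μ
    rw [sub_nonneg]
    by_cases hμ : ∃ j, hermiteEigenvalue n κ j = μ
    · obtain ⟨j, rfl⟩ := hμ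
      rw [hinj.extend_apply]
      exact hle j
    · rw [Function.extend_apply' _ _ _ hμ]
      exact spectralMass_nonneg _ _ _
  have hd := hsm.1.hasSum.sub hext
  have h0 : ∑' μ, spectralMass lam φ μ - ‖φ‖ ^ 2 = 0 :=
    le_antisymm (by linarith [hsm.2]) (hd.nonneg hnn)
  rw [h0] at hd
  have h1 := (hasSum_zero_iff_of_nonneg hnn).1 hd
  funext μ
  have := congrFun h1 μ
  simp only [Pi.zero_apply] at this
  linarith

theorem sum_mul_spectralMass_coherent {n : ℕ} {lam κ : ℝ} (hκ : 0 < κ) (hl : κ ^ 2 = lam ^ 2)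
    {e : Euc n} (he : ‖e‖ = 1) (r : ℝ) (m : ℝ → ℝ) (hm : ∃ M, ∀ μ, |m μ| ≤ M) :
    HasSum (fun j => m (hermiteEigenvalue n κ j) * (‖(coherent hκ (0 : Euc n)).toLp 2 volume‖ ^ 2 *
      (Real.exp (-(r ^ 2 / (2 * κ))) * ((r ^ 2 / (2 * κ)) ^ j / j.factorial))))
      (RCLike.re ⟪(coherent hκ (r • e)).toLp 2 volume,
        hermiteCalculus n lam m hm ((coherent hκ (r • e)).toLp 2 volume)⟫_ℂ) := by
  have h := hasSum_re_inner_hermiteCalculus n lam m hm ((coherent hκ (r • e)).toLp 2 volume)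
  have hinj := hermiteEigenvalue_injective n hκ
  rw [← hinj.hasSum_iff] at h
  · have h1 : (fun μ => m μ * spectralMass lam ((coherent hκ (r • e)).toLp 2 volume) μ) ∘
        hermiteEigenvalue n κ = fun j => m (hermiteEigenvalue n κ j) *
          (‖(coherent hκ (0 : Euc n)).toLp 2 volume‖ ^ 2 * (Real.exp (-(r ^ 2 / (2 * κ))) *
            ((r ^ 2 / (2 * κ)) ^ j / j.factorial))) := by
      funext j
      rw [Function.comp_apply, spectralMass_coherent hκ hl he, hinj.extend_apply]
    rw [← h1]
    exact h
  · intro μ hμ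
    rw [spectralMass_coherent hκ hl he, Function.extend_apply' _ _ _ hμ]
    simp

/-- Coherent states are total in `L²(ℝⁿ)`. -/
theorem eq_zero_of_inner_coherent_eq_zero {n : ℕ} {κ : ℝ} (hκ : 0 < κ) {φ : L2 n}
    (h : ∀ w : Euc n, ⟪(coherent hκ w).toLp 2 volume, φ⟫_ℂ = 0) : φ = 0 := by
  have hk : Integrable fun ξ => φ ξ * coherent hκ (0 : Euc n) ξ := by
    have h1 : MemLp (coherent hκ (0 : Euc n)) 2 volume := (coherent hκ (0 : Euc n)).memLp 2 volume
    exact (Lp.memLp φ).integrable_mul h1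
  have h1 := ae_eq_zero_of_fourier_ae_eq_zero hk (Eventually.of_forall fun w => by
    rw [← h (-w), L2.inner_def]
    refine integral_congr_ae ?_
    filter_upwards [(coherent hκ (-w)).coeFn_toLp 2 volume] with ξ h1
    rw [h1, RCLike.inner_apply, conj_coherent, neg_neg, coherent_apply, coherent_apply]
    simp only [inner_zero_left, Complex.ofReal_zero, mul_zero, Complex.exp_zero, one_mul]
    ring)
  refine (Lp.eq_zero_iff_ae_eq_zero).2 ?_
  filter_upwards [h1] with ξ h2
  refine (mul_eq_zero.1 h2).resolve_right ?_
  rw [coherent_apply]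
  exact mul_ne_zero (Complex.exp_ne_zero _) (Complex.exp_ne_zero _)

theorem clm_ext_of_coherent {n : ℕ} {κ : ℝ} (hκ : 0 < κ) {T S : L2 n →L[ℂ] L2 n}
    (h : ∀ w : Euc n, T ((coherent hκ w).toLp 2 volume) = S ((coherent hκ w).toLp 2 volume)) :
    T = S := by
  refine ContinuousLinearMap.ext_on (s := Set.range fun w : Euc n =>
    (coherent hκ w).toLp 2 volume) ?_ ?_
  · rw [Submodule.dense_iff_topologicalClosure_eq_top,
      Submodule.topologicalClosure_eq_top_iff, Submodule.eq_bot_iff]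
    intro φ hφ
    exact eq_zero_of_inner_coherent_eq_zero hκ fun w =>
      hφ _ (Submodule.subset_span (Set.mem_range_self w))
  · rintro _ ⟨w, rfl⟩
    exact h w

/-- `L²(ℝⁿ)` is the Hilbert sum of the eigenspaces of the Hermite operator: the sum of the spectral
projections fixes every coherent state, as its spectral masses add up to its squared norm. -/
theorem hasSum_starProjection_hermiteEigenspace {n : ℕ} (hn : 1 ≤ n) {lam : ℝ} (hlam : lam ≠ 0)
    (φ : L2 n) : HasSum (fun μ : ℝ => (hermiteEigenspace n lam μ).starProjection φ) φ := by
  have hm : ∃ M, ∀ μ : ℝ, |(fun _ => (1 : ℝ)) μ| ≤ M := ⟨1, fun _ => by simp⟩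
  have hκ : 0 < |lam| := abs_pos.2 hlam
  have hl : |lam| ^ 2 = lam ^ 2 := sq_abs lam
  obtain ⟨e, he⟩ : ∃ e : Euc n, ‖e‖ = 1 := ⟨EuclideanSpace.single ⟨0, hn⟩ 1, by simp⟩
  have hQ : hermiteCalculus n lam (fun _ => 1) hm = ContinuousLinearMap.id ℂ (L2 n) := by
    refine clm_ext_of_coherent hκ fun w => ?_
    obtain ⟨e, he, r, rfl⟩ : ∃ e : Euc n, ‖e‖ = 1 ∧ ∃ r : ℝ, w = r • e := by
      rcases eq_or_ne w 0 with rfl | hw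
      · exact ⟨e, he, 0, by simp⟩
      · refine ⟨‖w‖⁻¹ • w, norm_smul_inv_norm hw, ‖w‖, ?_⟩
        rw [smul_smul, mul_inv_cancel₀ (norm_ne_zero_iff.2 hw), one_smul]
    set φ := (coherent hκ (r • e)).toLp 2 volume
    have h1 : RCLike.re ⟪φ, hermiteCalculus n lam (fun _ => 1) hm φ⟫_ℂ = ‖φ‖ ^ 2 := by
      refine (sum_mul_spectralMass_coherent hκ hl he r (fun _ => 1) hm).unique ?_
      have h1 := (NormedSpace.expSeries_div_hasSum_exp (r ^ 2 / (2 * |lam|))).mul_left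
        (Real.exp (-(r ^ 2 / (2 * |lam|)))) |>.mul_left
          (‖(coherent hκ (0 : Euc n)).toLp 2 volume‖ ^ 2)
      rw [← Real.exp_eq_exp_ℝ, ← Real.exp_add, neg_add_cancel, Real.exp_zero, mul_one] at h1
      simpa only [φ, norm_coherent, one_mul] using h1
    have h2 : ‖hermiteCalculus n lam (fun _ => 1) hm φ‖ ≤ 1 * ‖φ‖ :=
      (summable_spectral n lam (fun _ => 1) 1 (fun _ => by simp) φ).2
    have h3 := norm_sub_sq (𝕜 := ℂ) φ (hermiteCalculus n lam (fun _ => 1) hm φ)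
    rw [h1] at h3
    have h4 : ‖φ - hermiteCalculus n lam (fun _ => 1) hm φ‖ ^ 2 ≤ 0 := by
      rw [h3]
      nlinarith [norm_nonneg (hermiteCalculus n lam (fun _ => 1) hm φ), norm_nonneg φ]
    have h5 : ‖φ - hermiteCalculus n lam (fun _ => 1) hm φ‖ = 0 :=
      pow_eq_zero_iff two_ne_zero |>.1 (le_antisymm h4 (sq_nonneg _))
    rw [norm_eq_zero, sub_eq_zero] at h5
    exact h5.symm
  have h := hasSum_hermiteCalculus n lam (fun _ => 1) hm φ
  rw [hQ] at h
  simpa using h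

/-! ### Coordinates on the Heisenberg group -/

/-- The point `(x + i y, t)` of the Heisenberg group with real coordinates `q = (y, x, t)`. -/
def Heis.ofCoord {n : ℕ} (q : Euc n × Euc n × ℝ) : Heis n :=
  (fun j => ⟨q.2.1 j, q.1 j⟩, q.2.2)

@[simp] theorem Heis.im_ofCoord {n : ℕ} (q : Euc n × Euc n × ℝ) : (Heis.ofCoord q).im = q.1 := rfl

@[simp] theorem Heis.re_ofCoord {n : ℕ} (q : Euc n × Euc n × ℝ) : (Heis.ofCoord q).re = q.2.1 := rfl

@[simp] theorem Heis.snd_ofCoord {n : ℕ} (q : Euc n × Euc n × ℝ) : (Heis.ofCoord q).2 = q.2.2 := rfl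

theorem Heis.ofCoord_eta {n : ℕ} (p : Heis n) : Heis.ofCoord (p.im, p.re, p.2) = p := rfl

theorem Heis.continuous_ofCoord {n : ℕ} : Continuous (Heis.ofCoord : Euc n × Euc n × ℝ → Heis n) := by
  have h : (Heis.ofCoord : Euc n × Euc n × ℝ → Heis n) = fun q =>
      (fun j => Complex.equivRealProdCLM.symm (q.2.1 j, q.1 j), q.2.2) := by
    funext q
    rfl
  rw [h]
  fun_prop

theorem Heis.measurePreserving_ofCoord {n : ℕ} :
    MeasurePreserving (Heis.ofCoord : Euc n × Euc n × ℝ → Heis n) volume volume := by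
  have h1 : MeasurePreserving (fun q : Euc n × Euc n => ((q.2 : Fin n → ℝ), (q.1 : Fin n → ℝ)))
      volume volume :=
    ((PiLp.volume_preserving_ofLp (Fin n)).prod (PiLp.volume_preserving_ofLp (Fin n))).comp
      Measure.measurePreserving_swap
  have h2 : MeasurePreserving
      (fun q : (Fin n → ℝ) × (Fin n → ℝ) => fun j => ((q.1 j, q.2 j) : ℝ × ℝ)) volume volume :=
    (volume_measurePreserving_arrowProdEquivProdArrow ℝ ℝ (Fin n)).symm
  have h3 : MeasurePreserving
      (fun v : Fin n → ℝ × ℝ => fun j => Complex.measurableEquivRealProd.symm (v j))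
      volume volume :=
    volume_preserving_pi fun _ => Complex.volume_preserving_equiv_real_prod.symm
  have h4 := ((h3.comp (h2.comp h1)).prod (MeasurePreserving.id (volume : Measure ℝ))).comp
    (MeasurePreserving.symm MeasurableEquiv.prodAssoc volume_preserving_prodAssoc)
  exact h4

theorem Heis.integral_eq_integral_ofCoord {n : ℕ} {F : Heis n → ℂ} (hF : Continuous F) :
    ∫ p, F p = ∫ q : Euc n × Euc n × ℝ, F (Heis.ofCoord q) := by
  rw [← Heis.measurePreserving_ofCoord.map_eq,
    integral_map Heis.continuous_ofCoord.aemeasurable hF.aestronglyMeasurable]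

theorem Heis.hasCompactSupport_comp_ofCoord {n : ℕ} {F : Heis n → ℂ} (hF : HasCompactSupport F) :
    HasCompactSupport fun q : Euc n × Euc n × ℝ => F (Heis.ofCoord q) := by
  refine HasCompactSupport.intro (K := (fun p : Heis n => (p.im, p.re, p.2)) '' tsupport F)
    (hF.isCompact.image ?_) fun q hq => ?_
  · exact Heis.continuous_im.prodMk (Heis.continuous_re.prodMk continuous_snd)
  · by_contra h
    exact hq ⟨Heis.ofCoord q, subset_tsupport _ h, rfl⟩

theorem continuous_integral_fiber {A B : Type*} [TopologicalSpace A] [TopologicalSpace B]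
    [T2Space B] [MeasurableSpace B] [OpensMeasurableSpace B] {μ : Measure B}
    [IsFiniteMeasureOnCompacts μ] {G : A × B → ℂ} (hG : Continuous G) (hs : HasCompactSupport G) :
    Continuous fun a => ∫ b, G (a, b) ∂μ := by
  have hk : IsCompact (Prod.snd '' tsupport G) := hs.isCompact.image continuous_snd
  rw [← continuousOn_univ]
  refine continuousOn_integral_of_compact_support (f := fun a b => G (a, b)) hk
    hG.continuousOn fun a b _ hb => ?_
  by_contra h
  exact hb ⟨(a, b), subset_tsupport _ h, rfl⟩

theorem hasCompactSupport_fiber {A B : Type*} [TopologicalSpace A] [TopologicalSpace B]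
    [R1Space B] {G : A × B → ℂ} (hs : HasCompactSupport G) (a : A) :
    HasCompactSupport fun b => G (a, b) := by
  refine HasCompactSupport.intro (hs.isCompact.image continuous_snd) fun b hb => ?_
  by_contra h
  exact hb ⟨(a, b), subset_tsupport _ h, rfl⟩

theorem hasCompactSupport_integral_fiber {A B : Type*} [TopologicalSpace A] [TopologicalSpace B]
    [R1Space A] [MeasurableSpace B] {μ : Measure B} {G : A × B → ℂ} (hs : HasCompactSupport G) :
    HasCompactSupport fun a => ∫ b, G (a, b) ∂μ := by
  refine HasCompactSupport.intro (hs.isCompact.image continuous_fst) fun a ha => ?_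
  have h : (fun b => G (a, b)) = 0 := by
    funext b
    by_contra h
    exact ha ⟨(a, b), subset_tsupport _ h, rfl⟩
  change ∫ b, (fun b => G (a, b)) b ∂μ = 0
  rw [h]
  exact integral_zero _ _

/-! ### The group Fourier transform as an integral operator -/

theorem integrable_heisFourier_kernel {n : ℕ} {f : Heis n → ℂ} (hf : Integrable f) (lam : ℝ)
    (ψ φ : L2 n) : Integrable (fun q : Heis n × Euc n => (starRingEnd ℂ) (ψ q.2) *
      (f q.1 * (schrodingerPhase lam q.1 q.2 * φ (q.2 + q.1.im)))) (volume.prod volume) := by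
  have hms : AEStronglyMeasurable (fun q : Heis n × Euc n => (starRingEnd ℂ) (ψ q.2) *
      (f q.1 * (schrodingerPhase lam q.1 q.2 * φ (q.2 + q.1.im)))) (volume.prod volume) := by
    have h1 : Measurable fun q : Heis n × Euc n => q.2 + q.1.im :=
      (continuous_snd.add (Heis.continuous_im.comp continuous_fst)).measurable
    have h2 : StronglyMeasurable fun q : Heis n × Euc n => φ (q.2 + q.1.im) :=
      (Lp.stronglyMeasurable φ).comp_measurable h1
    have h3 : StronglyMeasurable fun q : Heis n × Euc n => (starRingEnd ℂ) (ψ q.2) :=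
      Complex.continuous_conj.comp_stronglyMeasurable
        ((Lp.stronglyMeasurable ψ).comp_measurable measurable_snd)
    exact h3.aestronglyMeasurable.mul (hf.aestronglyMeasurable.comp_fst.mul
      ((continuous_schrodingerPhase lam).aestronglyMeasurable.mul h2.aestronglyMeasurable))
  have hint : ∀ p : Heis n, Integrable (fun ξ => ‖ψ ξ‖ * ‖φ (ξ + p.im)‖) := fun p =>
    (Lp.memLp ψ).norm.integrable_mul (memLp_translate p.im φ).norm
  rw [integrable_prod_iff hms]
  refine ⟨Eventually.of_forall fun p => ?_, ?_⟩
  · refine ((hint p).const_mul ‖f p‖).mono' ?_ (Eventually.of_forall fun ξ => ?_)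
    · have hc : Continuous fun ξ => schrodingerPhase lam p ξ :=
        (continuous_schrodingerPhase lam).comp (by fun_prop : Continuous fun ξ => (p, ξ))
      exact (Complex.continuous_conj.comp_aestronglyMeasurable (Lp.aestronglyMeasurable ψ)).mul
        ((hc.aestronglyMeasurable.mul (memLp_translate p.im φ).1).const_mul (f p))
    · rw [norm_mul, norm_mul, norm_mul, norm_schrodingerPhase, RCLike.norm_conj]
      exact le_of_eq (by ring)
  · refine (hf.norm.mul_const (‖ψ‖ * ‖φ‖)).mono' hms.norm.integral_prod_right'
      (Eventually.of_forall fun p => ?_)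
    have h1 : ∀ ξ, ‖(starRingEnd ℂ) (ψ ξ) * (f p * (schrodingerPhase lam p ξ * φ (ξ + p.im)))‖ =
        ‖f p‖ * (‖ψ ξ‖ * ‖φ (ξ + p.im)‖) := fun ξ => by
      rw [norm_mul, norm_mul, norm_mul, norm_schrodingerPhase, RCLike.norm_conj]
      ring
    simp only [h1]
    rw [integral_const_mul, Real.norm_of_nonneg (by positivity)]
    gcongr
    have h2 := integral_mul_le_Lp_mul_Lq_of_nonneg (μ := (volume : Measure (Euc n)))
      (Real.HolderConjugate.two_two) (f := fun ξ => ‖ψ ξ‖) (g := fun ξ => ‖φ (ξ + p.im)‖)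
      (Eventually.of_forall fun _ => norm_nonneg _) (Eventually.of_forall fun _ => norm_nonneg _)
      (by simpa using (Lp.memLp ψ).norm) (by simpa using (memLp_translate p.im φ).norm)
    refine h2.trans (le_of_eq ?_)
    have h3 : ‖φ‖ = ‖schrodinger lam p φ‖ := ((schrodinger lam p).norm_map φ).symm
    have h4 : ∀ g : L2 n, (∫ ξ, ‖g ξ‖ ^ (2 : ℝ)) ^ (1 / (2 : ℝ)) = ‖g‖ := fun g => by
      rw [Lp.norm_def, (Lp.memLp g).eLpNorm_eq_integral_rpow_norm (by simp) (by simp),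
        ENNReal.toReal_ofReal (by positivity)]
      simp
    rw [h4]
    congr 1
    rw [h3, ← h4]
    congr 1
    refine integral_congr_ae ?_
    filter_upwards [coeFn_schrodinger lam p φ] with ξ h5
    rw [h5, norm_mul, norm_schrodingerPhase, one_mul]

/-- The weak form of `f̂(λ) φ (ξ) = ∫ f(p) phase(p, ξ) φ(ξ + Im p) dp`. -/
theorem inner_heisFourier {n : ℕ} {f : Heis n → ℂ} (hf : Integrable f) (lam : ℝ) (ψ φ : L2 n) :
    ⟪ψ, heisFourier f hf lam φ⟫_ℂ = ∫ ξ, (starRingEnd ℂ) (ψ ξ) *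
      ∫ p : Heis n, f p * (schrodingerPhase lam p ξ * φ (ξ + p.im)) := by
  have hint : Integrable fun p => f p • schrodinger lam p φ :=
    (hf.norm.mul_const ‖φ‖).mono'
      (hf.aestronglyMeasurable.smul (continuous_schrodinger lam φ).aestronglyMeasurable)
      (Eventually.of_forall fun p => by rw [norm_smul, LinearIsometry.norm_map])
  have h1 : ⟪ψ, heisFourier f hf lam φ⟫_ℂ = ∫ p, ⟪ψ, f p • schrodinger lam p φ⟫_ℂ := by
    rw [heisFourier_apply]
    exact (ContinuousLinearMap.integral_comp_comm (innerSL ℂ ψ) hint).symm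
  have h2 : ∀ p : Heis n, ⟪ψ, f p • schrodinger lam p φ⟫_ℂ = ∫ ξ, (starRingEnd ℂ) (ψ ξ) *
      (f p * (schrodingerPhase lam p ξ * φ (ξ + p.im))) := fun p => by
    rw [inner_smul_right, L2.inner_def, ← integral_const_mul]
    refine integral_congr_ae ?_
    filter_upwards [coeFn_schrodinger lam p φ] with ξ h
    rw [h, RCLike.inner_apply]
    ring
  rw [h1]
  simp only [h2]
  rw [integral_integral_swap (integrable_heisFourier_kernel hf lam ψ φ)]
  refine integral_congr_ae (Eventually.of_forall fun ξ => ?_)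
  exact integral_const_mul _ _

theorem coeFn_heisFourier {n : ℕ} {f : Heis n → ℂ} (hf : Integrable f) (lam : ℝ) (φ : L2 n) :
    heisFourier f hf lam φ =ᵐ[volume]
      fun ξ => ∫ p : Heis n, f p * (schrodingerPhase lam p ξ * φ (ξ + p.im)) := by
  refine ae_eq_of_forall_setIntegral_eq_of_sigmaFinite (fun s hs hμ => ?_) (fun s hs hμ => ?_)
    fun s hs hμ => ?_
  · have : IsFiniteMeasure (volume.restrict s) := ⟨by simpa using hμ⟩
    exact ((Lp.memLp _).restrict s).integrable (by simp)
  · have h := (integrable_heisFourier_kernel hf lam (indicatorConstLp 2 hs hμ.ne (1 : ℂ))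
      φ).integral_prod_right
    simp only [integral_const_mul] at h
    rw [← integrable_indicator_iff hs]
    refine h.congr ?_
    filter_upwards [indicatorConstLp_coeFn (p := 2) (hs := hs) (hμs := hμ.ne) (c := (1 : ℂ))]
      with ξ h1
    rw [h1]
    by_cases hξ : ξ ∈ s <;> simp [hξ]
  · have h := inner_heisFourier hf lam (indicatorConstLp 2 hs hμ.ne (1 : ℂ)) φ
    rw [L2.inner_indicatorConstLp_one] at h
    rw [h, ← integral_indicator hs]
    refine integral_congr_ae ?_
    filter_upwards [indicatorConstLp_coeFn (p := 2) (hs := hs) (hμs := hμ.ne) (c := (1 : ℂ))]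
      with ξ h1
    rw [h1]
    by_cases hξ : ξ ∈ s <;> simp [hξ]

theorem continuous_heisFourier_kernel {n : ℕ} {f : Heis n → ℂ} (hc : Continuous f)
    (hs : HasCompactSupport f) (lam : ℝ) {φ : Euc n → ℂ} (hφ : Continuous φ) :
    Continuous fun ξ : Euc n => ∫ p : Heis n, f p * (schrodingerPhase lam p ξ * φ (ξ + p.im)) := by
  rw [← continuousOn_univ]
  refine continuousOn_integral_of_compact_support
    (μ := (volume : Measure (Heis n)))
    (f := fun ξ (p : Heis n) => f p * (schrodingerPhase lam p ξ * φ (ξ + p.im))) hs.isCompact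
    ?_ fun ξ p _ hp => ?_
  · have h1 : Continuous fun q : Euc n × Heis n => schrodingerPhase lam q.2 q.1 :=
      (continuous_schrodingerPhase lam).comp continuous_swap
    have h2 := Heis.continuous_im (n := n)
    have h3 : Continuous fun q : Euc n × Heis n =>
        f q.2 * (schrodingerPhase lam q.2 q.1 * φ (q.1 + q.2.im)) := by fun_prop
    exact h3.continuousOn
  · rw [image_eq_zero_of_notMem_tsupport hp, zero_mul]

theorem Heis.quasiMeasurePreserving_im {n : ℕ} :
    Measure.QuasiMeasurePreserving (Heis.im : Heis n → Euc n) volume volume := by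
  refine ⟨Heis.continuous_im.measurable, ?_⟩
  rw [← Heis.measurePreserving_ofCoord.map_eq, Measure.map_map Heis.continuous_im.measurable
    Heis.continuous_ofCoord.measurable]
  exact (Measure.quasiMeasurePreserving_fst
    (μ := (volume : Measure (Euc n))) (ν := (volume : Measure (Euc n × ℝ)))).absolutelyContinuous

theorem integral_heisFourier_kernel_congr {n : ℕ} (f : Heis n → ℂ) (lam : ℝ) {φ g : Euc n → ℂ}
    (h : φ =ᵐ[volume] g) (ξ : Euc n) :
    ∫ p : Heis n, f p * (schrodingerPhase lam p ξ * φ (ξ + p.im)) =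
      ∫ p : Heis n, f p * (schrodingerPhase lam p ξ * g (ξ + p.im)) := by
  have hq : Measure.QuasiMeasurePreserving (fun p : Heis n => ξ + p.im) volume volume :=
    (measurePreserving_add_left volume ξ).quasiMeasurePreserving.comp
      Heis.quasiMeasurePreserving_im
  refine integral_congr_ae ?_
  filter_upwards [hq.ae_eq h] with p hp
  simp only [Function.comp_apply] at hp
  rw [hp]

/-- Iterated integration over `y` and `(x, t)`. -/
theorem Heis.integral_eq_integral_integral {n : ℕ} {F : Heis n → ℂ} (hF : Continuous F)
    (hs : HasCompactSupport F) :
    ∫ p, F p = ∫ y : Euc n, ∫ v : Euc n × ℝ, F (Heis.ofCoord (y, v)) := by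
  rw [Heis.integral_eq_integral_ofCoord hF]
  exact integral_prod _ ((hF.comp Heis.continuous_ofCoord).integrable_of_hasCompactSupport
    (Heis.hasCompactSupport_comp_ofCoord hs))

theorem heisFourier_kernel_coherent_eq_zero {n : ℕ} {f : Heis n → ℂ} (hc : Continuous f)
    (hs : HasCompactSupport f) {lam : ℝ}
    (h : heisFourier f (hc.integrable_of_hasCompactSupport hs) lam = 0) {κ : ℝ} (hκ : 0 < κ)
    (w ξ : Euc n) :
    ∫ p : Heis n, f p * (schrodingerPhase lam p ξ * coherent hκ w (ξ + p.im)) = 0 := by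
  have hf : Integrable f := hc.integrable_of_hasCompactSupport hs
  have hae := coeFn_heisFourier hf lam ((coherent hκ w).toLp 2 volume)
  rw [h] at hae
  have h2 : (fun ξ => ∫ p : Heis n, f p * (schrodingerPhase lam p ξ * coherent hκ w (ξ + p.im)))
      =ᵐ[volume] fun _ => 0 := by
    have h0 := Lp.coeFn_zero ℂ 2 (volume : Measure (Euc n))
    filter_upwards [hae, h0] with η h3 h4
    rw [_root_.zero_apply, h4, integral_heisFourier_kernel_congr f lam
      ((coherent hκ w).coeFn_toLp 2 volume)] at h3
    exact h3.symm
  exact congrFun (((continuous_heisFourier_kernel hc hs lam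
    (coherent hκ w).continuous).ae_eq_iff_eq volume continuous_const).1 h2) ξ

/-- If `f̂(λ) = 0`, then the integral kernel of `f̂(λ)` vanishes: its value at `(ξ, ξ + y)` is the
integral over the fibre of `y`. -/
theorem heisFourier_fiber_eq_zero {n : ℕ} {f : Heis n → ℂ} (hc : Continuous f)
    (hs : HasCompactSupport f) {lam : ℝ}
    (h : heisFourier f (hc.integrable_of_hasCompactSupport hs) lam = 0) (ξ y : Euc n) :
    ∫ v : Euc n × ℝ, f (Heis.ofCoord (y, v)) *
      schrodingerPhase lam (Heis.ofCoord (y, v)) ξ = 0 := by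
  have hκ : (0 : ℝ) < 1 := one_pos
  have hph : Continuous fun p : Heis n => schrodingerPhase lam p ξ :=
    (continuous_schrodingerPhase lam).comp (by fun_prop : Continuous fun p => (p, ξ))
  have h1 := heisFourier_kernel_coherent_eq_zero hc hs h hκ
  let g : Heis n → ℂ := fun p => f p * schrodingerPhase lam p ξ
  have hgc : Continuous g := hc.mul hph
  have hgs : HasCompactSupport g := hs.mul_right
  let A : Euc n → ℂ := fun y => ∫ v : Euc n × ℝ, g (Heis.ofCoord (y, v))
  have hA : Continuous A := continuous_integral_fiber
    (hgc.comp Heis.continuous_ofCoord) (Heis.hasCompactSupport_comp_ofCoord hgs)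
  have hAs : HasCompactSupport A := hasCompactSupport_integral_fiber
    (Heis.hasCompactSupport_comp_ofCoord hgs)
  have hcoh : Continuous (coherent hκ (0 : Euc n)) := (coherent hκ (0 : Euc n)).continuous
  have hkc : Continuous fun y => A y * coherent hκ (0 : Euc n) (ξ + y) := by fun_prop
  have hk0 : (fun y => A y * coherent hκ (0 : Euc n) (ξ + y)) = 0 := by
    refine eq_zero_of_fourier_ae_eq_zero (hkc.integrable_of_hasCompactSupport hAs.mul_right) hkc
      (Eventually.of_forall fun w => ?_)
    have h2 : ∫ p : Heis n, g p * coherent hκ w (ξ + p.im) = 0 := by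
      rw [← h1 w ξ]
      simp only [g, mul_assoc]
    have hcw : Continuous fun p : Heis n => g p * coherent hκ w (ξ + p.im) :=
      hgc.mul ((coherent hκ w).continuous.comp (continuous_const.add Heis.continuous_im))
    rw [Heis.integral_eq_integral_integral hcw hgs.mul_right] at h2
    have h3 : ∀ y : Euc n, A y * coherent hκ (0 : Euc n) (ξ + y) *
          Complex.exp (Complex.I * ((⟪w, y⟫_ℝ : ℝ) : ℂ)) =
        Complex.exp (-(Complex.I * ((⟪w, ξ⟫_ℝ : ℝ) : ℂ))) *
          ∫ v : Euc n × ℝ, g (Heis.ofCoord (y, v)) *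
            coherent hκ w (ξ + (Heis.ofCoord (y, v)).im) := by
      intro y
      have h5 : ∫ v : Euc n × ℝ, g (Heis.ofCoord (y, v)) *
          coherent hκ w (ξ + (Heis.ofCoord (y, v)).im) = A y * coherent hκ w (ξ + y) := by
        simp only [Heis.im_ofCoord]
        exact integral_mul_const _ _
      rw [h5, coherent_apply hκ 0, coherent_apply hκ w, inner_add_right w, inner_zero_left,
        Complex.ofReal_add, mul_add, Complex.exp_add, Complex.exp_neg, Complex.ofReal_zero,
        mul_zero, Complex.exp_zero]
      have h4 := Complex.exp_ne_zero (Complex.I * ((⟪w, ξ⟫_ℝ : ℝ) : ℂ))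
      field_simp
    simp only [h3]
    rw [integral_const_mul, h2, mul_zero]
  have h5 := congrFun hk0 y
  refine (mul_eq_zero.1 h5).resolve_right ?_
  rw [coherent_apply]
  exact mul_ne_zero (Complex.exp_ne_zero _) (Complex.exp_ne_zero _)

/-- The group Fourier transform on `C_c(ℍⁿ)` is injective: the vanishing of the kernel of `f̂(λ)`
says that the Fourier transform of `f(x + i y, t)` in `(x, t)` vanishes. -/
theorem eq_zero_of_heisFourier_eq_zero {n : ℕ} {f : Heis n → ℂ} (hc : Continuous f)
    (hs : HasCompactSupport f)
    (h : ∀ lam : ℝ, lam ≠ 0 → heisFourier f (hc.integrable_of_hasCompactSupport hs) lam = 0) :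
    f = 0 := by
  have hfib : ∀ y : Euc n, HasCompactSupport fun v : Euc n × ℝ => f (Heis.ofCoord (y, v)) :=
    fun y => hasCompactSupport_fiber (Heis.hasCompactSupport_comp_ofCoord hs) y
  have key : ∀ y x : Euc n, ∀ lam : ℝ, lam ≠ 0 →
      ∫ t : ℝ, f (Heis.ofCoord (y, x, t)) * Complex.exp (Complex.I * ((lam * t : ℝ) : ℂ)) = 0 := by
    intro y x lam hlam
    let G : Euc n × ℝ → ℂ := fun v =>
      f (Heis.ofCoord (y, v)) * Complex.exp (Complex.I * ((lam * v.2 : ℝ) : ℂ))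
    have hGc : Continuous G := by
      have := Heis.continuous_ofCoord (n := n)
      fun_prop
    have hGs : HasCompactSupport G := (hfib y).mul_right
    have hB := continuous_integral_fiber (μ := (volume : Measure ℝ)) hGc hGs
    have hBs := hasCompactSupport_integral_fiber (μ := (volume : Measure ℝ)) hGs
    refine congrFun (eq_zero_of_fourier_ae_eq_zero (hB.integrable_of_hasCompactSupport hBs) hB
      (Eventually.of_forall fun w => ?_)) x
    -- at `ξ = w / λ - y / 2` the phase is `exp (i λ t) exp (i x · w)`
    have h1 := heisFourier_fiber_eq_zero hc hs (h lam hlam)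
      (lam⁻¹ • w - (1 / 2 : ℝ) • y) y
    have h2 : ∀ v : Euc n × ℝ, f (Heis.ofCoord (y, v)) * schrodingerPhase lam
        (Heis.ofCoord (y, v)) (lam⁻¹ • w - (1 / 2 : ℝ) • y) =
        G v * Complex.exp (Complex.I * ((⟪w, v.1⟫_ℝ : ℝ) : ℂ)) := by
      intro v
      have h3 : lam * (⟪v.1, lam⁻¹ • w - (1 / 2 : ℝ) • y⟫_ℝ + 1 / 2 * ⟪v.1, y⟫_ℝ) =
          ⟪w, v.1⟫_ℝ := by
        rw [inner_sub_right, inner_smul_right, inner_smul_right, real_inner_comm]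
        field_simp
        ring
      simp only [schrodingerPhase, Heis.re_ofCoord, Heis.im_ofCoord, Heis.snd_ofCoord, h3, G,
        mul_assoc]
    simp only [h2] at h1
    have hi : Integrable (fun v : Euc n × ℝ =>
        G v * Complex.exp (Complex.I * ((⟪w, v.1⟫_ℝ : ℝ) : ℂ))) :=
      Continuous.integrable_of_hasCompactSupport (by fun_prop) hGs.mul_right
    rw [Measure.volume_eq_prod, integral_prod _ hi] at h1
    simpa only [integral_mul_const] using h1
  funext p
  have hcont : Continuous fun t : ℝ => f (Heis.ofCoord (p.im, p.re, t)) := by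
    have := Heis.continuous_ofCoord (n := n)
    fun_prop
  have h0 : (fun t : ℝ => f (Heis.ofCoord (p.im, p.re, t))) = 0 := by
    refine eq_zero_of_fourier_ae_eq_zero
      (hcont.integrable_of_hasCompactSupport (hasCompactSupport_fiber (hfib p.im) p.re)) hcont ?_
    filter_upwards [compl_mem_ae_iff.2 (measure_singleton (0 : ℝ))] with lam hlam
    have := key p.im p.re lam hlam
    simpa [mul_comm] using this
  exact congrFun h0 p.2

/-! ### Decay of the matrix coefficients along coherent states -/

theorem hasSum_pow_div_factorial (x : ℝ) :
    HasSum (fun j : ℕ => x ^ j / j.factorial) (Real.exp x) := by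
  rw [Real.exp_eq_exp_ℝ]
  exact NormedSpace.expSeries_div_hasSum_exp x

/-- A Poisson average of a sequence bounded by `1`, and by `b` on `[X / 4, 8 X]`, is at most
`b` up to an exponentially small error, by the Chernoff bounds for the two tails. -/
theorem poisson_average_le {X b S : ℝ} (hX : 0 ≤ X) (hb : 0 ≤ b) {u : ℕ → ℝ}
    (hu1 : ∀ j, u j ≤ 1) (hub : ∀ j : ℕ, X / 4 ≤ j → j ≤ 8 * X → u j ≤ b)
    (hS : HasSum (fun j : ℕ => u j * (Real.exp (-X) * (X ^ j / j.factorial))) S) :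
    S ≤ b + 2 * Real.exp (-(X / 4)) := by
  have h1 := ((hasSum_pow_div_factorial X).mul_left (Real.exp (-X))).mul_left b
  rw [← Real.exp_add, neg_add_cancel, Real.exp_zero, mul_one] at h1
  have h2 := (hasSum_pow_div_factorial (X * Real.exp (-1))).mul_left (Real.exp (X / 4 - X))
  have h3 := (hasSum_pow_div_factorial (X * Real.exp 1)).mul_left (Real.exp (-(8 * X) - X))
  have h4 := hasSum_le (fun j : ℕ => ?_) hS ((h1.add h2).add h3)
  · refine h4.trans ?_
    rw [← Real.exp_add, ← Real.exp_add, add_assoc, two_mul]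
    have he1 : Real.exp (-1) ≤ 1 / 2 := by
      rw [Real.exp_neg, one_div]
      exact inv_anti₀ two_pos (by linarith [Real.add_one_le_exp (1 : ℝ)])
    have he2 : Real.exp 1 ≤ 3 := by linarith [Real.exp_one_lt_d9]
    gcongr
    · nlinarith
    · nlinarith
  · have hp : 0 ≤ X ^ j / (j.factorial : ℝ) := by positivity
    have hA : Real.exp (X / 4 - X) * ((X * Real.exp (-1)) ^ j / j.factorial) =
        Real.exp (X / 4 - j) * (Real.exp (-X) * (X ^ j / j.factorial)) := by
      rw [mul_pow, ← Real.exp_nat_mul, sub_eq_add_neg, sub_eq_add_neg, Real.exp_add,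
        Real.exp_add (X / 4) (-j)]
      simp only [mul_neg, mul_one]
      ring
    have hB : Real.exp (-(8 * X) - X) * ((X * Real.exp 1) ^ j / j.factorial) =
        Real.exp (j - 8 * X) * (Real.exp (-X) * (X ^ j / j.factorial)) := by
      rw [mul_pow, ← Real.exp_nat_mul, sub_eq_add_neg, sub_eq_add_neg, Real.exp_add,
        Real.exp_add j (-(8 * X))]
      simp only [mul_one]
      ring
    rw [hA, hB, ← add_mul, ← add_mul]
    refine mul_le_mul_of_nonneg_right ?_ (by positivity)
    have q1 := Real.exp_pos (X / 4 - j)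
    have q2 := Real.exp_pos (j - 8 * X)
    by_cases hj1 : X / 4 ≤ j
    · by_cases hj2 : (j : ℝ) ≤ 8 * X
      · linarith [hub j hj1 hj2]
      · have := Real.one_le_exp (x := j - 8 * X) (by linarith)
        linarith [hu1 j]
    · have := Real.one_le_exp (x := X / 4 - j) (by linarith)
      linarith [hu1 j]

theorem inghamSymbol_le_one (Θ : ℝ≥0 → ℝ≥0) (μ : ℝ) : inghamSymbol Θ μ ≤ 1 := by
  rw [inghamSymbol, Real.exp_le_one_iff]
  have : 0 ≤ √μ * (Θ (√μ).toNNReal : ℝ) := by positivity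
  linarith

/-- Coherent states of frequency `r` have energy about `r²`, so that the symbol
`exp (-2 √μ Θ(√μ))` decays on them like `exp (-|r| Θ(3 |r|))`. -/
theorem exists_inner_inghamSymbol_coherent_le {n : ℕ} (Θ : ℝ≥0 → ℝ≥0) (hΘ : Antitone Θ)
    {lam κ : ℝ} (hκ : 0 < κ) (hl : κ ^ 2 = lam ^ 2) {e : Euc n} (he : ‖e‖ = 1) :
    ∃ C : ℝ, 0 < C ∧ ∀ r : ℝ, RCLike.re ⟪(coherent hκ (r • e)).toLp 2 volume,
        hermiteCalculus n lam (inghamSymbol Θ) (inghamSymbol_bounded Θ)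
          ((coherent hκ (r • e)).toLp 2 volume)⟫_ℂ ≤
      C * Real.exp (-(|r| * Θ (3 * |r|).toNNReal)) := by
  set N := ‖(coherent hκ (0 : Euc n)).toLp 2 volume‖ ^ 2 with hN
  have hN0 : 0 < N := by
    have := norm_coherent_zero_pos (n := n) hκ
    positivity
  set q0 : ℝ := ((Θ 0 : ℝ≥0) : ℝ) with hq0
  have hq0' : 0 ≤ q0 := by positivity
  -- for `|r| ≥ r0` the ground state energy `n κ` is at most `r²` and the tail `exp (-X / 4)` of the
  -- Poisson distribution is at most `exp (-|r| Θ(3 |r|))`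
  set r0 : ℝ := max (√(n * κ)) (8 * κ * q0) with hr0
  have hr00 : 0 ≤ r0 := (Real.sqrt_nonneg _).trans (le_max_left _ _)
  refine ⟨N * (3 * Real.exp (r0 * q0)), by positivity, fun r => ?_⟩
  set X : ℝ := r ^ 2 / (2 * κ) with hX
  have hX0 : 0 ≤ X := by positivity
  have hXκ : 2 * κ * X = r ^ 2 := by rw [hX]; field_simp
  set T : ℝ := ((Θ (3 * |r|).toNNReal : ℝ≥0) : ℝ) with hT
  have hT0 : 0 ≤ T := by positivity
  have hTq : T ≤ q0 := by exact_mod_cast hΘ zero_le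
  have hS := sum_mul_spectralMass_coherent hκ hl he r (inghamSymbol Θ) (inghamSymbol_bounded Θ)
  have hS' : HasSum (fun j : ℕ => inghamSymbol Θ (hermiteEigenvalue n κ j) *
      (Real.exp (-X) * (X ^ j / j.factorial)))
      (N⁻¹ * RCLike.re ⟪(coherent hκ (r • e)).toLp 2 volume,
        hermiteCalculus n lam (inghamSymbol Θ) (inghamSymbol_bounded Θ)
          ((coherent hκ (r • e)).toLp 2 volume)⟫_ℂ) := by
    have h := hS.mul_left N⁻¹
    rw [← hN, ← hX] at h
    refine h.congr_fun fun j => ?_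
    field_simp
  set S := RCLike.re ⟪(coherent hκ (r • e)).toLp 2 volume,
        hermiteCalculus n lam (inghamSymbol Θ) (inghamSymbol_bounded Θ)
          ((coherent hκ (r • e)).toLp 2 volume)⟫_ℂ with hSdef
  suffices h : N⁻¹ * S ≤ 3 * Real.exp (r0 * q0) * Real.exp (-(|r| * T)) by
    rw [inv_mul_le_iff₀ hN0] at h
    linarith
  have hone : 1 ≤ Real.exp (r0 * q0) := Real.one_le_exp (by positivity)
  rcases le_or_gt r0 |r| with hr | hr
  · have hr1 : n * κ ≤ r ^ 2 := by
      rw [← sq_abs]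
      exact (Real.sqrt_le_left (abs_nonneg r)).1 ((le_max_left _ _).trans hr)
    have hr2 : 8 * κ * q0 ≤ |r| := (le_max_right _ _).trans hr
    have h1 := poisson_average_le hX0 (Real.exp_pos (-(|r| * T))).le
      (fun j => inghamSymbol_le_one Θ _) (fun j hj1 hj2 => ?_) hS'
    · have h2 : Real.exp (-(X / 4)) ≤ Real.exp (-(|r| * T)) := by
        rw [Real.exp_le_exp, neg_le_neg_iff]
        have h3 : 8 * κ * (X / 4) = |r| * |r| := by
          rw [abs_mul_abs_self]
          linarith [sq r]
        have h4 : 8 * κ * (|r| * T) ≤ 8 * κ * (X / 4) := by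
          rw [h3]
          calc 8 * κ * (|r| * T) ≤ 8 * κ * (|r| * q0) := by gcongr
            _ = |r| * (8 * κ * q0) := by ring
            _ ≤ |r| * |r| := by gcongr
        exact le_of_mul_le_mul_left h4 (by positivity)
      calc N⁻¹ * S ≤ Real.exp (-(|r| * T)) + 2 * Real.exp (-(X / 4)) := h1
        _ ≤ 3 * 1 * Real.exp (-(|r| * T)) := by linarith
        _ ≤ _ := by gcongr
    · -- on the bulk of the Poisson distribution `|r| / 2 ≤ √μ ≤ 3 |r|`
      have hμ1 : |r| / 2 ≤ √(hermiteEigenvalue n κ j) := by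
        refine Real.le_sqrt_of_sq_le ?_
        rw [div_pow, sq_abs, hermiteEigenvalue, ← hXκ]
        have : (0 : ℝ) ≤ n * κ := by positivity
        nlinarith
      have hμ2 : √(hermiteEigenvalue n κ j) ≤ 3 * |r| := by
        refine Real.sqrt_le_iff.2 ⟨by positivity, ?_⟩
        rw [mul_pow, sq_abs, hermiteEigenvalue]
        nlinarith
      have hΘ2 : T ≤ Θ (√(hermiteEigenvalue n κ j)).toNNReal := by
        exact_mod_cast hΘ (Real.toNNReal_le_toNNReal hμ2)
      rw [inghamSymbol, Real.exp_le_exp]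
      have : |r| / 2 * T ≤ √(hermiteEigenvalue n κ j) * Θ (√(hermiteEigenvalue n κ j)).toNNReal := by
        gcongr
      linarith
  · have h1 := poisson_average_le hX0 zero_le_one
      (fun j => inghamSymbol_le_one Θ _) (fun j _ _ => inghamSymbol_le_one Θ _) hS'
    have h2 : Real.exp (-(X / 4)) ≤ 1 := Real.exp_le_one_iff.2 (by linarith)
    rw [mul_assoc, ← Real.exp_add]
    have h3 : 1 ≤ Real.exp (r0 * q0 + -(|r| * T)) := by
      refine Real.one_le_exp ?_
      have : |r| * T ≤ r0 * q0 := by gcongr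
      linarith
    linarith

/-! ### Fourier integrals with compact support are of exponential type -/

theorem exists_norm_le_of_hasCompactSupport {X : Type*} [TopologicalSpace X] {k : X → ℂ}
    {l : X → ℝ} (hl : Continuous l) (hs : HasCompactSupport k) :
    ∃ A : ℝ, 0 ≤ A ∧ ∀ q, k q = 0 ∨ |l q| ≤ A := by
  obtain ⟨A, hA⟩ := hs.isCompact.exists_bound_of_continuousOn (f := l) hl.continuousOn
  refine ⟨max A 0, le_max_right _ _, fun q => ?_⟩
  by_cases hq : q ∈ tsupport k
  · exact Or.inr ((hA q hq).trans (le_max_left _ _))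
  · exact Or.inl (image_eq_zero_of_notMem_tsupport hq)

theorem norm_mul_cexp_le {z : ℂ} {k : ℂ} {l A : ℝ} (h : k = 0 ∨ |l| ≤ A) :
    ‖k * Complex.exp (Complex.I * z * l)‖ ≤ ‖k‖ * Real.exp (A * |z.im|) := by
  rcases h with h | h
  · simp [h]
  · rw [norm_mul, Complex.norm_exp]
    gcongr
    have h1 : (Complex.I * z * l).re = -(l * z.im) := by simp; ring
    rw [h1]
    calc -(l * z.im) ≤ |l * z.im| := neg_le_abs _
      _ = |l| * |z.im| := abs_mul _ _
      _ ≤ A * |z.im| := by gcongr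

theorem exists_norm_integral_cexp_le {X : Type*} [TopologicalSpace X] [MeasurableSpace X]
    [OpensMeasurableSpace X] {μ : Measure X} [IsFiniteMeasureOnCompacts μ] {k : X → ℂ} {l : X → ℝ}
    (hk : Continuous k) (hl : Continuous l) (hs : HasCompactSupport k) :
    ∃ A C : ℝ, ∀ z : ℂ, ‖∫ q, k q * Complex.exp (Complex.I * z * l q) ∂μ‖ ≤
      C * Real.exp (A * |z.im|) := by
  obtain ⟨A, hA0, hA⟩ := exists_norm_le_of_hasCompactSupport hl hs
  refine ⟨A, ∫ q, ‖k q‖ ∂μ, fun z => ?_⟩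
  rw [← integral_mul_const]
  exact norm_integral_le_of_norm_le
    ((hk.integrable_of_hasCompactSupport hs).norm.mul_const _)
    (Eventually.of_forall fun q => norm_mul_cexp_le (hA q))

theorem differentiable_integral_cexp {X : Type*} [TopologicalSpace X] [MeasurableSpace X]
    [OpensMeasurableSpace X] {μ : Measure X} [IsFiniteMeasureOnCompacts μ] {k : X → ℂ} {l : X → ℝ}
    (hk : Continuous k) (hl : Continuous l) (hs : HasCompactSupport k) :
    Differentiable ℂ fun z : ℂ => ∫ q, k q * Complex.exp (Complex.I * z * l q) ∂μ := by
  intro z0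
  obtain ⟨A, hA0, hA⟩ := exists_norm_le_of_hasCompactSupport hl hs
  have hint : ∀ g : X → ℂ, Continuous g → Integrable (fun q => k q * g q) μ := fun g hg =>
    (hk.mul hg).integrable_of_hasCompactSupport hs.mul_right
  have h := hasDerivAt_integral_of_dominated_loc_of_deriv_le (μ := μ) (𝕜 := ℂ) (x₀ := z0)
    (F := fun z q => k q * Complex.exp (Complex.I * z * l q))
    (F' := fun z q => k q * (Complex.I * l q) * Complex.exp (Complex.I * z * l q))
    (s := Metric.ball z0 1) (bound := fun q => ‖k q * (Complex.I * l q)‖ *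
      Real.exp (A * (|z0.im| + 1)))
    (Metric.ball_mem_nhds z0 one_pos)
    (Eventually.of_forall fun z => (hint _ (by fun_prop)).1) (hint _ (by fun_prop)) ?_
    (Eventually.of_forall fun q z hz => ?_) ?_ (Eventually.of_forall fun q z hz => ?_)
  · exact h.2.differentiableAt
  · simp only [mul_assoc]
    exact (hint _ (by fun_prop)).1
  · have h1 : k q * (Complex.I * l q) = 0 ∨ |l q| ≤ A := (hA q).imp (fun h => by simp [h]) id
    refine (norm_mul_cexp_le h1).trans ?_
    gcongr
    have h2 : |z.im - z0.im| ≤ 1 := by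
      rw [← Complex.sub_im]
      exact (Complex.abs_im_le_norm _).trans (by simpa [dist_eq_norm] using (Metric.mem_ball.1 hz).le)
    have := abs_sub_abs_le_abs_sub z.im z0.im
    linarith
  · exact (hint _ (by fun_prop)).norm.mul_const _
  · have h1 : HasDerivAt (fun z : ℂ => Complex.exp (Complex.I * z * l q))
        (Complex.exp (Complex.I * z * l q) * (Complex.I * 1 * l q)) z :=
      (((hasDerivAt_id z).const_mul Complex.I).mul_const (l q : ℂ)).cexp
    have h2 := h1.const_mul (k q)
    have h3 : k q * (Complex.exp (Complex.I * z * l q) * (Complex.I * 1 * l q)) =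
        k q * (Complex.I * l q) * Complex.exp (Complex.I * z * l q) := by ring
    rwa [h3] at h2

/-! ### Vanishing of operators with a divergent rate of decay -/

theorem re_inner_inghamSymbol_nonneg {n : ℕ} (Θ : ℝ≥0 → ℝ≥0) (lam : ℝ) (φ : L2 n) :
    0 ≤ RCLike.re ⟪φ, hermiteCalculus n lam (inghamSymbol Θ) (inghamSymbol_bounded Θ) φ⟫_ℂ :=
  (hasSum_re_inner_hermiteCalculus n lam _ (inghamSymbol_bounded Θ) φ).nonneg fun μ =>
    mul_nonneg (Real.exp_pos _).le (spectralMass_nonneg lam φ μ)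

theorem sq_norm_le_of_adjoint_comp_le {n : ℕ} {T S : L2 n →L[ℂ] L2 n} {c : ℝ}
    (h : T.adjoint ∘L T ≤ (c : ℂ) • S) (φ : L2 n) :
    ‖T φ‖ ^ 2 ≤ c * RCLike.re ⟪φ, S φ⟫_ℂ := by
  rw [ContinuousLinearMap.le_def] at h
  have h1 := h.re_inner_nonneg_right φ
  rw [_root_.sub_apply, inner_sub_right, map_sub, _root_.smul_apply, inner_smul_right,
    ContinuousLinearMap.comp_apply, ContinuousLinearMap.adjoint_inner_right,
    inner_self_eq_norm_sq, sub_nonneg] at h1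
  refine h1.trans (le_of_eq ?_)
  simp

theorem coherent_smul_apply {n : ℕ} {κ : ℝ} (hκ : 0 < κ) (r : ℝ) (e ξ : Euc n) :
    coherent hκ (r • e) ξ =
      coherent hκ 0 ξ * Complex.exp (Complex.I * (r : ℂ) * ((⟪e, ξ⟫_ℝ : ℝ) : ℂ)) := by
  rw [coherent_apply, coherent_apply, inner_smul_left]
  simp only [inner_zero_left, Complex.ofReal_zero, mul_zero, Complex.exp_zero, one_mul]
  rw [mul_comm]
  congr 2
  simp
  ring

/-- The matrix coefficient of `f̂(λ)` between a test function and a coherent state is the Fourier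
transform of a compactly supported function of the phase space variable `⟪e, ξ + y⟫`. -/
theorem inner_heisFourier_coherent_eq {n : ℕ} {f : Heis n → ℂ} (hc : Continuous f)
    (hs : HasCompactSupport f) (lam : ℝ) {κ : ℝ} (hκ : 0 < κ) (e : Euc n) {ψ : Euc n → ℝ}
    (hψ : Continuous ψ) (hψs : HasCompactSupport ψ) (r : ℝ) :
    ∫ ξ, ψ ξ • heisFourier f (hc.integrable_of_hasCompactSupport hs) lam
        ((coherent hκ (r • e)).toLp 2 volume) ξ =
      ∫ q : Euc n × Heis n, ((ψ q.1 : ℂ) * (f q.2 * (schrodingerPhase lam q.2 q.1 *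
        coherent hκ (0 : Euc n) (q.1 + q.2.im)))) *
          Complex.exp (Complex.I * (r : ℂ) * ((⟪e, q.1 + q.2.im⟫_ℝ : ℝ) : ℂ)) := by
  have him := Heis.continuous_im (n := n)
  have h1 : Continuous fun q : Euc n × Heis n => schrodingerPhase lam q.2 q.1 :=
    (continuous_schrodingerPhase lam).comp continuous_swap
  have h2 : Continuous (coherent hκ (r • e)) := (coherent hκ (r • e)).continuous
  let G : Euc n × Heis n → ℂ := fun q => (ψ q.1 : ℂ) * (f q.2 * (schrodingerPhase lam q.2 q.1 *
    coherent hκ (r • e) (q.1 + q.2.im)))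
  have hG : Continuous G := by fun_prop
  have hGs : HasCompactSupport G := by
    refine HasCompactSupport.intro (hψs.isCompact.prod hs.isCompact) fun q hq' => ?_
    by_contra hne
    refine hq' ⟨subset_tsupport _ fun h => hne ?_, subset_tsupport _ fun h => hne ?_⟩
    · simp [G, h]
    · simp [G, h]
  have h3 : ∀ q : Euc n × Heis n, ((ψ q.1 : ℂ) * (f q.2 * (schrodingerPhase lam q.2 q.1 *
        coherent hκ (0 : Euc n) (q.1 + q.2.im)))) *
          Complex.exp (Complex.I * (r : ℂ) * ((⟪e, q.1 + q.2.im⟫_ℝ : ℝ) : ℂ)) = G q := fun q => by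
    simp only [G]
    rw [coherent_smul_apply]
    ring
  simp only [h3]
  have h5 : ∫ q, G q = ∫ ξ, ∫ p, G (ξ, p) :=
    integral_prod _ (hG.integrable_of_hasCompactSupport hGs)
  rw [h5]
  refine integral_congr_ae ?_
  filter_upwards [coeFn_heisFourier (hc.integrable_of_hasCompactSupport hs) lam
    ((coherent hκ (r • e)).toLp 2 volume)] with ξ h4
  rw [h4, integral_heisFourier_kernel_congr f lam ((coherent hκ (r • e)).coeFn_toLp 2 volume),
    Complex.real_smul, ← integral_const_mul]

/-- The decay condition at a single `λ` forces `f̂(λ) = 0` if `∑ Θ(2^k)` diverges. -/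
theorem heisFourier_eq_zero_of_decay {n : ℕ} (hn : 1 ≤ n) (Θ : ℝ≥0 → ℝ≥0) (hΘ : Antitone Θ)
    {f : Heis n → ℂ} (hc : Continuous f) (hs : HasCompactSupport f) {lam : ℝ} (hlam : lam ≠ 0)
    {C : ℝ} (hdec : (heisFourier f (hc.integrable_of_hasCompactSupport hs) lam).adjoint ∘L
        heisFourier f (hc.integrable_of_hasCompactSupport hs) lam ≤
      (C : ℂ) • hermiteCalculus n lam (inghamSymbol Θ) (inghamSymbol_bounded Θ))
    (hns : ¬ Summable fun k : ℕ => (Θ ((2 : ℝ) ^ k).toNNReal : ℝ)) :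
    heisFourier f (hc.integrable_of_hasCompactSupport hs) lam = 0 := by
  have hκ : 0 < |lam| := abs_pos.2 hlam
  have hl : |lam| ^ 2 = lam ^ 2 := sq_abs lam
  set T := heisFourier f (hc.integrable_of_hasCompactSupport hs) lam with hT
  refine clm_ext_of_coherent hκ fun w => ?_
  obtain ⟨e, r0, he, rfl⟩ : ∃ (e : Euc n) (r : ℝ), ‖e‖ = 1 ∧ w = r • e := by
    rcases eq_or_ne w 0 with rfl | hw
    · exact ⟨EuclideanSpace.basisFun (Fin n) ℝ ⟨0, hn⟩, 0, by simp, by simp⟩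
    · exact ⟨‖w‖⁻¹ • w, ‖w‖, norm_smul_inv_norm hw, by
        rw [smul_smul, mul_inv_cancel₀ (norm_ne_zero_iff.2 hw), one_smul]⟩
  rw [_root_.zero_apply]
  obtain ⟨C1, hC1, hbd⟩ := exists_inner_inghamSymbol_coherent_le Θ hΘ hκ hl he
  have hTbd : ∀ r : ℝ, ‖T ((coherent hκ (r • e)).toLp 2 volume)‖ ≤
      √(|C| * C1) * Real.exp (-(1 / 2 * |r| * Θ (3 * |r|).toNNReal)) := by
    intro r
    refine abs_le_of_sq_le_sq' ?_ (by positivity) |>.2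
    rw [mul_pow, Real.sq_sqrt (by positivity), ← Real.exp_nat_mul]
    calc ‖T ((coherent hκ (r • e)).toLp 2 volume)‖ ^ 2 ≤ C * _ :=
          sq_norm_le_of_adjoint_comp_le hdec _
      _ ≤ |C| * _ := mul_le_mul_of_nonneg_right (le_abs_self C)
          (re_inner_inghamSymbol_nonneg Θ lam _)
      _ ≤ |C| * _ := mul_le_mul_of_nonneg_left (hbd r) (abs_nonneg C)
      _ = _ := by
        rw [mul_assoc]
        congr 3
        push_cast
        ring
  have hq : Antitone fun x : ℝ => (Θ x.toNNReal : ℝ) := fun x y hxy => by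
    exact_mod_cast hΘ (Real.toNNReal_le_toNNReal hxy)
  refine (Lp.eq_zero_iff_ae_eq_zero).2 ?_
  refine ae_eq_zero_of_integral_contDiff_smul_eq_zero
    ((Lp.memLp _).locallyIntegrable (by norm_num)) fun ψ hψ hψs => ?_
  have hψc := hψ.continuous
  let k : Euc n × Heis n → ℂ := fun q => (ψ q.1 : ℂ) * (f q.2 * (schrodingerPhase lam q.2 q.1 *
        coherent hκ (0 : Euc n) (q.1 + q.2.im)))
  let l : Euc n × Heis n → ℝ := fun q => ⟪e, q.1 + q.2.im⟫_ℝ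
  have him := Heis.continuous_im (n := n)
  have hk : Continuous k := by
    have h1 : Continuous fun q : Euc n × Heis n => schrodingerPhase lam q.2 q.1 :=
      (continuous_schrodingerPhase lam).comp continuous_swap
    have h2 : Continuous (coherent hκ (0 : Euc n)) := (coherent hκ (0 : Euc n)).continuous
    fun_prop
  have hlc : Continuous l := by fun_prop
  have hks : HasCompactSupport k := by
    refine HasCompactSupport.intro (hψs.isCompact.prod hs.isCompact) fun q hq' => ?_
    by_contra hne
    refine hq' ⟨subset_tsupport _ fun h => hne ?_, subset_tsupport _ fun h => hne ?_⟩
    · simp [k, h]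
    · simp [k, h]
  obtain ⟨A, C0, hexp⟩ := exists_norm_integral_cexp_le (μ := (volume : Measure (Euc n × Heis n)))
    hk hlc hks
  have hdiff := differentiable_integral_cexp (μ := (volume : Measure (Euc n × Heis n))) hk hlc hks
  have hF : ∀ r : ℝ, ∫ ξ, ψ ξ • T ((coherent hκ (r • e)).toLp 2 volume) ξ =
      ∫ q, k q * Complex.exp (Complex.I * (r : ℂ) * l q) := fun r =>
    inner_heisFourier_coherent_eq hc hs lam hκ e hψc hψs r
  have hψ2 : MemLp (fun ξ => (ψ ξ : ℂ)) 2 (volume : Measure (Euc n)) :=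
    Continuous.memLp_of_hasCompactSupport (by fun_prop)
      (hψs.comp_left (g := fun x : ℝ => (x : ℂ)) Complex.ofReal_zero)
  have hFT : ∀ g : L2 n, ‖∫ ξ, ψ ξ • g ξ‖ ≤ ‖hψ2.toLp‖ * ‖g‖ := by
    intro g
    have h1 : ∫ ξ, ψ ξ • g ξ = ⟪hψ2.toLp, g⟫_ℂ := by
      rw [L2.inner_def]
      refine integral_congr_ae ?_
      filter_upwards [hψ2.coeFn_toLp] with ξ h
      rw [h, RCLike.inner_apply, Complex.conj_ofReal, Complex.real_smul, mul_comm]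
    rw [h1]
    exact norm_inner_le_norm _ _
  have hzero := eq_zero_of_decay_of_not_summable hdiff (A := A)
    (C := max C0 (‖hψ2.toLp‖ * √(|C| * C1)) + 1) (a := 3) (c := 1 / 2)
    (lt_of_le_of_lt (le_max_of_le_right (by positivity)) (lt_add_one _)) (by norm_num)
    (by norm_num) (fun z => (hexp z).trans ?_) hq (fun x => NNReal.coe_nonneg _) (fun r => ?_) hns
  · rw [hF]
    exact congrFun hzero (r0 : ℂ)
  · gcongr
    exact (le_max_left _ _).trans (le_add_of_nonneg_right zero_le_one)
  · rw [← hF]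
    refine (hFT _).trans ((mul_le_mul_of_nonneg_left (hTbd r) (norm_nonneg _)).trans ?_)
    rw [← mul_assoc]
    gcongr
    exact (le_max_right _ _).trans (le_add_of_nonneg_right zero_le_one)

/-- The decay condition for a nonzero `f` forces `∑ Θ(2^k)` to converge. -/
theorem summable_of_inghamDecay {n : ℕ} (hn : 1 ≤ n) (Θ : ℝ≥0 → ℝ≥0) (hΘ : Antitone Θ)
    {f : Heis n → ℂ} (hc : Continuous f) (hs : HasCompactSupport f) (hf : f ≠ 0)
    (h : InghamDecay Θ f (hc.integrable_of_hasCompactSupport hs)) :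
    Summable fun k : ℕ => (Θ ((2 : ℝ) ^ k).toNNReal : ℝ) := by
  by_contra hns
  obtain ⟨C, hC⟩ := h
  exact hf (eq_zero_of_heisFourier_eq_zero hc hs fun lam hlam =>
    heisFourier_eq_zero_of_decay hn Θ hΘ hc hs hlam (hC lam hlam) hns)

/-! ### The extremal function and its group Fourier transform -/

/-- The cube `{y : |y_j| ≤ R}`. -/
def cube (n : ℕ) (R : ℝ) : Set (Euc n) := {y | ∀ j, |y j| ≤ R}

theorem isCompact_cube (n : ℕ) (R : ℝ) : IsCompact (cube n R) := by
  have h : cube n R = WithLp.toLp 2 '' (Set.univ.pi fun _ : Fin n => Set.Icc (-R) R) := by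
    ext y
    constructor
    · intro hy
      exact ⟨WithLp.ofLp y, fun j _ => abs_le.1 (hy j), rfl⟩
    · rintro ⟨v, hv, rfl⟩ j
      exact abs_le.2 (hv j trivial)
  rw [h]
  exact (isCompact_univ_pi fun _ => isCompact_Icc).image (PiLp.continuous_toLp 2 _)

/-- The point `(x, 0) (i y, 0) (0, τ) = (x + i y, τ - x · y / 2)` with polarised coordinates
`q = (y, x, τ)`, in which the phase of the Schrödinger representation is `λ (τ + x · ξ)`. -/
noncomputable def Heis.ofPolar {n : ℕ} (q : Euc n × Euc n × ℝ) : Heis n :=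
  Heis.ofCoord (q.1, q.2.1, q.2.2 - 1 / 2 * ⟪q.2.1, q.1⟫_ℝ)

theorem Heis.continuous_ofPolar {n : ℕ} : Continuous (Heis.ofPolar : Euc n × Euc n × ℝ → Heis n) := by
  have := Heis.continuous_ofCoord (n := n)
  unfold Heis.ofPolar
  fun_prop

theorem Heis.measurePreserving_ofPolar {n : ℕ} :
    MeasurePreserving (Heis.ofPolar : Euc n × Euc n × ℝ → Heis n) volume volume := by
  refine Heis.measurePreserving_ofCoord.comp ?_
  refine MeasurePreserving.skew_product (f := id)
    (g := fun (y : Euc n) (v : Euc n × ℝ) => (v.1, v.2 - 1 / 2 * ⟪v.1, y⟫_ℝ))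
    (MeasurePreserving.id _) ?_ (Eventually.of_forall fun y => ?_)
  · exact Continuous.measurable (by fun_prop)
  · refine MeasurePreserving.map_eq ?_
    refine MeasurePreserving.skew_product (f := id)
      (g := fun (x : Euc n) (t : ℝ) => t - 1 / 2 * ⟪x, y⟫_ℝ) (MeasurePreserving.id _) ?_
      (Eventually.of_forall fun x => ?_)
    · exact Continuous.measurable (by fun_prop)
    · exact (measurePreserving_sub_right volume (1 / 2 * ⟪x, y⟫_ℝ)).map_eq

/-- The product function `∏ g(x_j / 18) ∏ g(y_j) g(τ / 18)` of the polarised coordinates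
`(y, x, τ)`, `τ = t + x · y / 2`. The dilation by `18` makes the Fourier transforms in `x` and `τ`
small already at the frequency `Λ / 6` if that of `g` is small at the frequency `3 Λ`. -/
noncomputable def productBump {n : ℕ} (g : ℝ → ℝ) (p : Heis n) : ℂ :=
  (((∏ j, g (p.im j)) * ((∏ j, g (p.re j / 18)) * g ((p.2 + 1 / 2 * ⟪p.re, p.im⟫_ℝ) / 18)) : ℝ) : ℂ)

theorem continuous_productBump {n : ℕ} {g : ℝ → ℝ} (hg : Continuous g) :
    Continuous (productBump g : Heis n → ℂ) := by
  have h1 := Heis.continuous_re (n := n)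
  have h2 := Heis.continuous_im (n := n)
  unfold productBump
  fun_prop

theorem Heis.exists_ofPolar_eq {n : ℕ} (p : Heis n) :
    Heis.ofPolar (p.im, p.re, p.2 + 1 / 2 * ⟪p.re, p.im⟫_ℝ) = p := by
  rw [Heis.ofPolar, add_sub_cancel_right]
  exact Heis.ofCoord_eta p

theorem hasCompactSupport_productBump {n : ℕ} {g : ℝ → ℝ} (hs : ∀ x, 3 ≤ |x| → g x = 0) :
    HasCompactSupport (productBump g : Heis n → ℂ) := by
  refine HasCompactSupport.intro (((isCompact_cube n 3).prod
    ((isCompact_cube n 54).prod (isCompact_Icc (a := (-54 : ℝ)) (b := 54)))).image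
      Heis.continuous_ofPolar) fun p hp => ?_
  by_contra hne
  have hne' : (∏ j, g (p.im j)) * ((∏ j, g (p.re j / 18)) *
      g ((p.2 + 1 / 2 * ⟪p.re, p.im⟫_ℝ) / 18)) ≠ 0 := by
    rw [productBump] at hne
    exact_mod_cast hne
  have hsup : ∀ x : ℝ, g x ≠ 0 → |x| ≤ 3 := fun x hx => by
    by_contra h
    exact hx (hs x (not_le.1 h).le)
  have hsup' : ∀ x : ℝ, g (x / 18) ≠ 0 → |x| ≤ 54 := fun x hx => by
    have h := hsup _ hx
    rw [abs_div, abs_of_pos (by norm_num : (0 : ℝ) < 18), div_le_iff₀ (by norm_num)] at h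
    linarith
  obtain ⟨h1, h2⟩ := mul_ne_zero_iff.1 hne'
  obtain ⟨h2, h3⟩ := mul_ne_zero_iff.1 h2
  exact hp ⟨_, ⟨fun j => hsup _ (Finset.prod_ne_zero_iff.1 h1 j (Finset.mem_univ j)),
    fun j => hsup' _ (Finset.prod_ne_zero_iff.1 h2 j (Finset.mem_univ j)),
    abs_le.1 (hsup' _ h3)⟩, Heis.exists_ofPolar_eq p⟩

theorem productBump_ne_zero {n : ℕ} {g : ℝ → ℝ} (hg : g 0 = 1) :
    (productBump g : Heis n → ℂ) ≠ 0 := by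
  intro h
  have h1 := congrFun h 0
  have h2 : (0 : Heis n).im = 0 := by ext j; simp [Heis.im]
  have h3 : (0 : Heis n).re = 0 := by ext j; simp [Heis.re]
  simp [productBump, h2, h3, hg] at h1

/-- The multiplier `ĥ(λ) â(λξ)` in the group Fourier transform of `productBump g`, where
`h(τ) = g(τ / 18)` and `a(x) = ∏ g(x_j / 18)`. -/
noncomputable def bumpMultiplier {n : ℕ} (g : ℝ → ℝ) (lam : ℝ) (ξ : Euc n) : ℂ :=
  (∏ j, (18 * lineFourier g (18 * (lam * ξ j)))) * (18 * lineFourier g (18 * lam))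

theorem integral_comp_div_mul_cexp (g : ℝ → ℝ) (ζ : ℝ) :
    ∫ u : ℝ, (g (u / 18) : ℂ) * Complex.exp (Complex.I * ((ζ * u : ℝ) : ℂ)) =
      18 * lineFourier g (18 * ζ) := by
  have h := Measure.integral_comp_div
    (fun u : ℝ => (g u : ℂ) * Complex.exp (Complex.I * ((18 * ζ * u : ℝ) : ℂ))) 18
  rw [lineFourier]
  rw [abs_of_pos (by norm_num : (0 : ℝ) < 18), Complex.real_smul] at h
  push_cast at h ⊢
  rw [← h]
  refine integral_congr_ae (Eventually.of_forall fun u => ?_)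
  simp only
  congr 3
  ring

theorem integral_prod_comp_div_mul_cexp {n : ℕ} (g : ℝ → ℝ) (lam : ℝ) (ξ : Euc n) :
    ∫ x : Euc n, ((∏ j, g (x j / 18) : ℝ) : ℂ) *
      Complex.exp (Complex.I * ((lam * ⟪x, ξ⟫_ℝ : ℝ) : ℂ)) =
      ∏ j, (18 * lineFourier g (18 * (lam * ξ j))) := by
  have h1 : ∀ x : Euc n, ((∏ j, g (x j / 18) : ℝ) : ℂ) *
      Complex.exp (Complex.I * ((lam * ⟪x, ξ⟫_ℝ : ℝ) : ℂ)) =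
      ∏ j, ((g (x j / 18) : ℂ) * Complex.exp (Complex.I * ((lam * ξ j * x j : ℝ) : ℂ))) := by
    intro x
    rw [Finset.prod_mul_distrib, ← Complex.exp_sum, ← Finset.mul_sum, Complex.ofReal_prod,
      ← Complex.ofReal_sum]
    congr 4
    rw [PiLp.inner_apply, Finset.mul_sum]
    refine Finset.sum_congr rfl fun j _ => ?_
    simp
    ring
  simp only [h1, ← integral_comp_div_mul_cexp]
  rw [← integral_fintype_prod_volume_eq_prod]
  exact ((PiLp.volume_preserving_ofLp (Fin n)).integral_comp
    (MeasurableEquiv.toLp 2 (Fin n → ℝ)).symm.measurableEmbedding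
    (fun v : Fin n → ℝ => ∏ j, ((g (v j / 18) : ℂ) *
      Complex.exp (Complex.I * ((lam * ξ j * v j : ℝ) : ℂ)))))

theorem integral_productBump_kernel {n : ℕ} {g : ℝ → ℝ} (hg : Continuous g) (lam : ℝ) (ξ : Euc n)
    (φ : L2 n) :
    ∫ p : Heis n, productBump g p * (schrodingerPhase lam p ξ * φ (ξ + p.im)) =
      bumpMultiplier g lam ξ * ∫ y : Euc n, ((∏ j, g (y j) : ℝ) : ℂ) * φ (ξ + y) := by
  have hm : AEStronglyMeasurable (fun p : Heis n =>
      productBump g p * (schrodingerPhase lam p ξ * φ (ξ + p.im))) volume := by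
    have h1 : StronglyMeasurable fun p : Heis n => φ (ξ + p.im) :=
      (Lp.stronglyMeasurable φ).comp_measurable
        (continuous_const.add Heis.continuous_im).measurable
    have h2 : Continuous fun p : Heis n => schrodingerPhase lam p ξ :=
      (continuous_schrodingerPhase lam).comp (by fun_prop : Continuous fun p => (p, ξ))
    exact (continuous_productBump hg).aestronglyMeasurable.mul
      (h2.aestronglyMeasurable.mul h1.aestronglyMeasurable)
  rw [← Heis.measurePreserving_ofPolar.map_eq] at hm ⊢
  rw [integral_map Heis.continuous_ofPolar.aemeasurable hm]
  have h1 : ∀ q : Euc n × Euc n × ℝ, productBump g (Heis.ofPolar q) *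
      (schrodingerPhase lam (Heis.ofPolar q) ξ * φ (ξ + (Heis.ofPolar q).im)) =
      (((∏ j, g (q.1 j) : ℝ) : ℂ) * φ (ξ + q.1)) *
        ((((∏ j, g (q.2.1 j / 18) : ℝ) : ℂ) *
          Complex.exp (Complex.I * ((lam * ⟪q.2.1, ξ⟫_ℝ : ℝ) : ℂ))) *
        ((g (q.2.2 / 18) : ℂ) * Complex.exp (Complex.I * ((lam * q.2.2 : ℝ) : ℂ)))) := by
    intro q
    rw [schrodingerPhase, ← Complex.exp_add]
    simp only [productBump, Heis.ofPolar, Heis.im_ofCoord, Heis.re_ofCoord, Heis.snd_ofCoord,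
      sub_add_cancel]
    have h2 : Complex.exp (Complex.I * ((lam * (q.2.2 - 1 / 2 * ⟪q.2.1, q.1⟫_ℝ) : ℝ) : ℂ) +
        Complex.I * ((lam * (⟪q.2.1, ξ⟫_ℝ + 1 / 2 * ⟪q.2.1, q.1⟫_ℝ) : ℝ) : ℂ)) =
        Complex.exp (Complex.I * ((lam * ⟪q.2.1, ξ⟫_ℝ : ℝ) : ℂ)) *
          Complex.exp (Complex.I * ((lam * q.2.2 : ℝ) : ℂ)) := by
      rw [← Complex.exp_add]
      congr 1
      push_cast
      ring
    rw [h2]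
    push_cast
    ring
  simp only [h1]
  have h3 := integral_prod_mul (μ := (volume : Measure (Euc n)))
    (ν := (volume : Measure (Euc n × ℝ)))
    (fun y : Euc n => ((∏ j, g (y j) : ℝ) : ℂ) * φ (ξ + y))
    (fun v : Euc n × ℝ => (((∏ j, g (v.1 j / 18) : ℝ) : ℂ) *
          Complex.exp (Complex.I * ((lam * ⟪v.1, ξ⟫_ℝ : ℝ) : ℂ))) *
        ((g (v.2 / 18) : ℂ) * Complex.exp (Complex.I * ((lam * v.2 : ℝ) : ℂ))))
  have h4 := integral_prod_mul (μ := (volume : Measure (Euc n))) (ν := (volume : Measure ℝ))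
    (fun x : Euc n => ((∏ j, g (x j / 18) : ℝ) : ℂ) *
          Complex.exp (Complex.I * ((lam * ⟪x, ξ⟫_ℝ : ℝ) : ℂ)))
    (fun t : ℝ => (g (t / 18) : ℂ) * Complex.exp (Complex.I * ((lam * t : ℝ) : ℂ)))
  rw [integral_prod_comp_div_mul_cexp, integral_comp_div_mul_cexp] at h4
  refine h3.trans ?_
  rw [mul_comm]
  exact congrArg (· * _) h4

theorem heisFourier_productBump {n : ℕ} {g : ℝ → ℝ} (hg : Continuous g)
    (hf : Integrable (productBump g : Heis n → ℂ)) (lam : ℝ) (φ : L2 n) :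
    heisFourier (productBump g) hf lam φ =ᵐ[volume]
      fun ξ => bumpMultiplier g lam ξ * ∫ y : Euc n, ((∏ j, g (y j) : ℝ) : ℂ) * φ (ξ + y) := by
  filter_upwards [coeFn_heisFourier hf lam φ] with ξ h
  rw [h, integral_productBump_kernel hg]

/-! ### Powers of the Hermite operator on localised functions -/

/-- `SobolevBound Λ R N B u` says that the iterated partial derivatives of `u` of order `k ≤ N` are
bounded by `B Λ ^ k` and vanish off `R`. -/
def SobolevBound {n : ℕ} (Λ : ℝ) (R : Set (Euc n)) : ℕ → ℝ → 𝓢(Euc n, ℂ) → Prop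
  | 0, B, u => (∀ η, ‖u η‖ ≤ B) ∧ ∀ η ∉ R, u η = 0
  | N + 1, B, u => ((∀ η, ‖u η‖ ≤ B) ∧ ∀ η ∉ R, u η = 0) ∧
      ∀ i, SobolevBound Λ R N (B * Λ) (∂_{EuclideanSpace.basisFun (Fin n) ℝ i} u)

namespace SobolevBound

variable {n : ℕ} {Λ : ℝ} {R : Set (Euc n)}

theorem bound {N : ℕ} {B : ℝ} {u : 𝓢(Euc n, ℂ)} (h : SobolevBound Λ R N B u) :
    (∀ η, ‖u η‖ ≤ B) ∧ ∀ η ∉ R, u η = 0 := by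
  cases N with
  | zero => exact h
  | succ N => exact h.1

theorem nonneg {N : ℕ} {B : ℝ} {u : 𝓢(Euc n, ℂ)} (h : SobolevBound Λ R N B u) : 0 ≤ B :=
  (norm_nonneg _).trans (h.bound.1 0)

theorem of_succ {N : ℕ} {B : ℝ} {u : 𝓢(Euc n, ℂ)} (h : SobolevBound Λ R (N + 1) B u) :
    SobolevBound Λ R N B u := by
  induction N generalizing B u with
  | zero => exact h.1
  | succ N ih => exact ⟨h.1, fun i => ih (h.2 i)⟩

theorem mono (hΛ : 0 ≤ Λ) {N : ℕ} {B B' : ℝ} {u : 𝓢(Euc n, ℂ)} (h : SobolevBound Λ R N B u)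
    (hB : B ≤ B') : SobolevBound Λ R N B' u := by
  induction N generalizing B B' u with
  | zero => exact ⟨fun η => (h.1 η).trans hB, h.2⟩
  | succ N ih =>
    exact ⟨⟨fun η => (h.1.1 η).trans hB, h.1.2⟩,
      fun i => ih (h.2 i) (mul_le_mul_of_nonneg_right hB hΛ)⟩

theorem add {N : ℕ} {B B' : ℝ} {u v : 𝓢(Euc n, ℂ)} (h : SobolevBound Λ R N B u)
    (h' : SobolevBound Λ R N B' v) : SobolevBound Λ R N (B + B') (u + v) := by
  induction N generalizing B B' u v with
  | zero =>
    exact ⟨fun η => (norm_add_le _ _).trans (add_le_add (h.1 η) (h'.1 η)),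
      fun η hη => by rw [_root_.add_apply, h.2 η hη, h'.2 η hη, add_zero]⟩
  | succ N ih =>
    refine ⟨⟨fun η => (norm_add_le _ _).trans (add_le_add (h.1.1 η) (h'.1.1 η)),
      fun η hη => by rw [_root_.add_apply, h.1.2 η hη, h'.1.2 η hη, add_zero]⟩, fun i => ?_⟩
    rw [LineDeriv.lineDerivOp_add, add_mul]
    exact ih (h.2 i) (h'.2 i)

theorem smul {N : ℕ} {B : ℝ} {u : 𝓢(Euc n, ℂ)} (h : SobolevBound Λ R N B u) (c : ℂ) :
    SobolevBound Λ R N (‖c‖ * B) (c • u) := by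
  induction N generalizing B u with
  | zero =>
    exact ⟨fun η => (norm_smul_le _ _).trans (mul_le_mul_of_nonneg_left (h.1 η) (norm_nonneg c)),
      fun η hη => by rw [_root_.smul_apply, h.2 η hη, smul_zero]⟩
  | succ N ih =>
    refine ⟨⟨fun η => (norm_smul_le _ _).trans
      (mul_le_mul_of_nonneg_left (h.1.1 η) (norm_nonneg c)),
      fun η hη => by rw [_root_.smul_apply, h.1.2 η hη, smul_zero]⟩, fun i => ?_⟩
    rw [LineDeriv.lineDerivOp_smul, mul_assoc]
    exact ih (h.2 i)

theorem zero {N : ℕ} : SobolevBound Λ R N 0 (0 : 𝓢(Euc n, ℂ)) := by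
  induction N with
  | zero => exact ⟨fun η => by simp, fun η _ => rfl⟩
  | succ N ih =>
    refine ⟨⟨fun η => by simp, fun η _ => rfl⟩, fun i => ?_⟩
    rw [LineDeriv.lineDerivOp_zero, zero_mul]
    exact ih

theorem sum {ι : Type*} (s : Finset ι) {N : ℕ} {B : ℝ} {u : ι → 𝓢(Euc n, ℂ)}
    (h : ∀ i ∈ s, SobolevBound Λ R N B (u i)) : SobolevBound Λ R N (s.card * B) (∑ i ∈ s, u i) := by
  classical
  induction s using Finset.induction_on with
  | empty => simpa using zero
  | insert i s hi ih =>
    rw [Finset.sum_insert hi, Finset.card_insert_of_notMem hi, Nat.cast_succ, add_mul, one_mul,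
      add_comm _ B]
    exact (h i (Finset.mem_insert_self i s)).add
      (ih fun j hj => h j (Finset.mem_insert_of_mem hj))

/-- Multiplication by `λ η_i` costs about as much as a derivative on the region
`|λ η_i| ≤ Λ`: the commutator terms, at most `N` of them, are of size `|λ|`. -/
theorem mulInner_basis {lam : ℝ} (hΛ : 0 < Λ) (i : Fin n) (hR : ∀ η ∈ R, |lam * η i| ≤ Λ)
    {N : ℕ} {B : ℝ} {u : 𝓢(Euc n, ℂ)} (h : SobolevBound Λ R N B u) :
    SobolevBound Λ R N (B * (Λ + N * |lam| / Λ))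
      ((lam : ℂ) • mulInner (EuclideanSpace.basisFun (Fin n) ℝ i) u) := by
  have hz : ∀ {u : 𝓢(Euc n, ℂ)} {N : ℕ} {B : ℝ}, SobolevBound Λ R N B u →
      ∀ K : ℝ, 0 ≤ K →
      (∀ η, ‖((lam : ℂ) • mulInner (EuclideanSpace.basisFun (Fin n) ℝ i) u) η‖ ≤ B * (Λ + K)) ∧
      ∀ η ∉ R, ((lam : ℂ) • mulInner (EuclideanSpace.basisFun (Fin n) ℝ i) u) η = 0 := by
    intro u N B h K hK
    have hB := h.nonneg
    have h0 : ∀ η, ((lam : ℂ) • mulInner (EuclideanSpace.basisFun (Fin n) ℝ i) u) η =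
        ((lam * η i : ℝ) : ℂ) * u η := fun η => by
      rw [_root_.smul_apply, mulInner_apply, EuclideanSpace.basisFun_apply,
        EuclideanSpace.inner_single_left]
      simp [mul_assoc]
    refine ⟨fun η => ?_, fun η hη => by rw [h0, h.bound.2 η hη, mul_zero]⟩
    by_cases hη : η ∈ R
    · rw [h0, norm_mul, Complex.norm_real, Real.norm_eq_abs, mul_comm]
      have h1 : |lam * η i| ≤ Λ + K := (hR η hη).trans (by linarith)
      exact mul_le_mul (h.bound.1 η) h1 (abs_nonneg _) hB
    · rw [h0, h.bound.2 η hη, mul_zero, norm_zero]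
      positivity
  induction N generalizing B u with
  | zero =>
    have h1 := hz h 0 le_rfl
    have h2 : (Λ + ((0 : ℕ) : ℝ) * |lam| / Λ) = Λ + 0 := by simp
    rw [h2]
    exact h1
  | succ N ih =>
    refine ⟨hz h _ (by positivity), fun k => ?_⟩
    have h1 : ∂_{EuclideanSpace.basisFun (Fin n) ℝ k}
        ((lam : ℂ) • mulInner (EuclideanSpace.basisFun (Fin n) ℝ i) u) =
        ((lam : ℂ) • mulInner (EuclideanSpace.basisFun (Fin n) ℝ i)
          (∂_{EuclideanSpace.basisFun (Fin n) ℝ k} u)) +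
        ((lam * ⟪EuclideanSpace.basisFun (Fin n) ℝ i,
          EuclideanSpace.basisFun (Fin n) ℝ k⟫_ℝ : ℝ) : ℂ) • u := by
      rw [LineDeriv.lineDerivOp_smul, lineDerivOp_mulInner, smul_add, smul_smul]
      push_cast
      rfl
    rw [h1]
    have hc : ‖((lam * ⟪EuclideanSpace.basisFun (Fin n) ℝ i,
          EuclideanSpace.basisFun (Fin n) ℝ k⟫_ℝ : ℝ) : ℂ)‖ ≤ |lam| := by
      rw [Complex.norm_real, Real.norm_eq_abs, abs_mul]
      refine mul_le_of_le_one_right (abs_nonneg _) ?_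
      refine (abs_real_inner_le_norm _ _).trans ?_
      simp
    have h2 := (ih (h.2 k)).add ((h.of_succ.smul _).mono hΛ.le
      (mul_le_mul_of_nonneg_right hc h.nonneg))
    refine h2.mono hΛ.le (le_of_eq ?_)
    push_cast
    field_simp
    ring

/-- Each of the `n` summands of `H(λ)` contributes `Λ²` from two derivatives and `(2 Λ)²` from two
multiplications by `λ η_i`, since `N |λ| / Λ ≤ Λ`. -/
theorem hermiteOp {lam : ℝ} (hΛ : 0 < Λ) (hR : ∀ η ∈ R, ∀ i, |lam * η i| ≤ Λ) {N : ℕ} {B : ℝ}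
    {u : 𝓢(Euc n, ℂ)} (h : SobolevBound Λ R (N + 2) B u) (hN : (N + 2 : ℕ) * |lam| ≤ Λ ^ 2) :
    SobolevBound Λ R N (5 * n * Λ ^ 2 * B) (hermiteOp n lam u) := by
  have hB := h.nonneg
  have h2 : ∀ i, ∀ v : 𝓢(Euc n, ℂ), ∀ {B : ℝ}, SobolevBound Λ R N B v →
      SobolevBound Λ R N (B * (2 * Λ))
        ((lam : ℂ) • mulInner (EuclideanSpace.basisFun (Fin n) ℝ i) v) := by
    intro i v B hv
    refine (hv.mulInner_basis hΛ i fun η hη => hR η hη i).mono hΛ.le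
      (mul_le_mul_of_nonneg_left ?_ hv.nonneg)
    have h3 : N * |lam| / Λ ≤ Λ := by
      rw [div_le_iff₀ hΛ]
      have : (0 : ℝ) ≤ |lam| := abs_nonneg _
      push_cast at hN
      nlinarith
    linarith
  rw [hermiteOp_eq_sum]
  have h4 : ∀ i ∈ (Finset.univ : Finset (Fin n)), SobolevBound Λ R N (5 * Λ ^ 2 * B)
      (-(∂_{EuclideanSpace.basisFun (Fin n) ℝ i} (∂_{EuclideanSpace.basisFun (Fin n) ℝ i} u)) +
      ((lam ^ 2 : ℝ) : ℂ) • mulInner (EuclideanSpace.basisFun (Fin n) ℝ i)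
        (mulInner (EuclideanSpace.basisFun (Fin n) ℝ i) u)) := by
    intro i _
    have h5 := ((h.2 i).2 i).smul (-1)
    have h6 := h2 i _ (h2 i _ h.of_succ.of_succ)
    have h7 := (h5.add h6).mono (B' := 5 * Λ ^ 2 * B) hΛ.le (le_of_eq (by
      rw [norm_neg, norm_one]
      ring))
    have h8 : (lam : ℂ) • mulInner (EuclideanSpace.basisFun (Fin n) ℝ i)
        ((lam : ℂ) • mulInner (EuclideanSpace.basisFun (Fin n) ℝ i) u) =
        ((lam ^ 2 : ℝ) : ℂ) • mulInner (EuclideanSpace.basisFun (Fin n) ℝ i)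
        (mulInner (EuclideanSpace.basisFun (Fin n) ℝ i) u) := by
      rw [map_smul, smul_smul]
      push_cast
      rw [sq]
    rwa [h8, neg_one_smul] at h7
  refine (sum _ h4).mono hΛ.le (le_of_eq ?_)
  rw [Finset.card_univ, Fintype.card_fin]
  ring

theorem hermiteOp_iterate {lam : ℝ} (hΛ : 0 < Λ) (hR : ∀ η ∈ R, ∀ i, |lam * η i| ≤ Λ) {m : ℕ}
    {B : ℝ} {u : 𝓢(Euc n, ℂ)} (h : SobolevBound Λ R (2 * m) B u)
    (hm : (2 * m : ℕ) * |lam| ≤ Λ ^ 2) :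
    SobolevBound Λ R 0 ((5 * n * Λ ^ 2) ^ m * B) ((_root_.hermiteOp n lam)^[m] u) := by
  induction m generalizing B u with
  | zero => simpa using h
  | succ m ih =>
    rw [Function.iterate_succ_apply]
    have h1 := hermiteOp hΛ hR (N := 2 * m) h hm
    refine (ih h1 (le_trans ?_ hm)).mono hΛ.le (le_of_eq (by ring))
    gcongr
    omega

end SobolevBound

/-! ### Translated product bumps -/

theorem iteratedDeriv_eq_zero_of_abs_gt {g : ℝ → ℝ} (hs : ∀ x, 3 ≤ |x| → g x = 0) (k : ℕ) {x : ℝ}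
    (hx : 3 < |x|) : iteratedDeriv k g x = 0 := by
  have h1 : g =ᶠ[𝓝 x] fun _ => 0 := by
    filter_upwards [(isOpen_lt continuous_const continuous_abs).mem_nhds hx] with y hy
    exact hs y (le_of_lt hy)
  rw [h1.iteratedDeriv_eq]
  simp

/-- The Schwartz function `η ↦ ∏ g^{(k_j)}(η_j - ξ_j)`. -/
noncomputable def translatedBump {n : ℕ} {g : ℝ → ℝ} (hg : ContDiff ℝ (⊤ : ℕ∞) g)
    (hs : ∀ x, 3 ≤ |x| → g x = 0) (k : Fin n → ℕ) (ξ : Euc n) : 𝓢(Euc n, ℂ) :=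
  HasCompactSupport.toSchwartzMap
    (f := fun η : Euc n => ((∏ j, iteratedDeriv (k j) g (η j - ξ j) : ℝ) : ℂ))
    (by
      refine HasCompactSupport.intro ((isCompact_cube n 3).image (continuous_add_const ξ))
        fun η hη => ?_
      by_contra hne
      refine hη ⟨η - ξ, fun j => ?_, sub_add_cancel _ _⟩
      by_contra hj
      refine hne ?_
      rw [Complex.ofReal_eq_zero]
      exact Finset.prod_eq_zero (Finset.mem_univ j)
        (iteratedDeriv_eq_zero_of_abs_gt hs _ (not_le.1 hj)))
    (by
      have hp : ContDiff ℝ (⊤ : ℕ∞) fun η : Euc n =>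
          ∏ j, iteratedDeriv (k j) g (η j - ξ j) := contDiff_prod fun j _ => ?_
      · exact Complex.ofRealCLM.contDiff.comp hp
      have h1 : ContDiff ℝ (⊤ : ℕ∞) (iteratedDeriv (k j) g) := by
        rw [iteratedDeriv_eq_iterate]
        exact hg.iterate_deriv (k j)
      exact h1.comp (by fun_prop))

theorem translatedBump_apply {n : ℕ} {g : ℝ → ℝ} (hg : ContDiff ℝ (⊤ : ℕ∞) g)
    (hs : ∀ x, 3 ≤ |x| → g x = 0) (k : Fin n → ℕ) (ξ η : Euc n) :
    translatedBump hg hs k ξ η = ((∏ j, iteratedDeriv (k j) g (η j - ξ j) : ℝ) : ℂ) := rfl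

theorem lineDerivOp_translatedBump {n : ℕ} {g : ℝ → ℝ} (hg : ContDiff ℝ (⊤ : ℕ∞) g)
    (hs : ∀ x, 3 ≤ |x| → g x = 0) (k : Fin n → ℕ) (ξ : Euc n) (i : Fin n) :
    ∂_{EuclideanSpace.basisFun (Fin n) ℝ i} (translatedBump hg hs k ξ) =
      translatedBump hg hs (Function.update k i (k i + 1)) ξ := by
  ext η
  have hd : ∀ (k : ℕ) (x : ℝ), HasDerivAt (iteratedDeriv k g) (iteratedDeriv (k + 1) g x) x := by
    intro k x
    rw [iteratedDeriv_succ]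
    exact ((hg.differentiable_iteratedDeriv k (by exact_mod_cast ENat.natCast_lt_top k)) x).hasDerivAt
  have h1 : ∀ j ∈ (Finset.univ : Finset (Fin n)),
      HasFDerivAt (fun η : Euc n => iteratedDeriv (k j) g (η j - ξ j))
      ((iteratedDeriv (k j + 1) g (η j - ξ j)) • (EuclideanSpace.proj j : Euc n →L[ℝ] ℝ)) η := by
    intro j _
    have h2 : HasFDerivAt (fun η : Euc n => η j - ξ j) (EuclideanSpace.proj j : Euc n →L[ℝ] ℝ) η :=
      (EuclideanSpace.proj j : Euc n →L[ℝ] ℝ).hasFDerivAt.sub_const _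
    exact (hd (k j) (η j - ξ j)).comp_hasFDerivAt η h2
  have h3 := Complex.ofRealCLM.hasFDerivAt.comp η (HasFDerivAt.finsetProd h1)
  rw [SchwartzMap.lineDerivOp_apply_eq_fderiv]
  have h4 : fderiv ℝ (translatedBump hg hs k ξ) η = _ := h3.fderiv
  rw [h4, translatedBump_apply, ContinuousLinearMap.comp_apply, Complex.ofRealCLM_apply,
    _root_.sum_apply, Finset.sum_eq_single i]
  · rw [← Finset.prod_erase_mul _ _ (Finset.mem_univ i), Function.update_self]
    have h5 : ∀ j ∈ Finset.univ.erase i, iteratedDeriv (Function.update k i (k i + 1) j) g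
        (η j - ξ j) = iteratedDeriv (k j) g (η j - ξ j) := fun j hj => by
      rw [Function.update_of_ne (Finset.ne_of_mem_erase hj)]
    rw [Finset.prod_congr rfl h5]
    simp
  · intro j _ hj
    simp [hj]
  · simp

theorem sobolevBound_translatedBump {n : ℕ} {g : ℝ → ℝ} (hg : ContDiff ℝ (⊤ : ℕ∞) g)
    (hs : ∀ x, 3 ≤ |x| → g x = 0) {Λ : ℝ} {M : ℕ}
    (hb : ∀ k ≤ M, ∀ x, |iteratedDeriv k g x| ≤ Λ ^ k) (ξ : Euc n) (N : ℕ) (k : Fin n → ℕ)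
    (hk : ∑ j, k j + N ≤ M) :
    SobolevBound Λ {η | η - ξ ∈ cube n 3} N (Λ ^ (∑ j, k j)) (translatedBump hg hs k ξ) := by
  have h0 : ∀ k : Fin n → ℕ, ∑ j, k j ≤ M →
      (∀ η, ‖translatedBump hg hs k ξ η‖ ≤ Λ ^ (∑ j, k j)) ∧
      ∀ η ∉ {η | η - ξ ∈ cube n 3}, translatedBump hg hs k ξ η = 0 := by
    intro k hk
    refine ⟨fun η => ?_, fun η hη => ?_⟩
    · rw [translatedBump_apply, Complex.norm_real, Real.norm_eq_abs, Finset.abs_prod,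
        ← Finset.prod_pow_eq_pow_sum]
      refine Finset.prod_le_prod (fun _ _ => abs_nonneg _) fun j _ => hb _ ?_ _
      exact (Finset.single_le_sum (fun _ _ => Nat.zero_le _) (Finset.mem_univ j)).trans hk
    · rw [translatedBump_apply, Complex.ofReal_eq_zero]
      obtain ⟨j, hj⟩ := not_forall.1 hη
      exact Finset.prod_eq_zero (Finset.mem_univ j)
        (iteratedDeriv_eq_zero_of_abs_gt hs _ (not_le.1 hj))
  induction N generalizing k with
  | zero => exact h0 k hk
  | succ N ih =>
    refine ⟨h0 k (by omega), fun i => ?_⟩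
    rw [lineDerivOp_translatedBump, ← pow_succ]
    have h1 : ∑ j, Function.update k i (k i + 1) j = ∑ j, k j + 1 := by
      rw [Finset.sum_update_of_mem (Finset.mem_univ i), ← Finset.erase_eq,
        ← Finset.add_sum_erase _ k (Finset.mem_univ i)]
      omega
    rw [← h1]
    exact ih _ (by omega)

/-! ### Local estimates for operators with kernels supported near the diagonal -/

theorem inner_hermiteOp_eigenspace {n : ℕ} {lam μ : ℝ} {v : L2 n}
    (hv : v ∈ hermiteEigenspace n lam μ) (u : 𝓢(Euc n, ℂ)) :
    ⟪(hermiteOp n lam u).toLp 2 volume, v⟫_ℂ = (μ : ℂ) * ⟪u.toLp 2 volume, v⟫_ℂ := by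
  have hclosed : IsClosed {v : L2 n | ⟪(hermiteOp n lam u).toLp 2 volume, v⟫_ℂ =
      (μ : ℂ) * ⟪u.toLp 2 volume, v⟫_ℂ} :=
    isClosed_eq (by fun_prop) (by fun_prop)
  refine closure_minimal ?_ hclosed hv
  rintro _ ⟨g, hg, rfl⟩
  have hg' : hermiteOp n lam g = (μ : ℂ) • g := by
    simpa [sub_eq_zero] using hg
  have h := hermiteOp_symmetric n lam u g
  rw [hg', toLp_smul, inner_smul_right] at h
  exact h

theorem inner_hermiteOp_iterate_eigenspace {n : ℕ} {lam μ : ℝ} {v : L2 n}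
    (hv : v ∈ hermiteEigenspace n lam μ) (m : ℕ) (u : 𝓢(Euc n, ℂ)) :
    ⟪((hermiteOp n lam)^[m] u).toLp 2 volume, v⟫_ℂ = (μ : ℂ) ^ m * ⟪u.toLp 2 volume, v⟫_ℂ := by
  induction m generalizing u with
  | zero => simp
  | succ m ih =>
    rw [Function.iterate_succ_apply, ih, inner_hermiteOp_eigenspace hv, pow_succ, mul_assoc]

/-- The integral of `|φ|` over the cube of side `6` centred at `ξ`. -/
noncomputable def cubeIntegral {n : ℕ} (φ : Euc n → ℂ) (ξ : Euc n) : ℝ≥0∞ :=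
  ∫⁻ y in cube n 3, ‖φ (ξ + y)‖ₑ

theorem lintegral_sq_le {α : Type*} [MeasurableSpace α] {μ : Measure α} {F : α → ℝ≥0∞}
    (hF : AEMeasurable F μ) : (∫⁻ x, F x ∂μ) ^ 2 ≤ μ Set.univ * ∫⁻ x, F x ^ 2 ∂μ := by
  have h := ENNReal.lintegral_mul_le_Lp_mul_Lq μ Real.HolderConjugate.two_two
    (aemeasurable_const (b := (1 : ℝ≥0∞))) hF
  simp only [Pi.mul_apply, one_mul, ENNReal.one_rpow, lintegral_const] at h
  calc (∫⁻ x, F x ∂μ) ^ 2 ≤ _ := pow_le_pow_left' h 2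
    _ = μ Set.univ * ∫⁻ x, F x ^ 2 ∂μ := by
      rw [mul_pow, ← ENNReal.rpow_natCast, ← ENNReal.rpow_natCast, ← ENNReal.rpow_mul,
        ← ENNReal.rpow_mul]
      norm_num

theorem lintegral_cubeIntegral_sq_le {n : ℕ} {φ : Euc n → ℂ} (hφ : StronglyMeasurable φ) :
    ∫⁻ ξ, cubeIntegral φ ξ ^ 2 ≤ volume (cube n 3) ^ 2 * ∫⁻ ξ, ‖φ ξ‖ₑ ^ 2 := by
  have hm : Measurable fun q : Euc n × Euc n => ‖φ (q.1 + q.2)‖ₑ :=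
    (hφ.comp_measurable (measurable_fst.add measurable_snd)).enorm
  calc ∫⁻ ξ, cubeIntegral φ ξ ^ 2
      ≤ ∫⁻ ξ, volume (cube n 3) * ∫⁻ y in cube n 3, ‖φ (ξ + y)‖ₑ ^ 2 := by
        refine lintegral_mono fun ξ => ?_
        have h := lintegral_sq_le (μ := volume.restrict (cube n 3))
          (F := fun y => ‖φ (ξ + y)‖ₑ) (hm.comp measurable_prodMk_left).aemeasurable
        rwa [Measure.restrict_apply_univ] at h
    _ = volume (cube n 3) * ∫⁻ y in cube n 3, ∫⁻ ξ, ‖φ (ξ + y)‖ₑ ^ 2 := by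
        rw [lintegral_const_mul' _ _ (isCompact_cube n 3).measure_lt_top.ne, lintegral_lintegral_swap]
        exact (hm.pow_const 2).aemeasurable
    _ = volume (cube n 3) * ∫⁻ y in cube n 3, ∫⁻ ξ, ‖φ ξ‖ₑ ^ 2 := by
        congr 1
        refine lintegral_congr fun y => ?_
        exact lintegral_add_right_eq_self (fun ξ => ‖φ ξ‖ₑ ^ 2) y
    _ = volume (cube n 3) ^ 2 * ∫⁻ ξ, ‖φ ξ‖ₑ ^ 2 := by
        rw [lintegral_const, Measure.restrict_apply_univ]
        ring

theorem enorm_inner_le_cubeIntegral {n : ℕ} {Λ B : ℝ} {ξ : Euc n} {u : 𝓢(Euc n, ℂ)}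
    (h : SobolevBound Λ {η | η - ξ ∈ cube n 3} 0 B u) (φ : L2 n) :
    ‖⟪u.toLp 2 volume, φ⟫_ℂ‖ₑ ≤ ENNReal.ofReal B * cubeIntegral φ ξ := by
  rw [L2.inner_def]
  have hmeas : MeasurableSet (cube n 3) := (isCompact_cube n 3).isClosed.measurableSet
  calc ‖∫ η, ⟪(u.toLp 2 volume) η, φ η⟫_ℂ‖ₑ ≤ ∫⁻ η, ‖⟪(u.toLp 2 volume) η, φ η⟫_ℂ‖ₑ :=
        enorm_integral_le_lintegral_enorm _
    _ ≤ ∫⁻ η, (cube n 3).indicator (fun y => ENNReal.ofReal B * ‖φ (ξ + y)‖ₑ) (-ξ + η) := by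
        refine lintegral_mono_ae ?_
        filter_upwards [u.coeFn_toLp 2 volume] with η hη
        rw [hη, RCLike.inner_apply, enorm_mul]
        by_cases hmem : -ξ + η ∈ cube n 3
        · rw [Set.indicator_of_mem hmem, mul_comm]
          simp only [add_neg_cancel_left]
          gcongr
          rw [RCLike.enorm_conj, ← ofReal_norm]
          exact ENNReal.ofReal_le_ofReal (h.1 η)
        · have h1 : u η = 0 := h.2 η (by
            rw [Set.mem_ofPred_eq, sub_eq_neg_add]
            exact hmem)
          simp [h1]
    _ = ∫⁻ y, (cube n 3).indicator (fun y => ENNReal.ofReal B * ‖φ (ξ + y)‖ₑ) y :=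
        lintegral_add_left_eq_self _ _
    _ = ENNReal.ofReal B * cubeIntegral φ ξ := by
        rw [lintegral_indicator hmeas, lintegral_const_mul' _ _ ENNReal.ofReal_ne_top]
        rfl

theorem enorm_sq_eq_lintegral {n : ℕ} (φ : L2 n) : ‖φ‖ₑ ^ 2 = ∫⁻ ξ, ‖φ ξ‖ₑ ^ 2 := by
  rw [Lp.enorm_def, eLpNorm_eq_lintegral_rpow_enorm_toReal (by simp) (by simp),
    ← ENNReal.rpow_natCast, ← ENNReal.rpow_mul]
  simp

theorem norm_sq_sum_eigenvectors {n : ℕ} {lam : ℝ} (S : Finset ℝ) {v : ℝ → L2 n}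
    (hv : ∀ μ, v μ ∈ hermiteEigenspace n lam μ) :
    ‖∑ μ ∈ S, v μ‖ ^ 2 = ∑ μ ∈ S, ‖v μ‖ ^ 2 :=
  (hermiteEigenspace_orthogonal n lam).norm_sum (fun μ => ⟨v μ, hv μ⟩) S

theorem norm_sum_smul_eigenvectors_le {n : ℕ} {lam : ℝ} {S : Finset ℝ} {v : ℝ → L2 n}
    (hv : ∀ μ, v μ ∈ hermiteEigenspace n lam μ) {a : ℝ → ℝ} (ha : ∀ μ ∈ S, |a μ| ≤ 1) :
    ‖∑ μ ∈ S, (a μ : ℂ) • v μ‖ ≤ ‖∑ μ ∈ S, v μ‖ := by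
  refine abs_le_of_sq_le_sq' ?_ (norm_nonneg _) |>.2
  rw [norm_sq_sum_eigenvectors S hv,
    norm_sq_sum_eigenvectors S fun μ => Submodule.smul_mem _ (a μ : ℂ) (hv μ)]
  refine Finset.sum_le_sum fun μ hμ => ?_
  rw [norm_smul, Complex.norm_real, Real.norm_eq_abs]
  gcongr
  exact mul_le_of_le_one_left (norm_nonneg _) (ha μ hμ)

/-- Let `T φ(ξ) = c(ξ) ⟪u_ξ, φ⟫` with `u_ξ` supported near `ξ`, and let `φ'` be such that
`H(λ)^m φ' = a^m φ` weakly. Then `T` is bounded by `D` on `φ` if for each `ξ` either `|c(ξ)| ≤ D` or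
`|c(ξ)| |H(λ)^m u_ξ| ≤ D a^m`. -/
theorem norm_apply_le_of_inner_hermiteOp_iterate {n : ℕ} {lam Λ : ℝ} {T : L2 n → L2 n}
    {c : Euc n → ℂ} {u : Euc n → 𝓢(Euc n, ℂ)}
    (hT : ∀ φ, T φ =ᵐ[volume] fun ξ => c ξ * ⟪(u ξ).toLp 2 volume, φ⟫_ℂ)
    (hu : ∀ ξ, SobolevBound Λ {η | η - ξ ∈ cube n 3} 0 1 (u ξ)) {a : ℝ} (ha : 0 < a) (m : ℕ)
    {φ φ' : L2 n} (hle : ‖φ'‖ ≤ ‖φ‖)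
    (hpair : ∀ w : 𝓢(Euc n, ℂ), ⟪((hermiteOp n lam)^[m] w).toLp 2 volume, φ'⟫_ℂ =
      ((a ^ m : ℝ) : ℂ) * ⟪w.toLp 2 volume, φ⟫_ℂ) {D : ℝ} (hD : 0 ≤ D)
    (h : ∀ ξ, ‖c ξ‖ ≤ D ∨ ∃ B,
      SobolevBound Λ {η | η - ξ ∈ cube n 3} 0 B ((hermiteOp n lam)^[m] (u ξ)) ∧
      ‖c ξ‖ * B ≤ D * a ^ m) :
    ‖T φ‖ ≤ 2 * (volume (cube n 3)).toReal * D * ‖φ‖ := by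
  have hpt : ∀ᵐ ξ, ‖T φ ξ‖ₑ ^ 2 ≤
      ENNReal.ofReal D ^ 2 * (cubeIntegral φ ξ ^ 2 + cubeIntegral φ' ξ ^ 2) := by
    filter_upwards [hT φ] with ξ hξ
    rw [hξ, enorm_mul]
    rcases h ξ with h1 | ⟨B, hB, h1⟩
    · have h2 : ‖c ξ‖ₑ * ‖⟪(u ξ).toLp 2 volume, φ⟫_ℂ‖ₑ ≤ ENNReal.ofReal D * cubeIntegral φ ξ := by
        refine mul_le_mul' ?_ ((enorm_inner_le_cubeIntegral (hu ξ) φ).trans (by simp))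
        rw [← ofReal_norm]
        exact ENNReal.ofReal_le_ofReal h1
      calc _ ≤ (ENNReal.ofReal D * cubeIntegral φ ξ) ^ 2 := pow_le_pow_left' h2 2
        _ = ENNReal.ofReal D ^ 2 * cubeIntegral φ ξ ^ 2 := mul_pow _ _ _
        _ ≤ _ := mul_le_mul_right le_self_add _
    · have h3 : ‖⟪(u ξ).toLp 2 volume, φ⟫_ℂ‖ₑ ≤
          ENNReal.ofReal (B / a ^ m) * cubeIntegral φ' ξ := by
        have h4 := enorm_inner_le_cubeIntegral hB φ'
        have h5 : ⟪(u ξ).toLp 2 volume, φ⟫_ℂ = (((a ^ m)⁻¹ : ℝ) : ℂ) *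
            ⟪((hermiteOp n lam)^[m] (u ξ)).toLp 2 volume, φ'⟫_ℂ := by
          rw [hpair, ← mul_assoc, ← Complex.ofReal_mul, inv_mul_cancel₀ (by positivity),
            Complex.ofReal_one, one_mul]
        rw [h5, enorm_mul, div_eq_inv_mul, ENNReal.ofReal_mul (by positivity), mul_assoc]
        refine mul_le_mul' (le_of_eq ?_) h4
        rw [← ofReal_norm, Complex.norm_real, Real.norm_of_nonneg (by positivity)]
      have h2 : ‖c ξ‖ₑ * ‖⟪(u ξ).toLp 2 volume, φ⟫_ℂ‖ₑ ≤ ENNReal.ofReal D * cubeIntegral φ' ξ := by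
        refine (mul_le_mul_right h3 _).trans ?_
        rw [← mul_assoc, ← ofReal_norm, ← ENNReal.ofReal_mul (norm_nonneg _)]
        refine mul_le_mul_left (ENNReal.ofReal_le_ofReal ?_) _
        rw [mul_div_assoc', div_le_iff₀ (by positivity)]
        exact h1
      calc _ ≤ (ENNReal.ofReal D * cubeIntegral φ' ξ) ^ 2 := pow_le_pow_left' h2 2
        _ = ENNReal.ofReal D ^ 2 * cubeIntegral φ' ξ ^ 2 := mul_pow _ _ _
        _ ≤ _ := mul_le_mul_right le_add_self _
  have hmφ : ∀ ψ : L2 n, ∫⁻ ξ, cubeIntegral ψ ξ ^ 2 ≤ volume (cube n 3) ^ 2 * ‖ψ‖ₑ ^ 2 := fun ψ => by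
    rw [enorm_sq_eq_lintegral]
    exact lintegral_cubeIntegral_sq_le (Lp.stronglyMeasurable ψ)
  have hmeas : Measurable fun ξ => cubeIntegral φ ξ ^ 2 := by
    refine Measurable.pow_const ?_ 2
    exact Measurable.lintegral_prod_right' (f := fun q : Euc n × Euc n => ‖φ (q.1 + q.2)‖ₑ)
      ((Lp.stronglyMeasurable φ).comp_measurable (measurable_fst.add measurable_snd)).enorm
  have hle' : ‖φ'‖ₑ ≤ ‖φ‖ₑ := by
    rw [← ofReal_norm, ← ofReal_norm]
    exact ENNReal.ofReal_le_ofReal hle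
  have hsq : ‖T φ‖ₑ ^ 2 ≤ (2 * volume (cube n 3) * ENNReal.ofReal D * ‖φ‖ₑ) ^ 2 := by
    calc ‖T φ‖ₑ ^ 2 = ∫⁻ ξ, ‖T φ ξ‖ₑ ^ 2 := enorm_sq_eq_lintegral _
      _ ≤ ∫⁻ ξ, ENNReal.ofReal D ^ 2 * (cubeIntegral φ ξ ^ 2 + cubeIntegral φ' ξ ^ 2) :=
        lintegral_mono_ae hpt
      _ = ENNReal.ofReal D ^ 2 * ((∫⁻ ξ, cubeIntegral φ ξ ^ 2) + ∫⁻ ξ, cubeIntegral φ' ξ ^ 2) := by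
        rw [lintegral_const_mul' _ _ (by simp), lintegral_add_left hmeas]
      _ ≤ ENNReal.ofReal D ^ 2 * (volume (cube n 3) ^ 2 * ‖φ‖ₑ ^ 2 +
          volume (cube n 3) ^ 2 * ‖φ‖ₑ ^ 2) := by
        gcongr
        · exact hmφ φ
        · exact (hmφ φ').trans (by gcongr)
      _ = 2 * (volume (cube n 3) * ENNReal.ofReal D * ‖φ‖ₑ) ^ 2 := by ring
      _ ≤ 2 ^ 2 * (volume (cube n 3) * ENNReal.ofReal D * ‖φ‖ₑ) ^ 2 := by
        gcongr
        norm_num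
      _ = _ := by ring
  have hV : volume (cube n 3) ≠ ⊤ := (isCompact_cube n 3).measure_lt_top.ne
  have hfin : 2 * volume (cube n 3) * ENNReal.ofReal D * ‖φ‖ₑ ≠ ⊤ := by finiteness
  have h6 := ENNReal.toReal_mono (by finiteness) hsq
  rw [ENNReal.toReal_pow, ENNReal.toReal_pow, ENNReal.toReal_mul, ENNReal.toReal_mul,
    ENNReal.toReal_mul, toReal_enorm, toReal_enorm, ENNReal.toReal_ofReal hD,
    ENNReal.toReal_ofNat] at h6
  exact abs_le_of_sq_le_sq' h6 (by positivity) |>.2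

/-- On a sum `φ` of eigenvectors with eigenvalues `μ ≥ a`, the function `φ'` of the previous lemma
arises from the multiplier `(a / μ) ^ m ≤ 1`. -/
theorem norm_apply_sum_eigenvectors_le {n : ℕ} {lam Λ : ℝ} {T : L2 n → L2 n} {c : Euc n → ℂ}
    {u : Euc n → 𝓢(Euc n, ℂ)}
    (hT : ∀ φ, T φ =ᵐ[volume] fun ξ => c ξ * ⟪(u ξ).toLp 2 volume, φ⟫_ℂ)
    (hu : ∀ ξ, SobolevBound Λ {η | η - ξ ∈ cube n 3} 0 1 (u ξ))
    {S : Finset ℝ} {v : ℝ → L2 n} (hv : ∀ μ, v μ ∈ hermiteEigenspace n lam μ) {a : ℝ}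
    (ha : 0 < a) (hS : ∀ μ ∈ S, a ≤ μ) (m : ℕ) {D : ℝ} (hD : 0 ≤ D)
    (h : ∀ ξ, ‖c ξ‖ ≤ D ∨ ∃ B,
      SobolevBound Λ {η | η - ξ ∈ cube n 3} 0 B ((hermiteOp n lam)^[m] (u ξ)) ∧
      ‖c ξ‖ * B ≤ D * a ^ m) :
    ‖T (∑ μ ∈ S, v μ)‖ ≤ 2 * (volume (cube n 3)).toReal * D * ‖∑ μ ∈ S, v μ‖ := by
  have hμ0 : ∀ μ ∈ S, 0 < μ := fun μ hμ => ha.trans_le (hS μ hμ)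
  refine norm_apply_le_of_inner_hermiteOp_iterate hT hu ha m
    (φ' := ∑ μ ∈ S, (((a / μ) ^ m : ℝ) : ℂ) • v μ)
    (norm_sum_smul_eigenvectors_le hv fun μ hμ => ?_) (fun w => ?_) hD h
  · rw [abs_pow]
    refine pow_le_one₀ (abs_nonneg _) ?_
    rw [abs_of_pos (div_pos ha (hμ0 μ hμ)), div_le_one (hμ0 μ hμ)]
    exact hS μ hμ
  · rw [inner_sum, inner_sum, Finset.mul_sum]
    refine Finset.sum_congr rfl fun μ hμ => ?_
    rw [inner_smul_right, inner_hermiteOp_iterate_eigenspace (hv μ), ← mul_assoc]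
    congr 1
    have : (μ : ℂ) ≠ 0 := by exact_mod_cast (hμ0 μ hμ).ne'
    push_cast
    rw [div_pow, div_mul_cancel₀ _ (pow_ne_zero _ this)]

/-! ### Choice of the dyadic parameters -/

/-- The number `m_l = ⌈2 ^ (l + 1) Θ(2 ^ l)⌉ + l` of factors `H(λ)` gained at frequency `2 ^ l`. The
first term dominates `x Θ(x)` for `2 ^ l ≤ x ≤ 2 ^ (l + 1)`; the second makes the blocks summable. -/
noncomputable def dyadicOrder (Θ : ℝ≥0 → ℝ≥0) (l : ℕ) : ℕ :=
  ⌈(2 : ℝ) ^ (l + 1) * (Θ ((2 : ℝ) ^ l).toNNReal : ℝ)⌉₊ + l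

/-- The bound `Λ_l = 2 ^ l / (4 n)` per derivative at frequency `2 ^ l`. -/
noncomputable def dyadicScale (n l : ℕ) : ℝ := 2 ^ l / (4 * n)

theorem dyadicScale_pos {n : ℕ} (hn : 1 ≤ n) (l : ℕ) : 0 < dyadicScale n l := by
  have : (0 : ℝ) < n := by exact_mod_cast hn
  unfold dyadicScale
  positivity

theorem le_dyadicOrder (Θ : ℝ≥0 → ℝ≥0) (l : ℕ) :
    (2 : ℝ) ^ (l + 1) * (Θ ((2 : ℝ) ^ l).toNNReal : ℝ) ≤ dyadicOrder Θ l - l := by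
  rw [dyadicOrder]
  push_cast
  linarith [Nat.le_ceil ((2 : ℝ) ^ (l + 1) * (Θ ((2 : ℝ) ^ l).toNNReal : ℝ))]

theorem mul_le_dyadicOrder {Θ : ℝ≥0 → ℝ≥0} (hΘ : Antitone Θ) {l : ℕ} {x : ℝ} (h1 : 2 ^ l ≤ x)
    (h2 : x ≤ 2 ^ (l + 1)) : x * (Θ x.toNNReal : ℝ) ≤ dyadicOrder Θ l - l := by
  refine le_trans ?_ (le_dyadicOrder Θ l)
  have : (Θ x.toNNReal : ℝ) ≤ Θ ((2 : ℝ) ^ l).toNNReal := by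
    exact_mod_cast hΘ (Real.toNNReal_le_toNNReal h1)
  gcongr

theorem summable_dyadicOrder_div_dyadicScale {n : ℕ} (hn : 1 ≤ n) {Θ : ℝ≥0 → ℝ≥0}
    (hs : Summable fun k : ℕ => (Θ ((2 : ℝ) ^ k).toNNReal : ℝ)) :
    Summable fun l : ℕ => ((2 * dyadicOrder Θ l : ℕ) : ℝ) / dyadicScale n l := by
  have hn' : (0 : ℝ) < n := by exact_mod_cast hn
  have h1 : Summable fun l : ℕ => ((l : ℝ) + 1) * (1 / 2 : ℝ) ^ l := by
    have h2 := summable_pow_mul_geometric_of_norm_lt_one 1 (r := (1 / 2 : ℝ)) (by norm_num)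
    have h3 := summable_geometric_of_lt_one (r := (1 / 2 : ℝ)) (by norm_num) (by norm_num)
    refine (h2.add h3).congr fun l => ?_
    ring
  refine Summable.of_nonneg_of_le
    (fun l => div_nonneg (Nat.cast_nonneg _) (dyadicScale_pos hn l).le) (fun l => ?_)
    ((hs.mul_left (16 * n : ℝ)).add (h1.mul_left (8 * n : ℝ)))
  have h4 : (dyadicOrder Θ l : ℝ) ≤
      (2 : ℝ) ^ (l + 1) * (Θ ((2 : ℝ) ^ l).toNNReal : ℝ) + 1 + l := by
    rw [dyadicOrder]
    push_cast
    linarith [Nat.ceil_lt_add_one (a := (2 : ℝ) ^ (l + 1) * (Θ ((2 : ℝ) ^ l).toNNReal : ℝ))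
      (by positivity)]
  rw [div_le_iff₀ (dyadicScale_pos hn l)]
  calc ((2 * dyadicOrder Θ l : ℕ) : ℝ) = 2 * dyadicOrder Θ l := by push_cast; ring
    _ ≤ 2 * ((2 : ℝ) ^ (l + 1) * (Θ ((2 : ℝ) ^ l).toNNReal : ℝ) + 1 + l) := by gcongr
    _ = _ := by
      rw [dyadicScale, one_div, inv_pow]
      field_simp
      ring

/-- The dyadic parameters admit a bump function whose derivatives are controlled at each frequency
`2 ^ l` with `l ≥ p`; here `p` is chosen such that the tail `∑_{l ≥ p} 2 m_l / Λ_l` is at most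
`1`. -/
theorem exists_dyadic_bump {n : ℕ} (hn : 1 ≤ n) {Θ : ℝ≥0 → ℝ≥0}
    (hs : Summable fun k : ℕ => (Θ ((2 : ℝ) ^ k).toNNReal : ℝ)) :
    ∃ (p : ℕ) (g : ℝ → ℝ), 1 ≤ p ∧ ContDiff ℝ (⊤ : ℕ∞) g ∧ g 0 = 1 ∧ (∀ x, 3 ≤ |x| → g x = 0) ∧
      ∀ l, p ≤ l → ((2 * dyadicOrder Θ l : ℕ) : ℝ) ≤ dyadicScale n l ∧
        ∀ k ≤ 2 * dyadicOrder Θ l, ∀ x, |iteratedDeriv k g x| ≤ dyadicScale n l ^ k := by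
  have hsum := summable_dyadicOrder_div_dyadicScale hn hs
  have hev := (tendsto_sum_nat_add fun l : ℕ =>
    ((2 * dyadicOrder Θ l : ℕ) : ℝ) / dyadicScale n l).eventually_le_const one_pos
  obtain ⟨p, hp1, hp⟩ := ((eventually_ge_atTop 1).and hev).exists
  have hsum' := (summable_nat_add_iff p).2 hsum
  obtain ⟨g, hg, hg0, hgs, hgb⟩ := exists_bump (N := fun i => 2 * dyadicOrder Θ (i + p))
    (Λ := fun i => dyadicScale n (i + p)) (fun i => dyadicScale_pos hn _)
    (fun k => ⟨k + 1, by
      unfold dyadicOrder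
      omega⟩) hsum' hp
  refine ⟨p, g, hp1, hg, hg0, hgs, fun l hl => ⟨?_, fun k hk x => ?_⟩⟩
  · have h1 := (hsum'.le_tsum (l - p) fun i _ =>
      div_nonneg (Nat.cast_nonneg _) (dyadicScale_pos hn _).le).trans hp
    rwa [Nat.sub_add_cancel hl, div_le_one (dyadicScale_pos hn l)] at h1
  · have h1 := hgb (l - p) k
    simp only [Nat.sub_add_cancel hl] at h1
    exact h1 hk x

/-! ### Decay of the multiplier -/

theorem norm_lineFourier_le_exp {g : ℝ → ℝ} (hg : ContDiff ℝ (⊤ : ℕ∞) g)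
    (hs : ∀ x, 3 ≤ |x| → g x = 0) {Λ : ℝ} (hΛ : 0 < Λ) {m : ℕ}
    (hb : ∀ x, |iteratedDeriv (2 * m) g x| ≤ Λ ^ (2 * m)) {ζ : ℝ} (hζ : 3 * Λ ≤ |ζ|) :
    ‖lineFourier g ζ‖ ≤ 6 * Real.exp (-(2 * m)) := by
  have h1 := abs_pow_mul_norm_lineFourier_le hg hs hb ζ
  have h2 : (3 * Λ) ^ (2 * m) * ‖lineFourier g ζ‖ ≤ 6 * Λ ^ (2 * m) :=
    (mul_le_mul_of_nonneg_right (pow_le_pow_left₀ (by positivity) hζ _) (norm_nonneg _)).trans h1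
  have h3 : (3 : ℝ) ^ (2 * m) * ‖lineFourier g ζ‖ ≤ 6 := by
    have h4 : 0 < Λ ^ (2 * m) := by positivity
    rw [mul_pow, mul_right_comm] at h2
    exact le_of_mul_le_mul_right h2 h4
  have h5 : Real.exp (2 * m) ≤ 3 ^ (2 * m) := by
    have : Real.exp (2 * m) = Real.exp 1 ^ (2 * m) := by
      rw [← Real.exp_nat_mul]
      push_cast
      ring_nf
    rw [this]
    exact pow_le_pow_left₀ (Real.exp_pos 1).le (by linarith [Real.exp_one_lt_d9]) _
  rw [Real.exp_neg, ← div_eq_mul_inv, le_div_iff₀ (Real.exp_pos _), mul_comm]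
  exact (mul_le_mul_of_nonneg_right h5 (norm_nonneg _)).trans h3

theorem norm_lineFourier_le_six {g : ℝ → ℝ} (hg : ContDiff ℝ (⊤ : ℕ∞) g)
    (hs : ∀ x, 3 ≤ |x| → g x = 0) (hb : ∀ x, |g x| ≤ 1) (ζ : ℝ) : ‖lineFourier g ζ‖ ≤ 6 := by
  have h := abs_pow_mul_norm_lineFourier_le hg hs (k := 0) (B := 1) (by simpa using hb) ζ
  simpa using h

theorem exists_pow_two_le_lt {x : ℝ} (hx : 1 ≤ x) : ∃ q : ℕ, 2 ^ q ≤ x ∧ x < 2 ^ (q + 1) :=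
  exists_nat_pow_near hx one_lt_two

/-- The factor `ĥ(λ)` of the multiplier decays like `exp (-2 |λ| Θ(|λ|))`. -/
theorem norm_lineFourier_dilate_le {n : ℕ} (hn : 1 ≤ n) {Θ : ℝ≥0 → ℝ≥0} (hΘ : Antitone Θ)
    {g : ℝ → ℝ} {p : ℕ} (hg : ContDiff ℝ (⊤ : ℕ∞) g) (hs : ∀ x, 3 ≤ |x| → g x = 0)
    (hb : ∀ l, p ≤ l → ∀ k ≤ 2 * dyadicOrder Θ l, ∀ x, |iteratedDeriv k g x| ≤ dyadicScale n l ^ k)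
    (lam : ℝ) : ‖lineFourier g (18 * lam)‖ ≤
      6 * Real.exp (2 * (2 ^ p * Θ 0)) * Real.exp (-(2 * (|lam| * Θ |lam|.toNNReal))) := by
  have hn' : (1 : ℝ) ≤ n := by exact_mod_cast hn
  have hb0 : ∀ x, |g x| ≤ 1 := fun x => by simpa using hb p le_rfl 0 (Nat.zero_le _) x
  have hΘ0 : (Θ |lam|.toNNReal : ℝ) ≤ Θ 0 := by exact_mod_cast hΘ zero_le
  rw [mul_assoc, ← Real.exp_add]
  rcases lt_or_ge |lam| (2 ^ p) with h | h
  · refine (norm_lineFourier_le_six hg hs hb0 _).trans ?_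
    have h1 : |lam| * (Θ |lam|.toNNReal : ℝ) ≤ 2 ^ p * Θ 0 := by gcongr
    have h2 := Real.one_le_exp
      (x := 2 * (2 ^ p * Θ 0) + -(2 * (|lam| * Θ |lam|.toNNReal))) (by linarith)
    linarith
  · obtain ⟨q, hq1, hq2⟩ := exists_pow_two_le_lt ((one_le_pow₀ one_le_two).trans h)
    have hpq : p ≤ q := by
      have := (pow_lt_pow_iff_right₀ (one_lt_two (α := ℝ))).1 (h.trans_lt hq2)
      omega
    have hζ : 3 * dyadicScale n q ≤ |18 * lam| := by
      rw [abs_mul, abs_of_pos (by norm_num : (0 : ℝ) < 18), dyadicScale]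
      have : (2 : ℝ) ^ q / (4 * n) ≤ 2 ^ q := div_le_self (by positivity) (by linarith)
      linarith [abs_nonneg lam]
    refine (norm_lineFourier_le_exp hg hs (dyadicScale_pos hn q)
      (hb q hpq _ le_rfl) hζ).trans ?_
    have h1 := mul_le_dyadicOrder hΘ hq1 hq2.le
    have h2 : (0 : ℝ) ≤ 2 ^ p * Θ 0 := by positivity
    have h3 : (0 : ℝ) ≤ q := Nat.cast_nonneg q
    gcongr
    linarith

theorem norm_bumpMultiplier {n : ℕ} (g : ℝ → ℝ) (lam : ℝ) (ξ : Euc n) :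
    ‖bumpMultiplier g lam ξ‖ = (∏ j, (18 * ‖lineFourier g (18 * (lam * ξ j))‖)) *
      (18 * ‖lineFourier g (18 * lam)‖) := by
  rw [bumpMultiplier, norm_mul, norm_prod, norm_mul]
  simp

theorem norm_bumpMultiplier_le {n : ℕ} {g : ℝ → ℝ} (hg : ContDiff ℝ (⊤ : ℕ∞) g)
    (hs : ∀ x, 3 ≤ |x| → g x = 0) (hb : ∀ x, |g x| ≤ 1) (lam : ℝ) (ξ : Euc n) :
    ‖bumpMultiplier g lam ξ‖ ≤ 18 * 108 ^ n * ‖lineFourier g (18 * lam)‖ := by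
  rw [norm_bumpMultiplier]
  have h1 : ∏ j, (18 * ‖lineFourier g (18 * (lam * ξ j))‖) ≤ ∏ _j : Fin n, (108 : ℝ) :=
    Finset.prod_le_prod (fun j _ => by positivity) fun j _ => by
      linarith [norm_lineFourier_le_six hg hs hb (18 * (lam * ξ j))]
  rw [Finset.prod_const, Finset.card_univ, Fintype.card_fin] at h1
  calc _ ≤ 108 ^ n * (18 * ‖lineFourier g (18 * lam)‖) := by gcongr
    _ = _ := by ring

theorem norm_bumpMultiplier_le_mul {n : ℕ} {g : ℝ → ℝ} (hg : ContDiff ℝ (⊤ : ℕ∞) g)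
    (hs : ∀ x, 3 ≤ |x| → g x = 0) (hb : ∀ x, |g x| ≤ 1) (lam : ℝ) (ξ : Euc n) {i : Fin n} {δ : ℝ}
    (hδ : ‖lineFourier g (18 * (lam * ξ i))‖ ≤ 6 * δ) :
    ‖bumpMultiplier g lam ξ‖ ≤ 18 * 108 ^ n * δ * ‖lineFourier g (18 * lam)‖ := by
  rw [norm_bumpMultiplier]
  have h1 : ∏ j ∈ Finset.univ.erase i, (18 * ‖lineFourier g (18 * (lam * ξ j))‖) ≤
      ∏ _j ∈ Finset.univ.erase i, (108 : ℝ) :=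
    Finset.prod_le_prod (fun j _ => by positivity) fun j _ => by
      linarith [norm_lineFourier_le_six hg hs hb (18 * (lam * ξ j))]
  have h2 : (∏ _j ∈ Finset.univ.erase i, (108 : ℝ)) * 108 = 108 ^ n := by
    rw [Finset.prod_erase_mul _ _ (Finset.mem_univ i)]
    simp
  rw [← Finset.prod_erase_mul _ _ (Finset.mem_univ i)]
  calc _ ≤ (∏ _j ∈ Finset.univ.erase i, (108 : ℝ)) * (18 * (6 * δ)) *
        (18 * ‖lineFourier g (18 * lam)‖) := by gcongr
    _ = ((∏ _j ∈ Finset.univ.erase i, (108 : ℝ)) * 108) * δ * (18 * ‖lineFourier g (18 * lam)‖) := by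
      ring
    _ = _ := by
      rw [h2]
      ring

/-! ### Decay of the group Fourier transform of the product bump -/

theorem heisFourier_productBump_eq_inner {n : ℕ} {g : ℝ → ℝ} (hg : ContDiff ℝ (⊤ : ℕ∞) g)
    (hs : ∀ x, 3 ≤ |x| → g x = 0) (hf : Integrable (productBump g : Heis n → ℂ)) (lam : ℝ)
    (φ : L2 n) : heisFourier (productBump g) hf lam φ =ᵐ[volume]
      fun ξ => bumpMultiplier g lam ξ * ⟪(translatedBump hg hs 0 ξ).toLp 2 volume, φ⟫_ℂ := by
  filter_upwards [heisFourier_productBump hg.continuous hf lam φ] with ξ h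
  rw [h, L2.inner_def]
  congr 1
  have h1 : ∫ y : Euc n, ((∏ j, g (y j) : ℝ) : ℂ) * φ (ξ + y) =
      ∫ η : Euc n, ((∏ j, g ((-ξ + η) j) : ℝ) : ℂ) * φ (ξ + (-ξ + η)) :=
    (integral_add_left_eq_self (fun y : Euc n => ((∏ j, g (y j) : ℝ) : ℂ) * φ (ξ + y)) (-ξ)).symm
  rw [h1]
  refine integral_congr_ae ?_
  filter_upwards [(translatedBump hg hs 0 ξ).coeFn_toLp 2 volume] with η h2
  have h3 : ∏ j, g ((-ξ + η) j) = ∏ j, iteratedDeriv ((0 : Fin n → ℕ) j) g (η j - ξ j) :=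
    Finset.prod_congr rfl fun j _ => by simp [neg_add_eq_sub]
  rw [h2, RCLike.inner_apply, translatedBump_apply, Complex.conj_ofReal, add_neg_cancel_left, h3,
    mul_comm]

/-- The geometric mean of the two bounds is at least their minimum. -/
theorem exp_le_exp_add_of_le_of_le {x a b : ℝ} {A : ℝ} (hA : 1 ≤ A) (h1 : x ≤ 6 * Real.exp (-(2 * a)))
    (h2 : x ≤ 6 * A * Real.exp (-(2 * b))) : x ≤ 6 * A * Real.exp (-b) * Real.exp (-a) := by
  rw [mul_assoc, ← Real.exp_add]
  rcases le_total a b with hab | hab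
  · refine h2.trans ?_
    gcongr
    linarith
  · refine h1.trans ?_
    have h3 : Real.exp (-(2 * a)) ≤ Real.exp (-b + -a) := Real.exp_le_exp.2 (by linarith)
    have h4 := Real.exp_pos (-b + -a)
    nlinarith

/-- On functions of energy at least `4 ^ l` the operator `f̂(λ)` is of size
`exp (-|λ| Θ(|λ|)) exp (-m_l)`: where `|λ| ≤ Λ_l / 6` and `|λ ξ_j| ≤ Λ_l / 2`, because `m_l` powers
of `H(λ)` can be moved onto the smooth kernel; elsewhere, because the multiplier is small. -/
theorem norm_heisFourier_productBump_high_le {n : ℕ} (hn : 1 ≤ n) {Θ : ℝ≥0 → ℝ≥0} (hΘ : Antitone Θ)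
    {g : ℝ → ℝ} {p : ℕ} (hg : ContDiff ℝ (⊤ : ℕ∞) g) (hs : ∀ x, 3 ≤ |x| → g x = 0)
    (hpb : ∀ l, p ≤ l → ((2 * dyadicOrder Θ l : ℕ) : ℝ) ≤ dyadicScale n l ∧
        ∀ k ≤ 2 * dyadicOrder Θ l, ∀ x, |iteratedDeriv k g x| ≤ dyadicScale n l ^ k)
    (hf : Integrable (productBump g : Heis n → ℂ)) (lam : ℝ) {l : ℕ} (hl : p ≤ l)
    {S : Finset ℝ} (hS : ∀ μ ∈ S, (4 : ℝ) ^ l ≤ μ) {v : ℝ → L2 n}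
    (hv : ∀ μ, v μ ∈ hermiteEigenspace n lam μ) :
    ‖heisFourier (productBump g) hf lam (∑ μ ∈ S, v μ)‖ ≤ 2 * (volume (cube n 3)).toReal *
      (18 * 108 ^ n * (6 * Real.exp (2 * (2 ^ p * Θ 0))) *
        Real.exp (-(|lam| * Θ |lam|.toNNReal)) * Real.exp (-dyadicOrder Θ l)) *
      ‖∑ μ ∈ S, v μ‖ := by
  have hn' : (1 : ℝ) ≤ n := by exact_mod_cast hn
  set Λ := dyadicScale n l with hΛdef
  have hΛ : 0 < Λ := dyadicScale_pos hn l
  set m := dyadicOrder Θ l with hm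
  set w : ℝ := |lam| * Θ |lam|.toNNReal with hw
  have hw0 : 0 ≤ w := by positivity
  set A : ℝ := Real.exp (2 * (2 ^ p * Θ 0)) with hA
  have hA1 : 1 ≤ A := Real.one_le_exp (by positivity)
  have hb0 : ∀ x, |g x| ≤ 1 := fun x => by simpa using (hpb p le_rfl).2 0 (Nat.zero_le _) x
  have hlam2 : ‖lineFourier g (18 * lam)‖ ≤ 6 * A * Real.exp (-(2 * w)) :=
    norm_lineFourier_dilate_le hn hΘ hg hs (fun l hl => (hpb l hl).2) lam
  have hc := fun ξ => norm_bumpMultiplier_le (n := n) hg hs hb0 lam ξ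
  have hfar : ∀ ζ : ℝ, 3 * Λ ≤ |ζ| → ‖lineFourier g ζ‖ ≤ 6 * Real.exp (-(2 * m)) := fun ζ hζ =>
    norm_lineFourier_le_exp hg hs hΛ ((hpb l hl).2 _ le_rfl) hζ
  have hSob : ∀ ξ : Euc n, SobolevBound Λ {η | η - ξ ∈ cube n 3} (2 * m) 1
      (translatedBump hg hs 0 ξ) := fun ξ => by
    simpa using sobolevBound_translatedBump hg hs (hpb l hl).2 ξ (2 * m) 0 (by simp [hm])
  refine norm_apply_sum_eigenvectors_le (Λ := Λ) (c := bumpMultiplier g lam)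
    (u := fun ξ => translatedBump hg hs 0 ξ)
    (heisFourier_productBump_eq_inner hg hs hf lam) (fun ξ => (hSob ξ).bound) hv
    (by positivity : (0 : ℝ) < 4 ^ l) hS m (by positivity) fun ξ => ?_
  by_cases h1 : Λ / 6 < |lam|
  · -- large `λ`: the factor `ĥ(λ)` is small
    left
    have h2 := hfar (18 * lam) (by
      rw [abs_mul, abs_of_pos (by norm_num : (0 : ℝ) < 18)]
      linarith)
    have h3 := exp_le_exp_add_of_le_of_le hA1 h2 hlam2
    calc ‖bumpMultiplier g lam ξ‖ ≤ 18 * 108 ^ n * ‖lineFourier g (18 * lam)‖ := hc ξ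
      _ ≤ 18 * 108 ^ n * (6 * A * Real.exp (-w) * Real.exp (-m)) := by gcongr
      _ = _ := by ring
  by_cases h2 : ∃ i, Λ / 2 < |lam * ξ i|
  · -- large `λ ξ`: the factor `â(λ ξ)` is small
    left
    obtain ⟨i, hi⟩ := h2
    have h3 := hfar (18 * (lam * ξ i)) (by
      rw [abs_mul, abs_of_pos (by norm_num : (0 : ℝ) < 18)]
      linarith)
    calc ‖bumpMultiplier g lam ξ‖ ≤
          18 * 108 ^ n * Real.exp (-(2 * m)) * ‖lineFourier g (18 * lam)‖ :=
          norm_bumpMultiplier_le_mul hg hs hb0 lam ξ h3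
      _ ≤ 18 * 108 ^ n * Real.exp (-m) * (6 * A * Real.exp (-w)) := by
          have h4 : (0 : ℝ) ≤ m := Nat.cast_nonneg m
          have h5 : ‖lineFourier g (18 * lam)‖ ≤ 6 * A * Real.exp (-w) :=
            hlam2.trans (by gcongr; linarith)
          gcongr
          linarith
      _ = _ := by ring
  · -- the kernel is supported where `|λ η_i| ≤ Λ`
    right
    rw [not_lt] at h1
    push Not at h2
    have hR : ∀ η ∈ {η : Euc n | η - ξ ∈ cube n 3}, ∀ i, |lam * η i| ≤ Λ := by
      intro η hη i
      have h3 : |η i - ξ i| ≤ 3 := hη i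
      have h4 : lam * η i = lam * ξ i + lam * (η i - ξ i) := by ring
      rw [h4]
      refine (abs_add_le _ _).trans ?_
      rw [abs_mul lam (η i - ξ i)]
      have h5 : |lam| * |η i - ξ i| ≤ Λ / 6 * 3 := by gcongr
      linarith [h2 i]
    have h6 : ((2 * m : ℕ) : ℝ) * |lam| ≤ Λ ^ 2 := by
      calc ((2 * m : ℕ) : ℝ) * |lam| ≤ Λ * (Λ / 6) := by
            gcongr
            exact (hpb l hl).1
        _ ≤ Λ ^ 2 := by nlinarith
    refine ⟨_, (hSob ξ).hermiteOp_iterate hΛ hR h6, ?_⟩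
    have h7 : (5 * n * Λ ^ 2) ^ m ≤ Real.exp (-m) * ((4 : ℝ) ^ l) ^ m := by
      have h8 : 5 * n * Λ ^ 2 ≤ Real.exp (-1) * 4 ^ l := by
        have h9 : Λ ^ 2 = 4 ^ l / (16 * n ^ 2) := by
          rw [hΛdef, dyadicScale, div_pow, ← pow_mul, mul_comm l 2, pow_mul]
          norm_num
          ring
        have h10 : (1 / 3 : ℝ) ≤ Real.exp (-1) := by
          rw [Real.exp_neg, one_div]
          exact inv_anti₀ (Real.exp_pos 1) (by linarith [Real.exp_one_lt_d9])
        calc 5 * n * Λ ^ 2 = 5 / 16 / n * 4 ^ l := by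
              rw [h9]
              field_simp
          _ ≤ 1 / 3 * 4 ^ l := by
              refine mul_le_mul_of_nonneg_right ?_ (by positivity)
              rw [div_le_iff₀ (by linarith)]
              linarith
          _ ≤ _ := by gcongr
      calc (5 * n * Λ ^ 2) ^ m ≤ (Real.exp (-1) * 4 ^ l) ^ m := by gcongr
        _ = _ := by
          rw [mul_pow, ← Real.exp_nat_mul]
          ring_nf
    calc ‖bumpMultiplier g lam ξ‖ * ((5 * n * Λ ^ 2) ^ m * 1)
        ≤ (18 * 108 ^ n * (6 * A * Real.exp (-w))) * (Real.exp (-m) * ((4 : ℝ) ^ l) ^ m) := by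
          rw [mul_one]
          have h11 : ‖lineFourier g (18 * lam)‖ ≤ 6 * A * Real.exp (-w) :=
            hlam2.trans (by gcongr; linarith)
          have h12 := (hc ξ).trans (mul_le_mul_of_nonneg_left h11 (by positivity))
          gcongr
      _ = _ := by ring

/-- The bound without gain in the energy, needed for the finitely many blocks below `4 ^ p`. -/
theorem norm_heisFourier_productBump_le {n : ℕ} (hn : 1 ≤ n) {Θ : ℝ≥0 → ℝ≥0} (hΘ : Antitone Θ)
    {g : ℝ → ℝ} {p : ℕ} (hg : ContDiff ℝ (⊤ : ℕ∞) g) (hs : ∀ x, 3 ≤ |x| → g x = 0)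
    (hpb : ∀ l, p ≤ l → ((2 * dyadicOrder Θ l : ℕ) : ℝ) ≤ dyadicScale n l ∧
        ∀ k ≤ 2 * dyadicOrder Θ l, ∀ x, |iteratedDeriv k g x| ≤ dyadicScale n l ^ k)
    (hf : Integrable (productBump g : Heis n → ℂ)) (lam : ℝ) (φ : L2 n) :
    ‖heisFourier (productBump g) hf lam φ‖ ≤ 2 * (volume (cube n 3)).toReal *
      (18 * 108 ^ n * (6 * Real.exp (2 * (2 ^ p * Θ 0))) *
        Real.exp (-(|lam| * Θ |lam|.toNNReal))) * ‖φ‖ := by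
  have hb0 : ∀ x, |g x| ≤ 1 := fun x => by simpa using (hpb p le_rfl).2 0 (Nat.zero_le _) x
  have hSob : ∀ ξ : Euc n, SobolevBound 1 {η | η - ξ ∈ cube n 3} 0 1
      (translatedBump hg hs 0 ξ) := fun ξ => by
    simpa using sobolevBound_translatedBump hg hs (Λ := 1) (M := 0)
      (fun k hk x => by simpa [Nat.le_zero.1 hk] using hb0 x) ξ 0 0 (by simp)
  refine norm_apply_le_of_inner_hermiteOp_iterate (lam := lam) (Λ := 1) (c := bumpMultiplier g lam)
    (u := fun ξ => translatedBump hg hs 0 ξ) (heisFourier_productBump_eq_inner hg hs hf lam) hSob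
    one_pos 0 (φ' := φ) le_rfl (fun w => by simp) (by positivity) fun ξ => Or.inl ?_
  have h1 := norm_lineFourier_dilate_le hn hΘ hg hs (fun l hl => (hpb l hl).2) lam
  have h2 : (0 : ℝ) ≤ |lam| * Θ |lam|.toNNReal := by positivity
  calc ‖bumpMultiplier g lam ξ‖ ≤ 18 * 108 ^ n * ‖lineFourier g (18 * lam)‖ :=
        norm_bumpMultiplier_le hg hs hb0 lam ξ
    _ ≤ 18 * 108 ^ n * (6 * Real.exp (2 * (2 ^ p * Θ 0)) *
          Real.exp (-(|lam| * Θ |lam|.toNNReal))) := by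
        gcongr
        exact h1.trans (mul_le_mul_of_nonneg_left (Real.exp_le_exp.2 (by linarith))
          (by positivity))
    _ = _ := by ring

/-- The index `l` of the dyadic block `[4 ^ l, 4 ^ (l + 1))` that contains `μ ≥ 1`; the block of
index `0` also takes up all `μ < 1`. -/
noncomputable def energyBlock (μ : ℝ) : ℕ := Nat.log 4 ⌊μ⌋₊

theorem lt_of_energyBlock (μ : ℝ) : μ < 4 ^ (energyBlock μ + 1) := by
  have h1 : ⌊μ⌋₊ + 1 ≤ 4 ^ (energyBlock μ + 1) := Nat.lt_pow_succ_log_self (by norm_num) _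
  calc μ < ⌊μ⌋₊ + 1 := Nat.lt_floor_add_one μ
    _ ≤ 4 ^ (energyBlock μ + 1) := by exact_mod_cast h1

theorem le_of_energyBlock {μ : ℝ} (h : energyBlock μ ≠ 0) : 4 ^ energyBlock μ ≤ μ := by
  have h0 : ⌊μ⌋₊ ≠ 0 := fun h0 => h (by rw [energyBlock, h0, Nat.log_zero_right])
  have h1 : 4 ^ energyBlock μ ≤ ⌊μ⌋₊ := Nat.pow_log_le_self 4 h0
  have hμ : 0 ≤ μ := by
    by_contra hneg
    exact h0 (Nat.floor_of_nonpos (not_le.1 hneg).le)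
  calc (4 : ℝ) ^ energyBlock μ ≤ ⌊μ⌋₊ := by exact_mod_cast h1
    _ ≤ μ := Nat.floor_le hμ

theorem norm_sum_eigenvectors_le_exp_mul {n : ℕ} {lam : ℝ} (Θ : ℝ≥0 → ℝ≥0) {S : Finset ℝ}
    {v : ℝ → L2 n} (hv : ∀ μ, v μ ∈ hermiteEigenspace n lam μ) {b : ℝ}
    (hb : ∀ μ ∈ S, √μ * Θ (√μ).toNNReal ≤ b) :
    ‖∑ μ ∈ S, v μ‖ ≤ Real.exp b * √(∑ μ ∈ S, inghamSymbol Θ μ * ‖v μ‖ ^ 2) := by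
  refine abs_le_of_sq_le_sq' ?_ (by positivity) |>.2
  have h0 : 0 ≤ ∑ μ ∈ S, inghamSymbol Θ μ * ‖v μ‖ ^ 2 :=
    Finset.sum_nonneg fun μ _ => mul_nonneg (Real.exp_pos _).le (by positivity)
  rw [norm_sq_sum_eigenvectors S hv, mul_pow, Real.sq_sqrt h0, Finset.mul_sum,
    ← Real.exp_nat_mul]
  refine Finset.sum_le_sum fun μ hμ => ?_
  rw [inghamSymbol, ← mul_assoc, ← Real.exp_add]
  refine le_mul_of_one_le_left (by positivity) (Real.one_le_exp ?_)
  push_cast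
  linarith [hb μ hμ]

/-- The bound on a single dyadic block of energies `μ`: the gain `exp (-m_l)` beats
`exp (√μ Θ(√μ)) ≤ exp (m_l - l)` by the factor `exp (-l)`. -/
theorem exists_norm_heisFourier_block_le {n : ℕ} (hn : 1 ≤ n) {Θ : ℝ≥0 → ℝ≥0} (hΘ : Antitone Θ)
    {g : ℝ → ℝ} {p : ℕ} (hp : 1 ≤ p) (hg : ContDiff ℝ (⊤ : ℕ∞) g) (hs : ∀ x, 3 ≤ |x| → g x = 0)
    (hpb : ∀ l, p ≤ l → ((2 * dyadicOrder Θ l : ℕ) : ℝ) ≤ dyadicScale n l ∧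
        ∀ k ≤ 2 * dyadicOrder Θ l, ∀ x, |iteratedDeriv k g x| ≤ dyadicScale n l ^ k)
    (hf : Integrable (productBump g : Heis n → ℂ)) :
    ∃ C : ℝ, 0 ≤ C ∧ ∀ (lam : ℝ) (l : ℕ) (S : Finset ℝ) (v : ℝ → L2 n),
      (∀ μ, v μ ∈ hermiteEigenspace n lam μ) → (∀ μ ∈ S, energyBlock μ = l) →
      ‖heisFourier (productBump g) hf lam (∑ μ ∈ S, v μ)‖ ≤
        C * Real.exp (-(|lam| * Θ |lam|.toNNReal)) * Real.exp (-l) *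
          √(∑ μ ∈ S, inghamSymbol Θ μ * ‖v μ‖ ^ 2) := by
  set b : ℝ := 2 ^ p * Θ 0 with hb
  have hb0 : 0 ≤ b := by positivity
  set K : ℝ := 2 * (volume (cube n 3)).toReal * (18 * 108 ^ n * (6 * Real.exp (2 * b))) with hK
  have hK0 : 0 ≤ K := by positivity
  refine ⟨K * Real.exp (b + p), by positivity, fun lam l S v hv hSl => ?_⟩
  set w : ℝ := |lam| * Θ |lam|.toNNReal with hw
  have hpow : ∀ l : ℕ, √((4 : ℝ) ^ l) = 2 ^ l := fun l => by
    rw [show (4 : ℝ) = 2 ^ 2 by norm_num, ← pow_mul, mul_comm, pow_mul, Real.sqrt_sq (by positivity)]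
  set X := √(∑ μ ∈ S, inghamSymbol Θ μ * ‖v μ‖ ^ 2) with hX
  have hX0 : 0 ≤ X := Real.sqrt_nonneg _
  have hμ2 : ∀ μ ∈ S, √μ ≤ 2 ^ (l + 1) := fun μ hμ => by
    rw [← hpow, ← hSl μ hμ]
    exact Real.sqrt_le_sqrt (lt_of_energyBlock μ).le
  rcases lt_or_ge l p with hl | hl
  · have h1 : ∀ μ ∈ S, √μ * Θ (√μ).toNNReal ≤ b := fun μ hμ => by
      have h2 : √μ ≤ 2 ^ p :=
        (hμ2 μ hμ).trans (pow_le_pow_right₀ one_le_two hl)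
      have h3 : (Θ (√μ).toNNReal : ℝ) ≤ Θ 0 := by exact_mod_cast hΘ zero_le
      rw [hb]
      gcongr
    have h4 := norm_sum_eigenvectors_le_exp_mul Θ hv h1
    have h5 : 1 ≤ Real.exp p * Real.exp (-l) := by
      rw [← Real.exp_add]
      have : (l : ℝ) ≤ p := by exact_mod_cast hl.le
      exact Real.one_le_exp (by linarith)
    calc _ ≤ K * Real.exp (-w) * ‖∑ μ ∈ S, v μ‖ :=
          (norm_heisFourier_productBump_le hn hΘ hg hs hpb hf lam _).trans (le_of_eq (by
            rw [hK]
            ring))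
      _ ≤ K * Real.exp (-w) * (Real.exp b * X) * (Real.exp p * Real.exp (-l)) := by
          refine (mul_le_mul_of_nonneg_left h4 (by positivity)).trans ?_
          exact le_mul_of_one_le_right (by positivity) h5
      _ = _ := by
          rw [Real.exp_add]
          ring
  · have hl0 : l ≠ 0 := by omega
    have hμ1 : ∀ μ ∈ S, (4 : ℝ) ^ l ≤ μ := fun μ hμ => by
      have h1 := hSl μ hμ
      have h2 := le_of_energyBlock (μ := μ) (by rw [h1]; exact hl0)
      rwa [h1] at h2
    have h1 : ∀ μ ∈ S, √μ * Θ (√μ).toNNReal ≤ (dyadicOrder Θ l - l : ℝ) := fun μ hμ => by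
      refine mul_le_dyadicOrder hΘ ?_ (hμ2 μ hμ)
      rw [← hpow]
      exact Real.sqrt_le_sqrt (hμ1 μ hμ)
    have h4 := norm_sum_eigenvectors_le_exp_mul Θ hv h1
    calc _ ≤ K * Real.exp (-w) * Real.exp (-dyadicOrder Θ l) * ‖∑ μ ∈ S, v μ‖ :=
          (norm_heisFourier_productBump_high_le hn hΘ hg hs hpb hf lam hl hμ1 hv).trans
            (le_of_eq (by
              rw [hK]
              ring))
      _ ≤ K * Real.exp (-w) * Real.exp (-dyadicOrder Θ l) *
            (Real.exp (dyadicOrder Θ l - l : ℝ) * X) := by gcongr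
      _ = K * Real.exp (-w) * Real.exp (-l) * X * 1 := by
          have : Real.exp (-(dyadicOrder Θ l : ℝ)) * Real.exp (dyadicOrder Θ l - l : ℝ) =
              Real.exp (-l) := by
            rw [← Real.exp_add]
            ring_nf
          rw [← this]
          ring
      _ ≤ K * Real.exp (-w) * Real.exp (-l) * X * Real.exp (b + p) := by
          gcongr
          exact Real.one_le_exp (by positivity)
      _ = _ := by ring

/-- The dyadic blocks are summed with the help of the factors `exp (-l)`. -/
theorem exists_norm_heisFourier_sum_le {n : ℕ} (hn : 1 ≤ n) {Θ : ℝ≥0 → ℝ≥0} (hΘ : Antitone Θ)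
    {g : ℝ → ℝ} {p : ℕ} (hp : 1 ≤ p) (hg : ContDiff ℝ (⊤ : ℕ∞) g) (hs : ∀ x, 3 ≤ |x| → g x = 0)
    (hpb : ∀ l, p ≤ l → ((2 * dyadicOrder Θ l : ℕ) : ℝ) ≤ dyadicScale n l ∧
        ∀ k ≤ 2 * dyadicOrder Θ l, ∀ x, |iteratedDeriv k g x| ≤ dyadicScale n l ^ k)
    (hf : Integrable (productBump g : Heis n → ℂ)) :
    ∃ C : ℝ, 0 ≤ C ∧ ∀ (lam : ℝ) (S : Finset ℝ) (v : ℝ → L2 n),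
      (∀ μ, v μ ∈ hermiteEigenspace n lam μ) →
      ‖heisFourier (productBump g) hf lam (∑ μ ∈ S, v μ)‖ ≤
        C * Real.exp (-(|lam| * Θ |lam|.toNNReal)) *
          √(∑ μ ∈ S, inghamSymbol Θ μ * ‖v μ‖ ^ 2) := by
  obtain ⟨C, hC, h⟩ := exists_norm_heisFourier_block_le hn hΘ hp hg hs hpb hf
  have hexp : Summable fun l : ℕ => Real.exp (-(l : ℝ)) := Real.summable_exp_neg_nat
  refine ⟨C * ∑' l : ℕ, Real.exp (-(l : ℝ)),
    mul_nonneg hC (tsum_nonneg fun _ => (Real.exp_pos _).le), fun lam S v hv => ?_⟩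
  set w : ℝ := |lam| * Θ |lam|.toNNReal with hw
  have hnn : ∀ μ, 0 ≤ inghamSymbol Θ μ * ‖v μ‖ ^ 2 := fun μ =>
    mul_nonneg (Real.exp_pos _).le (by positivity)
  rw [← Finset.sum_fiberwise_of_maps_to (g := energyBlock) (t := S.image energyBlock)
    (fun μ hμ => Finset.mem_image_of_mem _ hμ), map_sum]
  calc _ ≤ ∑ l ∈ S.image energyBlock, C * Real.exp (-w) * Real.exp (-(l : ℝ)) *
          √(∑ μ ∈ S, inghamSymbol Θ μ * ‖v μ‖ ^ 2) := by
        refine norm_sum_le_of_le _ fun l _ => ?_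
        refine (h lam l _ v hv fun μ hμ => (Finset.mem_filter.1 hμ).2).trans ?_
        gcongr
        · exact fun μ _ _ => hnn μ
        · exact Finset.filter_subset _ S
    _ = C * (∑ l ∈ S.image energyBlock, Real.exp (-(l : ℝ))) * Real.exp (-w) *
          √(∑ μ ∈ S, inghamSymbol Θ μ * ‖v μ‖ ^ 2) := by
        rw [← Finset.sum_mul, ← Finset.mul_sum]
        ring
    _ ≤ _ := by
        gcongr
        exact hexp.sum_le_tsum _ fun _ _ => (Real.exp_pos _).le

theorem inghamDecay_productBump {n : ℕ} (hn : 1 ≤ n) {Θ : ℝ≥0 → ℝ≥0} (hΘ : Antitone Θ)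
    {g : ℝ → ℝ} {p : ℕ} (hp : 1 ≤ p) (hg : ContDiff ℝ (⊤ : ℕ∞) g) (hs : ∀ x, 3 ≤ |x| → g x = 0)
    (hpb : ∀ l, p ≤ l → ((2 * dyadicOrder Θ l : ℕ) : ℝ) ≤ dyadicScale n l ∧
        ∀ k ≤ 2 * dyadicOrder Θ l, ∀ x, |iteratedDeriv k g x| ≤ dyadicScale n l ^ k)
    (hf : Integrable (productBump g : Heis n → ℂ)) : InghamDecay Θ (productBump g) hf := by
  obtain ⟨C, hC, h⟩ := exists_norm_heisFourier_sum_le hn hΘ hp hg hs hpb hf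
  refine ⟨C ^ 2, fun lam hlam => ?_⟩
  set T := heisFourier (productBump g) hf lam with hT
  set w : ℝ := |lam| * Θ |lam|.toNNReal with hw
  set H := hermiteCalculus n lam (inghamSymbol Θ) (inghamSymbol_bounded Θ) with hH
  have hexp : Real.exp (-2 * |lam| * Θ |lam|.toNNReal) = Real.exp (-w) ^ 2 := by
    rw [← Real.exp_nat_mul]
    congr 1
    push_cast
    ring
  have hbd : ∀ φ : L2 n, ‖T φ‖ ^ 2 ≤ C ^ 2 * Real.exp (-w) ^ 2 * RCLike.re ⟪φ, H φ⟫_ℂ := by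
    intro φ
    have hre := hasSum_re_inner_hermiteCalculus n lam _ (inghamSymbol_bounded Θ) φ
    -- finite sums of eigenvectors approximate `φ`
    have hle : ‖T φ‖ ≤ C * Real.exp (-w) * √(RCLike.re ⟪φ, H φ⟫_ℂ) := by
      refine le_of_tendsto ((T.continuous.tendsto φ).comp
        (hasSum_starProjection_hermiteEigenspace hn hlam φ)).norm (Eventually.of_forall fun S => ?_)
      refine (h lam S _ fun μ => Submodule.starProjection_apply_mem _ φ).trans ?_
      gcongr
      exact sum_le_hasSum S (fun μ _ =>
        mul_nonneg (Real.exp_pos _).le (spectralMass_nonneg lam φ μ)) hre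
    calc ‖T φ‖ ^ 2 ≤ (C * Real.exp (-w) * √(RCLike.re ⟪φ, H φ⟫_ℂ)) ^ 2 := by gcongr
      _ = _ := by
        rw [mul_pow, mul_pow, Real.sq_sqrt (re_inner_inghamSymbol_nonneg Θ lam φ)]
  rw [ContinuousLinearMap.le_def, ContinuousLinearMap.isPositive_iff_complex]
  intro φ
  have him : ⟪φ, H φ⟫_ℂ = ((RCLike.re ⟪φ, H φ⟫_ℂ : ℝ) : ℂ) := by
    have h1 := hasSum_inner_hermiteCalculus n lam _ (inghamSymbol_bounded Θ) φ
    have h2 := Complex.hasSum_ofReal.2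
      (hasSum_re_inner_hermiteCalculus n lam _ (inghamSymbol_bounded Θ) φ)
    exact h1.unique h2
  have hval : ⟪(((C ^ 2 * Real.exp (-2 * |lam| * Θ |lam|.toNNReal) : ℝ) : ℂ) • H -
      T.adjoint ∘L T) φ, φ⟫_ℂ =
      ((C ^ 2 * Real.exp (-w) ^ 2 * RCLike.re ⟪φ, H φ⟫_ℂ - ‖T φ‖ ^ 2 : ℝ) : ℂ) := by
    rw [hexp, _root_.sub_apply, inner_sub_left, _root_.smul_apply, inner_smul_left,
      ContinuousLinearMap.comp_apply, ContinuousLinearMap.adjoint_inner_left,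
      inner_self_eq_norm_sq_to_K, Complex.conj_ofReal, ← inner_conj_symm, him, Complex.conj_ofReal]
    push_cast
    rfl
  rw [hval]
  refine ⟨by rw [RCLike.re_eq_complex_re, Complex.ofReal_re], ?_⟩
  rw [RCLike.re_eq_complex_re, Complex.ofReal_re, sub_nonneg]
  exact hbd φ

/-- If `∑ Θ(2^k)` converges, there is a nonzero function with the decay condition. -/
theorem exists_inghamDecay_of_summable {n : ℕ} (hn : 1 ≤ n) {Θ : ℝ≥0 → ℝ≥0} (hΘ : Antitone Θ)
    (hsum : Summable fun k : ℕ => (Θ ((2 : ℝ) ^ k).toNNReal : ℝ)) :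
    ∃ (f : Heis n → ℂ) (hc : Continuous f) (hs : HasCompactSupport f), f ≠ 0 ∧
      InghamDecay Θ f (hc.integrable_of_hasCompactSupport hs) := by
  obtain ⟨p, g, hp, hg, hg0, hs, hpb⟩ := exists_dyadic_bump hn hsum
  exact ⟨productBump g, continuous_productBump hg.continuous, hasCompactSupport_productBump hs,
    productBump_ne_zero hg0, inghamDecay_productBump hn hΘ hp hg hs hpb _⟩

theorem theorem1p7 (n : ℕ) (hn : 1 ≤ n) (Θ : ℝ≥0 → ℝ≥0) (hΘ : Antitone Θ)
    (hΘ0 : Tendsto Θ atTop (𝓝 0)) :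
    (∃ (f : Heis n → ℂ) (hc : Continuous f) (hs : HasCompactSupport f), f ≠ 0 ∧
      InghamDecay Θ f (hc.integrable_of_hasCompactSupport hs)) ↔
    IntegrableOn (fun t : ℝ => (Θ t.toNNReal : ℝ) / t) (Set.Ici 1) := by
  have hq : Antitone fun x : ℝ => (Θ x.toNNReal : ℝ) := fun x y hxy => by
    exact_mod_cast hΘ (Real.toNNReal_le_toNNReal hxy)
  rw [integrableOn_div_iff_summable_dyadic hq fun x => NNReal.coe_nonneg _]
  constructor
  · rintro ⟨f, hc, hs, hf, h⟩
    exact summable_of_inghamDecay hn Θ hΘ hc hs hf h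
  · exact exists_inghamDecay_of_summable hn hΘ
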